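/- **Theorem 2 ($L^p$-estimates for the resolvent).** Let $d\ge 1$, and let $Z=(Z_t)_{t\ge 0}$ be an $\mathbb R^d$-valued symmetric stable process of order $\alpha=1$, defined on some probability space, with finite spectral measure $\mu$ on the unit sphere $\mathbb S^{d-1}$. That is, $Z$ is a càdlàg process with $Z_0=0$ a.s. and with independent increments such that, for all $0\le s\le t$ and $\zeta\in\mathbb R^d$, $$\mathbb E\big[e^{i\langle \zeta, Z_t-Z_s\rangle}\big]=\exp\Big(-(t-s)\int_{\mathbb S^{d-1}}|\langle \zeta,\theta\rangle|\,\mu(d\theta)\Big).$$ Assume the non-degeneracy condition (ND): there is $\kappa\ge 1$ such that $$\kappa^{-1}|\zeta|\le \int_{\mathbb S^{d-1}}|\langle \zeta,\theta\rangle|\,\mu(d\theta)\le \kappa|\zeta|\qquad\text{for all }\zeta\in\mathbb R^d .$$ Let $b_0\in\mathbb R^d$. For $x\in\mathbb R^d$ set $\tilde X^x_t=x+b_0t+Z_t$, and for $\lambda>0$ and $f\in C_0^\infty(\mathbb R^d)$ (real-valued, smooth, with compact support) let $$\tilde R^\lambda f(x)=\int_0^{\infty}e^{-\lambda t}\,\mathbb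 E\big[f(\tilde X^x_t)\big]\,dt ,\qquad x\in\mathbb R^d .$$ Then for every $p\in(1,\infty)$ there is a constant $C=C(p,\kappa,d,|b_0|)>0$, depending only on $p$, $\kappa$, $d$ and $|b_0|$, such that for all $\lambda>0$ and all $f\in C_0^\infty(\mathbb R^d)$ the function $\tilde R^\lambda f$ is differentiable on $\mathbb R^d$ and $$\|D\tilde R^\lambda f\|_{L^p(\mathbb R^d)}\le C\,(1+\lambda^{-1})\,\|f\|_{L^p(\mathbb R^d)} .$$ -/

import Mathlib

open MeasureTheory ProbabilityTheory Filter Topology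
open scoped NNReal ENNReal RealInnerProductSpace

/-- The function `ζ ↦ ∫_{S^{d-1}} |⟨ζ, θ⟩| μ(dθ)` attached to a measure `μ` on the unit sphere of
`ℝᵈ`. -/
noncomputable def spectralExponent {d : ℕ}
    (μ : Measure (Metric.sphere (0 : EuclideanSpace ℝ (Fin d)) 1))
    (ζ : EuclideanSpace ℝ (Fin d)) : ℝ :=
  ∫ θ, |⟪ζ, (θ : EuclideanSpace ℝ (Fin d))⟫| ∂μ

/-- The non-degeneracy condition on the spectral measure `μ`, with constant `κ ≥ 1`:
`κ⁻¹ |ζ| ≤ ∫_{S^{d-1}} |⟨ζ, θ⟩| μ(dθ) ≤ κ |ζ|` for all `ζ`. -/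
def SpectralNondegenerate {d : ℕ} (κ : ℝ)
    (μ : Measure (Metric.sphere (0 : EuclideanSpace ℝ (Fin d)) 1)) : Prop :=
  1 ≤ κ ∧ ∀ ζ : EuclideanSpace ℝ (Fin d),
    κ⁻¹ * ‖ζ‖ ≤ spectralExponent μ ζ ∧ spectralExponent μ ζ ≤ κ * ‖ζ‖

/-- A path `ℝ₊ → E` is càdlàg: right-continuous with left limits. -/
def IsCadlagPath {E : Type*} [TopologicalSpace E] (z : ℝ≥0 → E) : Prop :=
  ∀ t : ℝ≥0, ContinuousWithinAt z (Set.Ici t) t ∧ ∃ l : E, Tendsto z (𝓝[<] t) (𝓝 l)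

/-- `Z` is a `d`-dimensional symmetric stable (Lévy) process of order `α = 1` with spectral
measure `μ`: it starts at `0`, has càdlàg paths and independent increments, and the increment
`Z_t - Z_s`, `s ≤ t`, has the symmetric `1`-stable law with characteristic function
`ζ ↦ exp (-(t - s) ∫_{S^{d-1}} |⟨ζ, θ⟩| μ(dθ))` (in particular the increments are stationary). -/
structure IsSymmetricOneStableProcess {d : ℕ}
    (μ : Measure (Metric.sphere (0 : EuclideanSpace ℝ (Fin d)) 1))
    {Ω : Type*} [MeasurableSpace Ω] (P : Measure Ω)
    (Z : ℝ≥0 → Ω → EuclideanSpace ℝ (Fin d)) : Prop where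
  measurable : ∀ t, Measurable (Z t)
  zero : ∀ᵐ ω ∂P, Z 0 ω = 0
  cadlag : ∀ᵐ ω ∂P, IsCadlagPath fun t ↦ Z t ω
  indep : HasIndepIncrements Z P
  charFun_increment : ∀ s t : ℝ≥0, s ≤ t → ∀ ζ : EuclideanSpace ℝ (Fin d),
    charFun (P.map fun ω ↦ Z t ω - Z s ω) ζ
      = ((Real.exp (-((t : ℝ) - (s : ℝ)) * spectralExponent μ ζ) : ℝ) : ℂ)

/-- The frozen process `X̃ˣ_t = x + b₀ t + Z_t`. -/
noncomputable def frozenProcess {d : ℕ} {Ω : Type*} (b₀ : EuclideanSpace ℝ (Fin d))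
    (Z : ℝ≥0 → Ω → EuclideanSpace ℝ (Fin d)) (x : EuclideanSpace ℝ (Fin d))
    (t : ℝ≥0) (ω : Ω) : EuclideanSpace ℝ (Fin d) :=
  x + (t : ℝ) • b₀ + Z t ω

/-- The resolvent of the frozen process,
`R̃^λ f (x) = ∫_0^∞ exp(-λ t) E[f(X̃ˣ_t)] dt`. -/
noncomputable def frozenResolvent {d : ℕ} {Ω : Type*} [MeasurableSpace Ω] (P : Measure Ω)
    (b₀ : EuclideanSpace ℝ (Fin d)) (Z : ℝ≥0 → Ω → EuclideanSpace ℝ (Fin d)) (lam : ℝ)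
    (f : EuclideanSpace ℝ (Fin d) → ℝ) (x : EuclideanSpace ℝ (Fin d)) : ℝ :=
  ∫ t in Set.Ioi (0 : ℝ),
    Real.exp (-lam * t) * ∫ ω, f (frozenProcess b₀ Z x t.toNNReal ω) ∂P

/-! ### Stopping balls -/

section CalderonZygmund

open Metric Module

variable {E : Type*} [NormedAddCommGroup E] [InnerProductSpace ℝ E] [FiniteDimensional ℝ E]
  [MeasurableSpace E] [BorelSpace E]

/-! The exponent `ψ = spectralExponent μ` is homogeneous of degree one, so `Z t + t • b₀` has the
law of `t • w`, where `w` follows the law `L` of `Z 1 + b₀`. Hence the derivative of the resolvent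
in a direction `v` is `∫_0^∞ e^{-λt} ∫ ∂_v f(x + t w) L(dw) dt`. If `L` had a nice density `ℓ`,
integrating by parts in `w` would turn this into the convolution of `f` with `-∫ e^{-λt} t^{-d-1}
(∂_v ℓ)(-y/t) dt`. This superposes, against `dt/t`, the mass-preserving dilates of a profile with
mean zero, and such a superposition is a Calderón–Zygmund kernel. In the kernel bounds the
exponential enters only through `e^{-λt} ≤ 1`, so they do not depend on `λ`.

The difficulty is that `μ` may be singular: `ψ` is then not smooth away from the origin and a
density of `L` has no good decay. The remedy is a factorization `L = q * m`. Let `ψ₁` be `ψ`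
mollified at unit scale. The symbol `exp (ψ₁ 0 - ψ₁)` is smooth and decays exponentially, so it is
the characteristic function of a Schwartz function `q`, with seminorms controlled by `κ` and `d`.
The formula `c |s| = ∫ (1 - cos (x s)) / x² dx` exhibits `ψ₁ - ψ` as the Fourier transform of a
finite positive measure. Thus `exp (ψ₁ - ψ₁ 0 - ψ)` belongs to a compound Poisson law, and
translation by `b₀` gives `m` (`exists_compensating_law`). Only tails of order `1/R` are needed of
`m`, and these follow from the behaviour of its characteristic function near the origin.

The kernel built from `∂_v q` and `m`, truncated to `ε < t < N`, is integrable and represents the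
truncated gradient (`kernelConv_dilatedKernel`). Its Hörmander constant
(`hormanderBound_dilatedKernel`) and the supremum of its Fourier transform
(`norm_fourier_dilatedKernel_le`) are bounded uniformly in `λ`, `ε` and `N`. The Calderón–Zygmund
theorem (`exists_lintegral_kernelConv_rpow_le`) then gives the `Lᵖ` bound, and Fatou's lemma removes
the truncation. -/

theorem volume_closedBall_mul (x : E) {a r : ℝ} (ha : 0 ≤ a) (hr : 0 ≤ r) :
    volume (closedBall x (a * r))
      = ENNReal.ofReal (a ^ finrank ℝ E) * volume (closedBall x r) := by
  rw [Measure.addHaar_closedBall_mul _ _ ha hr, Measure.addHaar_closedBall_center volume x]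

/-- Calderón–Zygmund stopping balls: disjoint balls on which the average of `‖f‖` is at least `l`,
whose fivefold enlargements have average at most `l` and cover `{‖f‖ > l}` up to a null set. -/
theorem exists_stopping_balls [Nontrivial E] {f : E → ℂ} (hf : Integrable f) {l : ℝ} (hl : 0 < l) :
    ∃ (u : Set E) (r : E → ℝ), u.Countable ∧ (∀ c ∈ u, 0 < r c) ∧
      (u.PairwiseDisjoint fun c ↦ closedBall c (r c)) ∧
      (∀ c ∈ u, ENNReal.ofReal l * volume (closedBall c (r c))
        ≤ ∫⁻ y in closedBall c (r c), ‖f y‖ₑ) ∧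
      (∀ c ∈ u, ∫⁻ y in closedBall c (5 * r c), ‖f y‖ₑ
        ≤ ENNReal.ofReal l * volume (closedBall c (5 * r c))) ∧
      ∀ᵐ x, x ∉ ⋃ c ∈ u, closedBall c (5 * r c) → ‖f x‖ₑ ≤ ENNReal.ofReal l := by
  set S : E → Set ℝ := fun x ↦ {r | 0 < r ∧ ENNReal.ofReal l * volume (closedBall x r)
    < ∫⁻ y in closedBall x r, ‖f y‖ₑ} with hS
  have hfin : ∫⁻ y, ‖f y‖ₑ ≠ ∞ := hf.2.ne
  -- An integrable function has average at most a constant over `r ^ finrank`, so its average cannot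
  -- exceed `l` on large balls. The maximum with `1` allows `r ≤ r ^ finrank`.
  obtain ⟨R, hR0, hR⟩ : ∃ R : ℝ, 0 ≤ R ∧ ∀ x, ∀ r ∈ S x, r ≤ R := by
    have hd : 0 < finrank ℝ E := finrank_pos
    set v := volume (closedBall (0 : E) 1)
    have hv0 : v ≠ 0 := (measure_closedBall_pos _ _ one_pos).ne'
    have hvt : v ≠ ∞ := measure_closedBall_lt_top.ne
    set J := (∫⁻ y, ‖f y‖ₑ).toReal
    refine ⟨max 1 (J / (l * v.toReal)), by positivity, fun x r hr ↦ ?_⟩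
    by_contra! hlt
    have h1 : 1 < r := (le_max_left _ _).trans_lt hlt
    have h2 : J / (l * v.toReal) < r := (le_max_right _ _).trans_lt hlt
    have hv : 0 < v.toReal := ENNReal.toReal_pos hv0 hvt
    rw [div_lt_iff₀ (by positivity)] at h2
    have h3 : ENNReal.ofReal l * volume (closedBall x r) < ENNReal.ofReal J := by
      rw [ENNReal.ofReal_toReal hfin]
      exact hr.2.trans_le (setLIntegral_le_lintegral _ _)
    have h4 : volume (closedBall x r) = ENNReal.ofReal (r ^ finrank ℝ E) * v := by
      have := volume_closedBall_mul x (by linarith : 0 ≤ r) zero_le_one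
      rwa [mul_one, Measure.addHaar_closedBall_center volume x 1] at this
    rw [h4, ← ENNReal.ofReal_toReal hvt, ← ENNReal.ofReal_mul (by positivity),
      ← ENNReal.ofReal_mul hl.le] at h3
    have h5 := ENNReal.ofReal_lt_ofReal_iff'.1 h3
    have h6 : r ≤ r ^ finrank ℝ E := le_self_pow₀ h1.le hd.ne'
    have : r * (l * v.toReal) ≤ l * (r ^ finrank ℝ E * v.toReal) := by
      have : r * (l * v.toReal) ≤ r ^ finrank ℝ E * (l * v.toReal) := by gcongr
      linarith
    linarith [h5.1]
  have hex : ∀ x, ∃ r, (S x).Nonempty → r ∈ S x ∧ 5 * r ∉ S x := by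
    intro x
    by_cases hne : (S x).Nonempty
    · have hbdd : BddAbove (S x) := ⟨R, fun r hr ↦ hR x r hr⟩
      have hpos : 0 < sSup (S x) := by
        obtain ⟨r, hr⟩ := hne
        exact hr.1.trans_le (le_csSup hbdd hr)
      -- A radius above half the supremum suffices: five times it exceeds the supremum and so is no
      -- longer admissible.
      obtain ⟨r, hr, hr2⟩ := exists_lt_of_lt_csSup hne (half_lt_self hpos)
      refine ⟨r, fun _ ↦ ⟨hr, fun h5 ↦ ?_⟩⟩
      have := le_csSup hbdd h5
      linarith
    · exact ⟨0, fun h ↦ absurd h hne⟩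
  choose r hr using hex
  set t : Set E := {x | (S x).Nonempty}
  obtain ⟨u, hut, hdisj, hcov⟩ := Vitali.exists_disjoint_subfamily_covering_enlargement_closedBall t
    id r R (fun x hx ↦ hR x _ (hr x hx).1) 5 (by norm_num)
  simp only [id] at hdisj hcov
  have hrpos : ∀ c ∈ u, 0 < r c := fun c hc ↦ (hr c (hut hc)).1.1
  refine ⟨u, r, ?_, hrpos, hdisj, fun c hc ↦ (hr c (hut hc)).1.2.le, fun c hc ↦ ?_, ?_⟩
  · refine hdisj.countable_of_nonempty_interior fun c hc ↦ ⟨c, ?_⟩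
    exact ball_subset_interior_closedBall (mem_ball_self (hrpos c hc))
  · by_contra! h
    exact (hr c (hut hc)).2 ⟨by have := hrpos c hc; positivity, h⟩
  -- Outside the enlarged balls no radius is admissible, so every centred average is at most `l`;
  -- Lebesgue differentiation passes this to the value of `f`.
  · have hleb := (Besicovitch.vitaliFamily (volume : Measure E)).ae_tendsto_lintegral_div
      hf.1.enorm hfin
    filter_upwards [hleb] with x hx hxu
    have hxt : x ∉ t := by
      intro hxt
      obtain ⟨b, hb, hsub⟩ := hcov x hxt
      exact hxu (Set.mem_biUnion hb (hsub (mem_closedBall_self (hr x hxt).1.1.le)))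
    refine le_of_tendsto (hx.comp (Besicovitch.tendsto_filterAt volume x)) ?_
    filter_upwards [self_mem_nhdsWithin] with s hs
    have hs : 0 < s := hs
    refine ENNReal.div_le_of_le_mul ?_
    by_contra! h
    exact hxt ⟨s, hs, h⟩

end CalderonZygmund

/-! ### The Calderón–Zygmund decomposition -/

section CalderonZygmund

open Metric Module

theorem enorm_ofReal_complex (x : ℝ) : ‖(x : ℂ)‖ₑ = ‖x‖ₑ := by
  rw [← ofReal_norm, ← ofReal_norm, Complex.norm_real]

theorem hasSum_indicator_of_mem {ι α G : Type*} [AddCommMonoid G] [TopologicalSpace G]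
    {s : ι → Set α} (hs : Pairwise fun i j ↦ Disjoint (s i) (s j)) (F : ι → α → G) {x : α} {i : ι}
    (hx : x ∈ s i) : HasSum (fun j ↦ (s j).indicator (F j) x) (F i x) := by
  have := hasSum_single (f := fun j ↦ (s j).indicator (F j) x) i fun j hj ↦
    Set.indicator_of_notMem (fun h ↦ Set.disjoint_left.1 (hs hj) h hx) _
  simpa [Set.indicator_of_mem hx] using this

theorem hasSum_indicator_of_notMem {ι α G : Type*} [AddCommMonoid G] [TopologicalSpace G]
    {s : ι → Set α} (F : ι → α → G) {x : α} (hx : x ∉ ⋃ i, s i) :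
    HasSum (fun j ↦ (s j).indicator (F j) x) 0 := by
  have : (fun j ↦ (s j).indicator (F j) x) = fun _ ↦ 0 := by
    funext j
    exact Set.indicator_of_notMem (fun h ↦ hx (Set.mem_iUnion.2 ⟨j, h⟩)) _
  rw [this]
  exact hasSum_zero

/-- Each point is given to the first set, in an enumeration, that contains it. This serves for the
fivefold balls, which overlap, unlike the dyadic cubes of the classical decomposition. -/
theorem exists_disjoint_refinement {ι α : Type*} [Countable ι] [MeasurableSpace α]
    {s : ι → Set α} (hs : ∀ i, MeasurableSet (s i)) :
    ∃ q : ι → Set α, (∀ i, MeasurableSet (q i)) ∧ (∀ i, q i ⊆ s i) ∧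
      (Pairwise fun i j ↦ Disjoint (q i) (q j)) ∧ ⋃ i, q i = ⋃ i, s i := by
  obtain ⟨e, he⟩ := exists_injective_nat ι
  refine ⟨fun i ↦ s i \ ⋃ j, ⋃ (_ : e j < e i), s j, fun i ↦ ?_, fun i ↦ Set.sdiff_subset, ?_, ?_⟩
  · exact (hs i).diff (.iUnion fun j ↦ .iUnion fun _ ↦ hs j)
  · intro i j hij
    rw [Set.disjoint_left]
    rintro x ⟨hxi, hxi'⟩ ⟨hxj, hxj'⟩
    rcases lt_trichotomy (e i) (e j) with h | h | h
    · exact hxj' (Set.mem_iUnion₂.2 ⟨i, h, hxi⟩)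
    · exact hij (he h)
    · exact hxi' (Set.mem_iUnion₂.2 ⟨j, h, hxj⟩)
  · apply subset_antisymm
    · exact Set.iUnion_mono fun i ↦ Set.sdiff_subset
    · intro x hx
      have hne : ∃ n, ∃ i, e i = n ∧ x ∈ s i := by
        obtain ⟨i, hi⟩ := Set.mem_iUnion.1 hx
        exact ⟨_, i, rfl, hi⟩
      classical
      obtain ⟨i, hi, hxi⟩ := Nat.find_spec hne
      refine Set.mem_iUnion.2 ⟨i, hxi, fun h ↦ ?_⟩
      obtain ⟨j, hj, hxj⟩ := Set.mem_iUnion₂.1 h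
      exact Nat.find_min hne (hi ▸ hj) ⟨j, rfl, hxj⟩

variable {E : Type*} [NormedAddCommGroup E] [InnerProductSpace ℝ E] [FiniteDimensional ℝ E]
  [MeasurableSpace E] [BorelSpace E]

/-- The integral of the part of `‖f‖` above half the level, relative to the level. -/
noncomputable def largePart (f : E → ℂ) (l : ℝ) : ℝ≥0∞ :=
  (ENNReal.ofReal l)⁻¹ * ∫⁻ y in {y | ENNReal.ofReal (l / 2) < ‖f y‖ₑ}, ‖f y‖ₑ

/-- The integral of the square of the part of `‖f‖` below the level. -/
noncomputable def smallPart (f : E → ℂ) (l : ℝ) : ℝ≥0∞ :=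
  ∫⁻ y in {y | ‖f y‖ₑ ≤ ENNReal.ofReal l}, ‖f y‖ₑ ^ 2

/-- Values of `‖f‖` below `l / 2` account for at most half of `l * volume s`, so the values above `l
/ 2` supply the other half. Bounding by this part, instead of by the whole `L¹` norm, is what later
lets the distributional estimate be integrated in `l`. -/
theorem measure_le_of_le_setLIntegral {f : E → ℂ} {l : ℝ} (hl : 0 < l)
    {s : Set E} (hs : volume s ≠ ∞)
    (h : ENNReal.ofReal l * volume s ≤ ∫⁻ y in s, ‖f y‖ₑ) :
    volume s ≤ 2 * ((ENNReal.ofReal l)⁻¹ *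
      ∫⁻ y in s, {y | ENNReal.ofReal (l / 2) < ‖f y‖ₑ}.indicator (fun y ↦ ‖f y‖ₑ) y) := by
  set X := ∫⁻ y in s, {y | ENNReal.ofReal (l / 2) < ‖f y‖ₑ}.indicator (fun y ↦ ‖f y‖ₑ) y
  have h1 : ∫⁻ y in s, ‖f y‖ₑ ≤ X + ENNReal.ofReal (l / 2) * volume s := by
    rw [← setLIntegral_const, ← lintegral_add_right _ measurable_const]
    refine lintegral_mono fun y ↦ ?_
    by_cases hy : ENNReal.ofReal (l / 2) < ‖f y‖ₑ
    · simp [hy]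
    · simpa [hy] using not_lt.1 hy
  have hL : ENNReal.ofReal l = ENNReal.ofReal (l / 2) + ENNReal.ofReal (l / 2) := by
    rw [← ENNReal.ofReal_add (by positivity) (by positivity), add_halves]
  have h2 : ENNReal.ofReal (l / 2) * volume s ≤ X := by
    have := h.trans h1
    rw [hL, add_mul] at this
    exact (ENNReal.add_le_add_iff_right
      (ENNReal.mul_ne_top ENNReal.ofReal_ne_top hs)).1 this
  have hL0 : ENNReal.ofReal l ≠ 0 := (ENNReal.ofReal_pos.2 hl).ne'
  calc volume s = 2 * ((ENNReal.ofReal l)⁻¹ * (ENNReal.ofReal (l / 2) * volume s)) := by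
        rw [← mul_assoc (ENNReal.ofReal l)⁻¹, ← mul_assoc, mul_left_comm, ← ENNReal.ofReal_ofNat,
          ← ENNReal.ofReal_mul (by norm_num), mul_div_cancel₀ _ (by norm_num : (2 : ℝ) ≠ 0),
          ENNReal.inv_mul_cancel hL0 ENNReal.ofReal_ne_top, one_mul]
    _ ≤ _ := by gcongr

/-- Calderón–Zygmund decomposition of `f` at level `l`. -/
theorem exists_calderonZygmund_decomposition [Nontrivial E] {f : E → ℂ} (hfm : Measurable f)
    (hf : Integrable f) (hfb : ∃ M, ∀ x, ‖f x‖ ≤ M) {l : ℝ} (hl : 0 < l) :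
    ∃ (u : Set E) (r : E → ℝ) (b : u → E → ℂ) (g : E → ℂ), u.Countable ∧
      Measurable g ∧ Integrable g ∧ (∃ M, ∀ x, ‖g x‖ ≤ M) ∧
      (∀ c, Measurable (b c)) ∧ (∀ c, Integrable (b c)) ∧ (∀ c, ∫ x, b c x = 0) ∧
      (∀ (c : u) (x : E), x ∉ closedBall (c : E) (5 * r c) → b c x = 0) ∧
      (∀ x, HasSum (fun c ↦ b c x) (f x - g x)) ∧
      ∑' c : u, volume (closedBall (c : E) (10 * r c))
        ≤ ENNReal.ofReal (10 ^ finrank ℝ E) * (2 * largePart f l) ∧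
      ∑' c, ∫⁻ x, ‖b c x‖ₑ
        ≤ 2 * (ENNReal.ofReal l * (ENNReal.ofReal (5 ^ finrank ℝ E) * (2 * largePart f l))) ∧
      ∫⁻ x, ‖g x‖ₑ ^ 2 ≤ smallPart f l +
        (ENNReal.ofReal (5 ^ finrank ℝ E) * ENNReal.ofReal l) ^ 2 * (2 * largePart f l) := by
  obtain ⟨u, r, hu, hr, hdisj, hge, hle, hoff⟩ := exists_stopping_balls hf hl
  have : Countable u := hu.to_subtype
  set L := ENNReal.ofReal l
  have hL0 : L ≠ 0 := (ENNReal.ofReal_pos.2 hl).ne'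
  have hLt : L ≠ ∞ := ENNReal.ofReal_ne_top
  set B : u → Set E := fun c ↦ closedBall (c : E) (r c) with hB
  set B5 : u → Set E := fun c ↦ closedBall (c : E) (5 * r c) with hB5
  have hrp : ∀ c : u, 0 < r c := fun c ↦ hr c c.2
  have hBm : ∀ c, MeasurableSet (B c) := fun c ↦ measurableSet_closedBall
  have hBd : Pairwise fun i j ↦ Disjoint (B i) (B j) := fun i j hij ↦
    hdisj i.2 j.2 (fun h ↦ hij (Subtype.ext h))
  have hB0 : ∀ c, volume (B c) ≠ 0 := fun c ↦ (measure_closedBall_pos _ _ (hrp c)).ne'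
  have hBt : ∀ c, volume (B c) ≠ ∞ := fun c ↦ measure_closedBall_lt_top.ne
  have hBB5 : ∀ c, B c ⊆ B5 c := fun c ↦ closedBall_subset_closedBall (by have := hrp c; linarith)
  have hB5v : ∀ c, volume (B5 c) = ENNReal.ofReal (5 ^ finrank ℝ E) * volume (B c) := fun c ↦
    volume_closedBall_mul _ (by norm_num) (hrp c).le
  obtain ⟨q, hqm, hqs, hqd, hqU⟩ := exists_disjoint_refinement (s := B5)
    fun c ↦ measurableSet_closedBall
  -- the total mass of the balls
  have hS : ∑' c, volume (B c) ≤ 2 * largePart f l := by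
    calc ∑' c, volume (B c) ≤ ∑' c, 2 * (L⁻¹ * ∫⁻ y in B c,
          {y | ENNReal.ofReal (l / 2) < ‖f y‖ₑ}.indicator (fun y ↦ ‖f y‖ₑ) y) :=
          ENNReal.tsum_le_tsum fun c ↦ measure_le_of_le_setLIntegral hl (hBt c) (hge c c.2)
      _ = 2 * (L⁻¹ * ∫⁻ y in ⋃ c, B c,
          {y | ENNReal.ofReal (l / 2) < ‖f y‖ₑ}.indicator (fun y ↦ ‖f y‖ₑ) y) := by
          rw [ENNReal.tsum_mul_left, ENNReal.tsum_mul_left, lintegral_iUnion hBm hBd]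
      _ ≤ 2 * largePart f l := by
          unfold largePart
          rw [← lintegral_indicator (measurableSet_lt measurable_const hfm.enorm)]
          gcongr
          exact Measure.restrict_le_self
  -- The mass of `f` on `q c` is spread evenly over the small ball `B c`, not over `q c`, whose
  -- volume has no lower bound. The balls `B c` are disjoint, so these constants do not accumulate,
  -- and passing from radius `r` to `5 r` costs the factor `5 ^ finrank`.
  set a : u → ℂ := fun c ↦ (∫ x in q c, f x) / (volume (B c)).toReal with ha
  have haL : ∀ c, ‖a c‖ₑ ≤ ENNReal.ofReal (5 ^ finrank ℝ E) * L := by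
    intro c
    have hv : 0 < (volume (B c)).toReal := ENNReal.toReal_pos (hB0 c) (hBt c)
    have h1 : ‖a c‖ₑ = ‖∫ x in q c, f x‖ₑ / volume (B c) := by
      rw [ha]
      simp only [div_eq_mul_inv, enorm_mul]
      rw [enorm_inv (by exact_mod_cast hv.ne'), enorm_ofReal_complex,
        Real.enorm_eq_ofReal hv.le, ENNReal.ofReal_toReal (hBt c)]
    rw [h1]
    refine ENNReal.div_le_of_le_mul ?_
    calc ‖∫ x in q c, f x‖ₑ ≤ ∫⁻ x in q c, ‖f x‖ₑ := enorm_integral_le_lintegral_enorm _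
      _ ≤ ∫⁻ x in B5 c, ‖f x‖ₑ := lintegral_mono_set (hqs c)
      _ ≤ L * volume (B5 c) := hle c c.2
      _ = _ := by rw [hB5v]; ring
  have haB : ∀ c, ‖a c‖ₑ * volume (B c) ≤ ∫⁻ x in q c, ‖f x‖ₑ := by
    intro c
    have hv : 0 < (volume (B c)).toReal := ENNReal.toReal_pos (hB0 c) (hBt c)
    have h1 : ‖a c‖ₑ * volume (B c) = ‖a c * (volume (B c)).toReal‖ₑ := by
      rw [enorm_mul, enorm_ofReal_complex, Real.enorm_eq_ofReal hv.le, ENNReal.ofReal_toReal (hBt c)]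
    rw [h1, ha]
    simp only
    rw [div_mul_cancel₀ _ (by exact_mod_cast hv.ne')]
    exact enorm_integral_le_lintegral_enorm _
  set h : E → ℂ := fun x ↦ ∑' c, (B c).indicator (fun _ ↦ a c) x with hh
  set b : u → E → ℂ := fun c x ↦ (q c).indicator f x - (B c).indicator (fun _ ↦ a c) x with hb
  set g : E → ℂ := fun x ↦ (⋃ c, B5 c)ᶜ.indicator f x + h x with hg
  have hUm : MeasurableSet (⋃ c, B5 c) := .iUnion fun c ↦ measurableSet_closedBall
  have h_mem : ∀ {x : E} {c : u}, x ∈ B c → h x = a c := fun hx ↦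
    (hasSum_indicator_of_mem hBd _ hx).tsum_eq
  have h_notMem : ∀ {x : E}, x ∉ ⋃ c, B c → h x = 0 := fun hx ↦
    (hasSum_indicator_of_notMem _ hx).tsum_eq
  have h_hasSum : ∀ x, HasSum (fun c ↦ (B c).indicator (fun _ ↦ a c) x) (h x) := by
    intro x
    by_cases hx : x ∈ ⋃ c, B c
    · obtain ⟨c, hc⟩ := Set.mem_iUnion.1 hx
      exact (h_mem hc) ▸ hasSum_indicator_of_mem hBd _ hc
    · exact (h_notMem hx) ▸ hasSum_indicator_of_notMem _ hx
  have hhm : Measurable h := by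
    exact Measurable.tsum fun c ↦ measurable_const.indicator (hBm c)
  have hh_enorm : ∀ x, ‖h x‖ₑ ≤ ∑' c, (B c).indicator (fun _ ↦ ‖a c‖ₑ) x := by
    intro x
    by_cases hx : x ∈ ⋃ c, B c
    · obtain ⟨c, hc⟩ := Set.mem_iUnion.1 hx
      rw [h_mem hc, (hasSum_indicator_of_mem hBd (fun c _ ↦ ‖a c‖ₑ) hc).tsum_eq]
    · simp [h_notMem hx]
  have hqf : ∑' c, ∫⁻ x in q c, ‖f x‖ₑ = ∫⁻ x in ⋃ c, q c, ‖f x‖ₑ :=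
    (lintegral_iUnion hqm hqd _).symm
  have hhi : Integrable h := by
    refine ⟨hhm.aestronglyMeasurable, ?_⟩
    calc ∫⁻ x, ‖h x‖ₑ ≤ ∫⁻ x, ∑' c, (B c).indicator (fun _ ↦ ‖a c‖ₑ) x := lintegral_mono hh_enorm
      _ = ∑' c, ‖a c‖ₑ * volume (B c) := by
          rw [lintegral_tsum fun c ↦ (measurable_const.indicator (hBm c)).aemeasurable]
          simp_rw [lintegral_indicator (hBm _), setLIntegral_const]
      _ ≤ ∑' c, ∫⁻ x in q c, ‖f x‖ₑ := ENNReal.tsum_le_tsum haB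
      _ ≤ ∫⁻ x, ‖f x‖ₑ := hqf ▸ setLIntegral_le_lintegral _ _
      _ < ∞ := hf.2
  have hg_mem : ∀ {x : E} {c : u}, x ∈ B c → g x = a c := by
    intro x c hx
    have : x ∈ ⋃ c, B5 c := Set.mem_iUnion.2 ⟨c, hBB5 c hx⟩
    simp only [hg]
    rw [Set.indicator_of_notMem (not_not.2 this), zero_add, h_mem hx]
  refine ⟨u, r, b, g, hu, ?_, ?_, ?_, ?_, ?_, ?_, ?_, ?_, ?_, ?_, ?_⟩
  · exact (hfm.indicator hUm.compl).add hhm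
  · exact (hf.indicator hUm.compl).add hhi
  · obtain ⟨M, hM⟩ := hfb
    refine ⟨M + (ENNReal.ofReal (5 ^ finrank ℝ E) * L).toReal, fun x ↦ ?_⟩
    refine (norm_add_le _ _).trans (add_le_add ((norm_indicator_le_norm_self _ _).trans (hM x)) ?_)
    by_cases hx : x ∈ ⋃ c, B c
    · obtain ⟨c, hc⟩ := Set.mem_iUnion.1 hx
      rw [h_mem hc, ← toReal_enorm]
      exact ENNReal.toReal_mono (ENNReal.mul_ne_top ENNReal.ofReal_ne_top hLt) (haL c)
    · simp [h_notMem hx]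
  · exact fun c ↦ (hfm.indicator (hqm c)).sub (measurable_const.indicator (hBm c))
  · exact fun c ↦ (hf.indicator (hqm c)).sub
      ((integrable_indicator_iff (hBm c)).2 (integrableOn_const (hBt c)))
  · intro c
    rw [integral_sub (hf.indicator (hqm c))
      ((integrable_indicator_iff (hBm c)).2 (integrableOn_const (hBt c))),
      integral_indicator (hqm c), integral_indicator (hBm c), setIntegral_const]
    have hv : 0 < (volume (B c)).toReal := ENNReal.toReal_pos (hB0 c) (hBt c)
    rw [ha, Complex.real_smul, Measure.real, mul_div_cancel₀ _ (by exact_mod_cast hv.ne'), sub_self]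
  · intro c x hx
    simp only [hb]
    rw [Set.indicator_of_notMem (fun h ↦ hx (hqs c h)),
      Set.indicator_of_notMem (fun h ↦ hx (hBB5 c h)), sub_zero]
  · intro x
    have h1 : HasSum (fun c ↦ (q c).indicator f x) ((⋃ c, B5 c).indicator f x) := by
      by_cases hx : x ∈ ⋃ c, q c
      · obtain ⟨c, hc⟩ := Set.mem_iUnion.1 hx
        rw [Set.indicator_of_mem (hqU ▸ hx)]
        exact hasSum_indicator_of_mem hqd (fun _ ↦ f) hc
      · rw [Set.indicator_of_notMem (hqU ▸ hx)]
        exact hasSum_indicator_of_notMem (fun _ ↦ f) hx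
    have h2 : (⋃ c, B5 c)ᶜ.indicator f x = f x - (⋃ c, B5 c).indicator f x := by
      rw [Set.indicator_compl]
      rfl
    have h3 : f x - g x = (⋃ c, B5 c).indicator f x - h x := by
      simp only [hg, h2]
      ring
    rw [h3]
    exact h1.sub (h_hasSum x)
  · have : ∀ c : u, volume (closedBall (c : E) (10 * r c))
        = ENNReal.ofReal (10 ^ finrank ℝ E) * volume (B c) := fun c ↦
      volume_closedBall_mul _ (by norm_num) (hrp c).le
    simp_rw [this]
    rw [ENNReal.tsum_mul_left]
    gcongr
  · calc ∑' c, ∫⁻ x, ‖b c x‖ₑ ≤ ∑' c, 2 * ∫⁻ x in q c, ‖f x‖ₑ := by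
          refine ENNReal.tsum_le_tsum fun c ↦ ?_
          calc ∫⁻ x, ‖b c x‖ₑ
              ≤ ∫⁻ x, ((q c).indicator (fun y ↦ ‖f y‖ₑ) x + (B c).indicator (fun _ ↦ ‖a c‖ₑ) x) := by
                refine lintegral_mono fun x ↦ (enorm_sub_le).trans ?_
                rw [enorm_indicator_eq_indicator_enorm, enorm_indicator_eq_indicator_enorm]
            _ = (∫⁻ x in q c, ‖f x‖ₑ) + ‖a c‖ₑ * volume (B c) := by
                rw [lintegral_add_left (hfm.enorm.indicator (hqm c)), lintegral_indicator (hqm c),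
                  lintegral_indicator (hBm c), setLIntegral_const]
            _ ≤ 2 * ∫⁻ x in q c, ‖f x‖ₑ := by rw [two_mul]; gcongr; exact haB c
      _ ≤ ∑' c, 2 * (L * (ENNReal.ofReal (5 ^ finrank ℝ E) * volume (B c))) := by
          refine ENNReal.tsum_le_tsum fun c ↦ ?_
          gcongr
          exact (lintegral_mono_set (hqs c)).trans ((hle c c.2).trans (by rw [hB5v]))
      _ ≤ _ := by
          simp_rw [ENNReal.tsum_mul_left]
          gcongr
  · calc ∫⁻ x, ‖g x‖ₑ ^ 2
        ≤ ∫⁻ x, ({y | ‖f y‖ₑ ≤ L}.indicator (fun y ↦ ‖f y‖ₑ ^ 2) x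
          + ∑' c, (B c).indicator (fun _ ↦ (ENNReal.ofReal (5 ^ finrank ℝ E) * L) ^ 2) x) := by
          refine lintegral_mono_ae ?_
          filter_upwards [hoff] with x hx
          -- Three regions: on the small balls `g` is the constant `a c`; on the rest of the
          -- fivefold balls it vanishes; elsewhere it is `f`, which is at most `l` almost
          -- everywhere.
          by_cases hxB : x ∈ ⋃ c, B c
          · obtain ⟨c, hc⟩ := Set.mem_iUnion.1 hxB
            rw [hg_mem hc, (hasSum_indicator_of_mem hBd
              (fun c _ ↦ (ENNReal.ofReal (5 ^ finrank ℝ E) * L) ^ 2) hc).tsum_eq]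
            refine le_trans ?_ le_add_self
            gcongr
            exact haL c
          · refine le_trans ?_ le_self_add
            simp only [hg, h_notMem hxB, add_zero]
            by_cases hx5 : x ∈ ⋃ c, B5 c
            · rw [Set.indicator_of_notMem (not_not.2 hx5)]
              simp
            · have h5 : x ∉ ⋃ c ∈ u, closedBall c (5 * r c) := by
                rwa [Set.biUnion_eq_iUnion]
              rw [Set.indicator_of_mem hx5, Set.indicator_of_mem]
              exact hx h5
      _ = smallPart f l + (ENNReal.ofReal (5 ^ finrank ℝ E) * L) ^ 2 * ∑' c, volume (B c) := by
          have hm : MeasurableSet {y | ‖f y‖ₑ ≤ L} := measurableSet_le hfm.enorm measurable_const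
          rw [lintegral_add_left ((hfm.enorm.pow_const 2).indicator hm), lintegral_indicator hm,
            lintegral_tsum fun c ↦ (measurable_const.indicator (hBm c)).aemeasurable]
          simp_rw [lintegral_indicator (hBm _), setLIntegral_const]
          rw [ENNReal.tsum_mul_left]
          rfl
      _ ≤ _ := by gcongr

end CalderonZygmund

/-! ### Distributional estimate for convolution operators -/

section CalderonZygmund

open Metric Module

variable {E : Type*} [NormedAddCommGroup E] [InnerProductSpace ℝ E] [FiniteDimensional ℝ E]
  [MeasurableSpace E] [BorelSpace E]

/-- Convolution of `f` with the kernel `K`. -/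
noncomputable def kernelConv (K f : E → ℂ) (x : E) : ℂ := ∫ t, f t * K (x - t)

/-- Hörmander's integral regularity condition with constant `A`. -/
def HormanderBound (K : E → ℂ) (A : ℝ≥0∞) : Prop :=
  ∀ y, ∫⁻ x in {x | 2 * ‖y‖ ≤ ‖x‖}, ‖K (x - y) - K x‖ₑ ≤ A

/-- Convolution with `K` is bounded on `L²`, with squared norm at most `B`. -/
def ConvL2Bound (K : E → ℂ) (B : ℝ≥0∞) : Prop :=
  ∀ g : E → ℂ, Measurable g → Integrable g → (∃ M, ∀ x, ‖g x‖ ≤ M) →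
    ∫⁻ x, ‖kernelConv K g x‖ₑ ^ 2 ≤ B * ∫⁻ x, ‖g x‖ₑ ^ 2

theorem integrable_kernelConv_integrand {K f : E → ℂ} (hK : Integrable K) (hf : Integrable f) :
    Integrable (fun z : E × E ↦ f z.2 * K (z.1 - z.2)) (volume.prod volume) :=
  hf.convolution_integrand (ContinuousLinearMap.mul ℂ ℂ) hK

theorem integrable_kernelConv {K f : E → ℂ} (hK : Integrable K) (hf : Integrable f) :
    Integrable (kernelConv K f) :=
  (integrable_kernelConv_integrand hK hf).integral_prod_left

theorem ae_integrable_kernelConv {K f : E → ℂ} (hK : Integrable K) (hf : Integrable f) :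
    ∀ᵐ x, Integrable fun t ↦ f t * K (x - t) :=
  (integrable_kernelConv_integrand hK hf).prod_right_ae

theorem measurable_kernelConv {K f : E → ℂ} (hK : Measurable K) (hf : Measurable f) :
    Measurable (kernelConv K f) := by
  have : StronglyMeasurable (Function.uncurry fun x t : E ↦ f t * K (x - t)) := by
    apply Measurable.stronglyMeasurable
    exact (hf.comp measurable_snd).mul (hK.comp (measurable_fst.sub measurable_snd))
  exact this.integral_prod_right.measurable

theorem integrable_mul_of_bounded {K f : E → ℂ} (hK : Integrable K) (hfm : Measurable f)
    (hfb : ∃ M, ∀ x, ‖f x‖ ≤ M) (x : E) : Integrable fun t ↦ f t * K (x - t) := by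
  obtain ⟨M, hM⟩ := hfb
  exact (hK.comp_sub_left x).bdd_mul hfm.aestronglyMeasurable (Eventually.of_forall hM)

theorem norm_kernelConv_le {K f : E → ℂ} (hK : Integrable K) {M : ℝ}
    (hM : ∀ x, ‖f x‖ ≤ M) (x : E) : ‖kernelConv K f x‖ ≤ M * ∫ t, ‖K t‖ := by
  have : ∫ t, ‖K t‖ = ∫ t, ‖K (x - t)‖ := (integral_sub_left_eq_self (fun t ↦ ‖K t‖) _ x).symm
  rw [this, ← integral_const_mul]
  refine norm_integral_le_of_norm_le ((hK.comp_sub_left x).norm.const_mul M)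
    (Eventually.of_forall fun t ↦ ?_)
  rw [norm_mul]
  gcongr
  exact hM t

/-- Away from its support, the image of a function of mean zero is controlled in `L¹`. -/
theorem lintegral_kernelConv_compl_closedBall_le {K b : E → ℂ} {A : ℝ≥0∞} (hKm : Measurable K)
    (hK : Integrable K) (hA : HormanderBound K A) (hbm : Measurable b) (hb : Integrable b)
    (hb0 : ∫ x, b x = 0) {c : E} {ρ : ℝ} (hsupp : ∀ x ∉ closedBall c ρ, b x = 0) :
    ∫⁻ x in (closedBall c (2 * ρ))ᶜ, ‖kernelConv K b x‖ₑ ≤ A * ∫⁻ x, ‖b x‖ₑ := by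
  have hmeas : Measurable fun z : E × E ↦ ‖b z.2‖ₑ * ‖K (z.1 - z.2) - K (z.1 - c)‖ₑ := by
    fun_prop
  calc ∫⁻ x in (closedBall c (2 * ρ))ᶜ, ‖kernelConv K b x‖ₑ
      ≤ ∫⁻ x in (closedBall c (2 * ρ))ᶜ, ∫⁻ t, ‖b t‖ₑ * ‖K (x - t) - K (x - c)‖ₑ := by
        refine lintegral_mono_ae (ae_restrict_of_ae ?_)
        filter_upwards [ae_integrable_kernelConv hK hb] with x hx
        have : kernelConv K b x = ∫ t, b t * (K (x - t) - K (x - c)) := by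
          simp_rw [mul_sub]
          rw [integral_sub hx (hb.mul_const _), integral_mul_const, hb0, zero_mul, sub_zero]
          rfl
        rw [this]
        refine (enorm_integral_le_lintegral_enorm _).trans_eq ?_
        simp_rw [enorm_mul]
    _ = ∫⁻ t, ∫⁻ x in (closedBall c (2 * ρ))ᶜ, ‖b t‖ₑ * ‖K (x - t) - K (x - c)‖ₑ :=
        lintegral_lintegral_swap hmeas.aemeasurable
    _ ≤ ∫⁻ t, A * ‖b t‖ₑ := by
        refine lintegral_mono fun t ↦ ?_
        by_cases ht : t ∈ closedBall c ρ
        · rw [lintegral_const_mul _ (by fun_prop), mul_comm A]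
          gcongr
          have hsm : MeasurableSet {x : E | 2 * ‖t - c‖ ≤ ‖x‖} :=
            measurableSet_le measurable_const measurable_norm
          calc ∫⁻ x in (closedBall c (2 * ρ))ᶜ, ‖K (x - t) - K (x - c)‖ₑ
              ≤ ∫⁻ x, {x | 2 * ‖t - c‖ ≤ ‖x‖}.indicator
                  (fun x ↦ ‖K (x - (t - c)) - K x‖ₑ) (x - c) := by
                rw [← lintegral_indicator measurableSet_closedBall.compl]
                refine lintegral_mono fun x ↦ ?_
                by_cases hx : x ∈ (closedBall c (2 * ρ))ᶜ
                · rw [Set.indicator_of_mem hx, Set.indicator_of_mem, sub_sub_sub_cancel_right]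
                  rw [mem_closedBall, dist_eq_norm] at ht
                  rw [Set.mem_compl_iff, mem_closedBall, dist_eq_norm, not_le] at hx
                  show 2 * ‖t - c‖ ≤ ‖x - c‖
                  linarith
                · rw [Set.indicator_of_notMem hx]
                  exact zero_le
            _ = ∫⁻ x in {x | 2 * ‖t - c‖ ≤ ‖x‖}, ‖K (x - (t - c)) - K x‖ₑ := by
                rw [lintegral_sub_right_eq_self
                  ({x | 2 * ‖t - c‖ ≤ ‖x‖}.indicator fun x ↦ ‖K (x - (t - c)) - K x‖ₑ) c,
                  lintegral_indicator hsm]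
            _ ≤ A := hA _
        · simp [hsupp t ht]
    _ = A * ∫⁻ x, ‖b x‖ₑ := lintegral_const_mul _ hbm.enorm

/-- The constant in the distributional estimate for a convolution operator. -/
noncomputable def weakTypeConst (n : ℕ) (A B : ℝ≥0∞) : ℝ≥0∞ :=
  2 * ENNReal.ofReal (10 ^ n) + 8 * A * ENNReal.ofReal (5 ^ n)
    + 8 * B * ENNReal.ofReal (5 ^ n) ^ 2 + 4 * B

theorem weakTypeConst_ne_top (n : ℕ) {A B : ℝ≥0∞} (hA : A ≠ ∞) (hB : B ≠ ∞) :
    weakTypeConst n A B ≠ ∞ := by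
  unfold weakTypeConst
  finiteness

/-- The good part is handled by Chebyshev and the `L²` bound. The bad part is handled outside the
doubled balls by its mean zero and Hörmander's condition, and the doubled balls have small total
volume. Because the right side sees only the large values of `f` in `L¹` and the small ones in `L²`,
the truncation of Marcinkiewicz interpolation is already built in. -/
theorem measure_lt_enorm_kernelConv_le [Nontrivial E] {K f : E → ℂ} {A B : ℝ≥0∞}
    (hKm : Measurable K) (hK : Integrable K) (hA : HormanderBound K A) (hB : ConvL2Bound K B)
    (hfm : Measurable f) (hf : Integrable f) (hfb : ∃ M, ∀ x, ‖f x‖ ≤ M) {l : ℝ} (hl : 0 < l) :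
    volume {x | ENNReal.ofReal l < ‖kernelConv K f x‖ₑ} ≤ weakTypeConst (finrank ℝ E) A B *
      (largePart f l + (ENNReal.ofReal l)⁻¹ ^ 2 * smallPart f l) := by
  obtain ⟨u, r, b, g, hu, hgm, hg, hgb, hbm, hb, hb0, hbs, hsum, hvol, hb1, hg2⟩ :=
    exists_calderonZygmund_decomposition hfm hf hfb hl
  have : Countable u := hu.to_subtype
  set L := ENNReal.ofReal l with hL
  have hL0 : L ≠ 0 := (ENNReal.ofReal_pos.2 hl).ne'
  have hLt : L ≠ ∞ := ENNReal.ofReal_ne_top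
  have hL2 : L = L / 2 + L / 2 := (ENNReal.add_halves L).symm
  have hbtot : ∑' c, ∫⁻ x, ‖b c x‖ₑ ≠ ∞ := by
    refine ne_top_of_le_ne_top ?_ hb1
    have : largePart f l ≠ ∞ := by
      refine ENNReal.mul_ne_top (ENNReal.inv_ne_top.2 hL0) ?_
      exact ((setLIntegral_le_lintegral _ _).trans_lt hf.2).ne
    finiteness
  set U : Set E := ⋃ c : u, closedBall (c : E) (2 * (5 * r c)) with hU
  have hUm : MeasurableSet U := .iUnion fun c ↦ measurableSet_closedBall
  set G : E → ℝ≥0∞ := fun x ↦ ∑' c, ‖kernelConv K (b c) x‖ₑ with hG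
  have hGm : Measurable G := Measurable.tsum fun c ↦ (measurable_kernelConv hKm (hbm c)).enorm
  -- Convolution commutes with the infinite sum of bad parts only where the double sum of absolute
  -- values is finite; since `K` and the sum of the `‖b c‖` are integrable, that is almost
  -- everywhere.
  have hpt : ∀ᵐ x, ‖kernelConv K f x‖ₑ ≤ ‖kernelConv K g x‖ₑ + G x := by
    have hfin : ∫⁻ x, ∑' c, ∫⁻ t, ‖b c t * K (x - t)‖ₑ ≠ ∞ := by
      have hm : ∀ c, Measurable fun z : E × E ↦ ‖b c z.2 * K (z.1 - z.2)‖ₑ := fun c ↦ by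
        have := hbm c
        fun_prop
      rw [lintegral_tsum fun c ↦ ((hm c).lintegral_prod_right').aemeasurable]
      have : ∀ c, ∫⁻ x, ∫⁻ t, ‖b c t * K (x - t)‖ₑ = (∫⁻ x, ‖K x‖ₑ) * ∫⁻ t, ‖b c t‖ₑ := by
        intro c
        rw [lintegral_lintegral_swap (hm c).aemeasurable, ← lintegral_const_mul _ (hbm c).enorm]
        refine lintegral_congr fun t ↦ ?_
        simp_rw [enorm_mul]
        rw [lintegral_const_mul _ (by fun_prop), lintegral_sub_right_eq_self (fun x ↦ ‖K x‖ₑ) t,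
          mul_comm]
      simp_rw [this]
      rw [ENNReal.tsum_mul_left]
      exact ENNReal.mul_ne_top hK.2.ne hbtot
    have hmeas : Measurable fun x ↦ ∑' c, ∫⁻ t, ‖b c t * K (x - t)‖ₑ :=
      Measurable.tsum fun c ↦ by
        have := hbm c
        exact Measurable.lintegral_prod_right' (f := fun z : E × E ↦ ‖b c z.2 * K (z.1 - z.2)‖ₑ)
          (by fun_prop)
    filter_upwards [ae_lt_top hmeas hfin] with x hx
    have hdec : kernelConv K f x = kernelConv K g x + ∑' c, kernelConv K (b c) x := by
      have h1 : ∫ t, ∑' c, b c t * K (x - t) = ∑' c, kernelConv K (b c) x :=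
        integral_tsum (fun c ↦ by have := hbm c; fun_prop) hx.ne
      rw [← h1]
      have h2 : ∀ t, ∑' c, b c t * K (x - t) = f t * K (x - t) - g t * K (x - t) := fun t ↦ by
        rw [← sub_mul]
        exact ((hsum t).mul_right _).tsum_eq
      simp_rw [h2]
      rw [integral_sub (integrable_mul_of_bounded hK hfm hfb x)
        (integrable_mul_of_bounded hK hgm hgb x)]
      exact (add_sub_cancel _ _).symm
    rw [hdec]
    exact (enorm_add_le _ _).trans (add_le_add le_rfl (enorm_tsum_le_tsum_enorm ))
  have hsub : volume {x | L < ‖kernelConv K f x‖ₑ}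
      ≤ volume U + volume {x | L / 2 ≤ ‖kernelConv K g x‖ₑ} + volume ({x | L / 2 ≤ G x} ∩ Uᶜ) := by
    refine le_trans (measure_mono_ae (t := U ∪ {x | L / 2 ≤ ‖kernelConv K g x‖ₑ} ∪
      ({x | L / 2 ≤ G x} ∩ Uᶜ)) ?_) ((measure_union_le _ _).trans
        (add_le_add (measure_union_le _ _) le_rfl))
    filter_upwards [hpt] with x hx hlx
    by_contra hcon
    have hcon' : x ∉ U ∪ {x | L / 2 ≤ ‖kernelConv K g x‖ₑ} ∪ ({x | L / 2 ≤ G x} ∩ Uᶜ) := hcon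
    simp only [Set.mem_union, Set.mem_inter_iff, Set.mem_ofPred_eq, Set.mem_compl_iff, not_or,
      not_and, not_not, not_le] at hcon'
    obtain ⟨⟨h1, h2⟩, h3⟩ := hcon'
    have h4 : G x < L / 2 := by
      by_contra! h
      exact h1 (h3 h)
    have : L < L := lt_of_lt_of_le hlx (hx.trans ((add_le_add h2.le h4.le).trans_eq hL2.symm))
    exact lt_irrefl _ this
  have hV1 : volume U ≤ ENNReal.ofReal (10 ^ finrank ℝ E) * (2 * largePart f l) := by
    have h10 : ∀ c : u, 2 * (5 * r c) = 10 * r c := fun c ↦ by ring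
    simp_rw [hU, h10]
    exact (measure_iUnion_le _).trans hvol
  have hhalf0 : L / 2 ≠ 0 := by simp [hL0]
  have hhalft : L / 2 ≠ ∞ := ENNReal.div_ne_top hLt (by norm_num)
  have hV2 : volume {x | L / 2 ≤ ‖kernelConv K g x‖ₑ} ≤ 4 * L⁻¹ ^ 2 * (B * (smallPart f l +
        (ENNReal.ofReal (5 ^ finrank ℝ E) * L) ^ 2 * (2 * largePart f l))) := by
    have h1 : {x | L / 2 ≤ ‖kernelConv K g x‖ₑ}
        ⊆ {x | (L / 2) ^ 2 ≤ ‖kernelConv K g x‖ₑ ^ 2} := fun x hx ↦ by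
      have hx : L / 2 ≤ ‖kernelConv K g x‖ₑ := hx
      show (L / 2) ^ 2 ≤ _
      gcongr
    refine (measure_mono h1).trans ((meas_ge_le_lintegral_div
      ((measurable_kernelConv hKm hgm).enorm.pow_const 2).aemeasurable
      (pow_ne_zero 2 hhalf0) (ENNReal.pow_ne_top hhalft)).trans ?_)
    rw [div_eq_mul_inv, mul_comm]
    have h4 : ((L / 2) ^ 2)⁻¹ = 4 * L⁻¹ ^ 2 := by
      rw [ENNReal.inv_pow, ENNReal.inv_div (by simp) (by simp), div_eq_mul_inv, mul_pow]
      norm_num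
    rw [h4]
    gcongr
    exact (hB g hgm hg hgb).trans (by gcongr)
  have hV3 : volume ({x | L / 2 ≤ G x} ∩ Uᶜ) ≤ 2 * L⁻¹ * (A * (2 * (L *
      (ENNReal.ofReal (5 ^ finrank ℝ E) * (2 * largePart f l))))) := by
    have h1 : volume ({x | L / 2 ≤ G x} ∩ Uᶜ) = volume.restrict Uᶜ {x | L / 2 ≤ G x} :=
      (Measure.restrict_apply (measurableSet_le measurable_const hGm)).symm
    rw [h1]
    refine (meas_ge_le_lintegral_div hGm.aemeasurable hhalf0 hhalft).trans ?_
    rw [div_eq_mul_inv, mul_comm, ENNReal.inv_div (by simp) (by simp), div_eq_mul_inv]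
    gcongr
    calc ∫⁻ x in Uᶜ, G x = ∑' c, ∫⁻ x in Uᶜ, ‖kernelConv K (b c) x‖ₑ :=
          lintegral_tsum fun c ↦ (measurable_kernelConv hKm (hbm c)).enorm.aemeasurable
      _ ≤ ∑' c, A * ∫⁻ x, ‖b c x‖ₑ := by
          refine ENNReal.tsum_le_tsum fun c ↦ ?_
          refine le_trans (lintegral_mono_set ?_) (lintegral_kernelConv_compl_closedBall_le hKm hK
            hA (hbm c) (hb c) (hb0 c) (hbs c))
          exact Set.compl_subset_compl.2 (Set.subset_iUnion (fun c : u ↦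
            closedBall (c : E) (2 * (5 * r c))) c)
      _ ≤ _ := by
          rw [ENNReal.tsum_mul_left]
          gcongr
  refine hsub.trans ((add_le_add (add_le_add hV1 hV2) hV3).trans ?_)
  set P := largePart f l
  set S := smallPart f l
  set n5 := ENNReal.ofReal (5 ^ finrank ℝ E)
  set n10 := ENNReal.ofReal (10 ^ finrank ℝ E)
  have hLL : L⁻¹ * L = 1 := ENNReal.inv_mul_cancel hL0 hLt
  have hLL2 : L⁻¹ ^ 2 * L ^ 2 = 1 := by rw [← mul_pow, hLL, one_pow]
  calc n10 * (2 * P) + 4 * L⁻¹ ^ 2 * (B * (S + (n5 * L) ^ 2 * (2 * P)))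
        + 2 * L⁻¹ * (A * (2 * (L * (n5 * (2 * P)))))
      = 2 * n10 * P + 4 * B * (L⁻¹ ^ 2 * S) + 8 * B * n5 ^ 2 * (L⁻¹ ^ 2 * L ^ 2) * P
        + 8 * A * n5 * (L⁻¹ * L) * P := by ring
    _ = (2 * n10 + 8 * A * n5 + 8 * B * n5 ^ 2) * P + 4 * B * (L⁻¹ ^ 2 * S) := by
        rw [hLL, hLL2]; ring
    _ ≤ weakTypeConst (finrank ℝ E) A B * P + weakTypeConst (finrank ℝ E) A B * (L⁻¹ ^ 2 * S) := by
        exact add_le_add (mul_le_mul' le_self_add le_rfl) (mul_le_mul' le_add_self le_rfl)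
    _ = _ := by rw [mul_add]

end CalderonZygmund

/-! ### Integration over levels: the range `1 < p < 2` -/

section CalderonZygmund

open Metric Module

theorem lintegral_Ioo_zero_rpow {a s : ℝ} (ha : 0 ≤ a) (hs : -1 < s) :
    ∫⁻ t in Set.Ioo 0 a, ENNReal.ofReal (t ^ s) = ENNReal.ofReal (a ^ (s + 1) / (s + 1)) := by
  have hi : IntegrableOn (fun t : ℝ ↦ t ^ s) (Set.Ioc 0 a) :=
    (intervalIntegrable_iff_integrableOn_Ioc_of_le ha).1
      (intervalIntegral.intervalIntegrable_rpow' hs)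
  rw [setLIntegral_congr Ioo_ae_eq_Ioc, ← ofReal_integral_eq_lintegral_ofReal hi
    ((ae_restrict_iff' measurableSet_Ioc).2 (Eventually.of_forall fun t ht ↦
      Real.rpow_nonneg ht.1.le _)), ← intervalIntegral.integral_of_le ha,
    integral_rpow (Or.inl hs), Real.zero_rpow (by linarith), sub_zero]

theorem lintegral_Ici_rpow {a s : ℝ} (ha : 0 < a) (hs : s < -1) :
    ∫⁻ t in Set.Ici a, ENNReal.ofReal (t ^ s) = ENNReal.ofReal (-a ^ (s + 1) / (s + 1)) := by
  rw [setLIntegral_congr Ioi_ae_eq_Ici.symm, ← ofReal_integral_eq_lintegral_ofReal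
    (integrableOn_Ioi_rpow_of_lt hs ha)
    ((ae_restrict_iff' measurableSet_Ioi).2 (Eventually.of_forall fun t ht ↦
      Real.rpow_nonneg (ha.trans ht).le _)), integral_Ioi_rpow_of_lt hs ha]

variable {E : Type*} [NormedAddCommGroup E] [InnerProductSpace ℝ E] [FiniteDimensional ℝ E]
  [MeasurableSpace E] [BorelSpace E]

theorem ofReal_norm_rpow {s : ℝ} (hs : 0 ≤ s) (z : ℂ) : ENNReal.ofReal (‖z‖ ^ s) = ‖z‖ₑ ^ s := by
  rw [← ofReal_norm, ENNReal.ofReal_rpow_of_nonneg (norm_nonneg _) hs]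

/-- By Tonelli: for fixed `y` the levels range over `t < 2 ‖f y‖`, and `t ^ (p - 2)` is integrable
at the origin because `p > 1`. -/
theorem lintegral_largePart_mul_rpow {f : E → ℂ} (hf : Measurable f) {p : ℝ} (hp : 1 < p) :
    ∫⁻ t in Set.Ioi (0 : ℝ), largePart f t * ENNReal.ofReal (t ^ (p - 1))
      = ENNReal.ofReal (2 ^ (p - 1) / (p - 1)) * ∫⁻ x, ‖f x‖ₑ ^ p := by
  set φ : ℝ → E → ℝ≥0∞ := fun t y ↦ {z : ℝ × E | z.1 / 2 < ‖f z.2‖}.indicator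
    (fun z ↦ ‖f z.2‖ₑ * ENNReal.ofReal (z.1 ^ (p - 2))) (t, y) with hφ
  have hφm : Measurable (Function.uncurry φ) := by
    refine Measurable.indicator (by fun_prop) ?_
    exact measurableSet_lt (by fun_prop) (by fun_prop)
  have h1 : ∀ t ∈ Set.Ioi (0 : ℝ), largePart f t * ENNReal.ofReal (t ^ (p - 1)) = ∫⁻ y, φ t y := by
    intro t ht
    have ht : 0 < t := ht
    have hset : {y | ENNReal.ofReal (t / 2) < ‖f y‖ₑ} = {y | t / 2 < ‖f y‖} := by
      ext y
      rw [Set.mem_ofPred_eq, Set.mem_ofPred_eq, ← ofReal_norm, ENNReal.ofReal_lt_ofReal_iff']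
      exact ⟨fun h ↦ h.1, fun h ↦ ⟨h, (by positivity : 0 < t / 2).trans h⟩⟩
    have hm : MeasurableSet {y | t / 2 < ‖f y‖} := measurableSet_lt (by fun_prop) (by fun_prop)
    have hpow : (ENNReal.ofReal t)⁻¹ * ENNReal.ofReal (t ^ (p - 1))
        = ENNReal.ofReal (t ^ (p - 2)) := by
      rw [← ENNReal.ofReal_inv_of_pos ht, ← ENNReal.ofReal_mul (by positivity),
        ← Real.rpow_neg_one, ← Real.rpow_add ht]
      ring_nf
    rw [largePart, hset, mul_right_comm, hpow, ← lintegral_const_mul _ (by fun_prop),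
      ← lintegral_indicator hm]
    refine lintegral_congr fun y ↦ ?_
    by_cases hy : t / 2 < ‖f y‖
    · simp [hφ, hy, mul_comm]
    · simp [hφ, hy]
  rw [setLIntegral_congr_fun measurableSet_Ioi h1, lintegral_lintegral_swap hφm.aemeasurable,
    ← lintegral_const_mul _ (by fun_prop)]
  refine lintegral_congr fun y ↦ ?_
  have h2 : ∀ t, φ t y = (Set.Iio (2 * ‖f y‖)).indicator
      (fun t ↦ ‖f y‖ₑ * ENNReal.ofReal (t ^ (p - 2))) t := by
    intro t
    have : t / 2 < ‖f y‖ ↔ t < 2 * ‖f y‖ := by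
      rw [div_lt_iff₀ (by norm_num), mul_comm]
    by_cases hy : t / 2 < ‖f y‖
    · simp [hφ, hy, this.1 hy]
    · have hy' := mt this.2 hy
      simp only [hφ]
      rw [Set.indicator_of_notMem (s := Set.Iio (2 * ‖f y‖)) hy',
        Set.indicator_of_notMem (s := {z : ℝ × E | z.1 / 2 < ‖f z.2‖}) hy]
  simp_rw [h2]
  rw [lintegral_indicator measurableSet_Iio, Measure.restrict_restrict measurableSet_Iio,
    Set.inter_comm, Set.Ioi_inter_Iio, lintegral_const_mul _ (by fun_prop),
    lintegral_Ioo_zero_rpow (by positivity) (by linarith),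
    Real.mul_rpow (by norm_num) (norm_nonneg _), ← ofReal_norm,
    ENNReal.ofReal_rpow_of_nonneg (norm_nonneg _) (by linarith),
    ← ENNReal.ofReal_mul (norm_nonneg _), ← ENNReal.ofReal_mul (by
      have : 0 < p - 1 := by linarith
      positivity)]
  congr 1
  have hpp : ‖f y‖ ^ p = ‖f y‖ * ‖f y‖ ^ (p - 1) := by
    rcases (norm_nonneg (f y)).eq_or_lt with h | h
    · rw [← h, Real.zero_rpow (by linarith), zero_mul]
    · rw [← Real.rpow_one_add' h.le (by linarith)]
      ring_nf
  rw [hpp, show p - 2 + 1 = p - 1 by ring]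
  ring

/-- By Tonelli: for fixed `y` the levels range over `t ≥ ‖f y‖`, and `t ^ (p - 3)` is integrable at
infinity because `p < 2`. -/
theorem lintegral_smallPart_mul_rpow_le {f : E → ℂ} (hf : Measurable f) {p : ℝ} (hp1 : 1 < p)
    (hp : p < 2) :
    ∫⁻ t in Set.Ioi (0 : ℝ),
        (ENNReal.ofReal t)⁻¹ ^ 2 * smallPart f t * ENNReal.ofReal (t ^ (p - 1))
      ≤ ENNReal.ofReal (1 / (2 - p)) * ∫⁻ x, ‖f x‖ₑ ^ p := by
  set φ : ℝ → E → ℝ≥0∞ := fun t y ↦ {z : ℝ × E | ‖f z.2‖ ≤ z.1}.indicator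
    (fun z ↦ ‖f z.2‖ₑ ^ 2 * ENNReal.ofReal (z.1 ^ (p - 3))) (t, y) with hφ
  have hφm : Measurable (Function.uncurry φ) := by
    refine Measurable.indicator (by fun_prop) ?_
    exact measurableSet_le (by fun_prop) (by fun_prop)
  have h1 : ∀ t ∈ Set.Ioi (0 : ℝ), (ENNReal.ofReal t)⁻¹ ^ 2 * smallPart f t
      * ENNReal.ofReal (t ^ (p - 1)) = ∫⁻ y, φ t y := by
    intro t ht
    have ht : 0 < t := ht
    have hset : {y | ‖f y‖ₑ ≤ ENNReal.ofReal t} = {y | ‖f y‖ ≤ t} := by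
      ext y
      rw [Set.mem_ofPred_eq, Set.mem_ofPred_eq, ← ofReal_norm, ENNReal.ofReal_le_ofReal_iff ht.le]
    have hm : MeasurableSet {y | ‖f y‖ ≤ t} := measurableSet_le (by fun_prop) (by fun_prop)
    have hpow : (ENNReal.ofReal t)⁻¹ ^ 2 * ENNReal.ofReal (t ^ (p - 1))
        = ENNReal.ofReal (t ^ (p - 3)) := by
      rw [← ENNReal.ofReal_inv_of_pos ht, ← ENNReal.ofReal_pow (by positivity),
        ← ENNReal.ofReal_mul (by positivity), inv_pow, ← Real.rpow_natCast, ← Real.rpow_neg ht.le,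
        ← Real.rpow_add ht]
      congr 2
      push_cast
      ring
    rw [smallPart, hset, mul_right_comm, hpow, ← lintegral_const_mul _ (by fun_prop),
      ← lintegral_indicator hm]
    refine lintegral_congr fun y ↦ ?_
    by_cases hy : ‖f y‖ ≤ t
    · simp [hφ, hy, mul_comm]
    · simp [hφ, hy]
  rw [setLIntegral_congr_fun measurableSet_Ioi h1, lintegral_lintegral_swap hφm.aemeasurable,
    ← lintegral_const_mul _ (by fun_prop)]
  refine lintegral_mono fun y ↦ ?_
  -- The zeros of `f` are set apart because `t ^ (p - 3)` is not integrable at the origin; there the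
  -- factor `‖f y‖ₑ ^ 2` kills the integrand.
  rcases eq_or_ne (f y) 0 with h0 | h0
  · have : ∀ t, φ t y = 0 := fun t ↦ by
      simp only [hφ]
      rw [Set.indicator_apply]
      simp [h0]
    simp [this]
  have hpos : 0 < ‖f y‖ := norm_pos_iff.2 h0
  have h2 : ∀ t, φ t y = (Set.Ici ‖f y‖).indicator
      (fun t ↦ ‖f y‖ₑ ^ 2 * ENNReal.ofReal (t ^ (p - 3))) t := by
    intro t
    by_cases hy : ‖f y‖ ≤ t
    · simp [hφ, hy]
    · simp [hφ, hy]
  simp_rw [h2]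
  rw [lintegral_indicator measurableSet_Ici]
  refine (lintegral_mono' (Measure.restrict_mono le_rfl Measure.restrict_le_self) le_rfl).trans ?_
  rw [lintegral_const_mul _ (by fun_prop), lintegral_Ici_rpow hpos (by linarith), ← ofReal_norm,
    ENNReal.ofReal_rpow_of_nonneg hpos.le (by linarith), ← ENNReal.ofReal_pow hpos.le,
    ← ENNReal.ofReal_mul (by positivity), ← ENNReal.ofReal_mul (by
      have : 0 < 2 - p := by linarith
      positivity)]
  refine ENNReal.ofReal_le_ofReal (le_of_eq ?_)
  have hpp : ‖f y‖ ^ p = ‖f y‖ ^ 2 * ‖f y‖ ^ (p - 3 + 1) := by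
    rw [← Real.rpow_natCast, ← Real.rpow_add hpos]
    congr 1
    push_cast
    ring
  rw [hpp]
  have : (2 - p) ≠ 0 := by linarith
  have : p - 3 + 1 ≠ 0 := by linarith
  field_simp
  ring

/-- The constant in the `Lᵖ` estimate, `1 < p < 2`, for a convolution operator. -/
noncomputable def strongTypeConst (p : ℝ) (n : ℕ) (A B : ℝ≥0∞) : ℝ≥0∞ :=
  ENNReal.ofReal p * (weakTypeConst n A B *
    (ENNReal.ofReal (2 ^ (p - 1) / (p - 1)) + ENNReal.ofReal (1 / (2 - p))))

theorem lintegral_kernelConv_rpow_le_of_lt_two [Nontrivial E] {K f : E → ℂ} {A B : ℝ≥0∞}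
    (hKm : Measurable K) (hK : Integrable K) (hA : HormanderBound K A) (hB : ConvL2Bound K B)
    (hAt : A ≠ ∞) (hBt : B ≠ ∞)
    (hfm : Measurable f) (hf : Integrable f) (hfb : ∃ M, ∀ x, ‖f x‖ ≤ M) {p : ℝ} (hp1 : 1 < p)
    (hp : p < 2) :
    ∫⁻ x, ‖kernelConv K f x‖ₑ ^ p
      ≤ strongTypeConst p (finrank ℝ E) A B * ∫⁻ x, ‖f x‖ₑ ^ p := by
  have hTm := measurable_kernelConv hKm hfm
  have hl1 := lintegral_rpow_eq_lintegral_meas_lt_mul volume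
    (f := fun x ↦ ‖kernelConv K f x‖) (Eventually.of_forall fun x ↦ norm_nonneg _)
    hTm.norm.aemeasurable (p := p) (by linarith)
  simp_rw [ofReal_norm_rpow (by linarith : 0 ≤ p)] at hl1
  rw [hl1, strongTypeConst, mul_assoc, mul_assoc]
  have hmeas1 : Measurable fun t ↦ largePart f t * ENNReal.ofReal (t ^ (p - 1)) := by
    refine Measurable.mul ?_ (by fun_prop)
    refine Measurable.mul (by fun_prop) ?_
    have hm : ∀ t, MeasurableSet {y | ENNReal.ofReal (t / 2) < ‖f y‖ₑ} := fun t ↦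
      measurableSet_lt measurable_const hfm.enorm
    have : ∀ t, ∫⁻ y in {y | ENNReal.ofReal (t / 2) < ‖f y‖ₑ}, ‖f y‖ₑ
        = ∫⁻ y, {z : ℝ × E | ENNReal.ofReal (z.1 / 2) < ‖f z.2‖ₑ}.indicator
          (fun z ↦ ‖f z.2‖ₑ) (t, y) := fun t ↦ by
      rw [← lintegral_indicator (hm t)]
      rfl
    simp_rw [this]
    refine Measurable.lintegral_prod_right' (Measurable.indicator (by fun_prop) ?_)
    exact measurableSet_lt (by fun_prop) (by fun_prop)
  gcongr
  calc ∫⁻ t in Set.Ioi (0 : ℝ), volume {x | t < ‖kernelConv K f x‖} * ENNReal.ofReal (t ^ (p - 1))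
      ≤ ∫⁻ t in Set.Ioi (0 : ℝ), weakTypeConst (finrank ℝ E) A B *
        (largePart f t * ENNReal.ofReal (t ^ (p - 1))
          + (ENNReal.ofReal t)⁻¹ ^ 2 * smallPart f t * ENNReal.ofReal (t ^ (p - 1))) := by
        refine setLIntegral_mono' measurableSet_Ioi fun t ht ↦ ?_
        rw [← add_mul, ← mul_assoc]
        gcongr
        refine le_trans (measure_mono fun x hx ↦ ?_)
          (measure_lt_enorm_kernelConv_le hKm hK hA hB hfm hf hfb ht)
        have hx : t < ‖kernelConv K f x‖ := hx
        rw [Set.mem_ofPred_eq, ← ofReal_norm]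
        exact (ENNReal.ofReal_lt_ofReal_iff_of_nonneg (le_of_lt ht)).2 hx
    _ ≤ weakTypeConst (finrank ℝ E) A B * ((∫⁻ t in Set.Ioi (0 : ℝ),
          largePart f t * ENNReal.ofReal (t ^ (p - 1))) + ∫⁻ t in Set.Ioi (0 : ℝ),
          (ENNReal.ofReal t)⁻¹ ^ 2 * smallPart f t * ENNReal.ofReal (t ^ (p - 1))) := by
        rw [lintegral_const_mul' _ _ (weakTypeConst_ne_top _ hAt hBt), lintegral_add_left hmeas1]
    _ ≤ _ := by
        rw [lintegral_largePart_mul_rpow hfm hp1, add_mul]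
        gcongr
        exact lintegral_smallPart_mul_rpow_le hfm hp1 hp

end CalderonZygmund

/-! ### Plancherel and the `L²` bound -/

section PlancherelConvolution

open Metric Module
open scoped FourierTransform SchwartzMap

variable {E : Type*} [NormedAddCommGroup E] [InnerProductSpace ℝ E] [FiniteDimensional ℝ E]
  [MeasurableSpace E] [BorelSpace E]

/-- On `L¹ ∩ L²` the `L²` Fourier transform is given by the Fourier integral. -/
theorem coeFn_fourier_toLp_ae_eq {f : E → ℂ} (hf : Integrable f) (hf2 : MemLp f 2 volume) :
    (𝓕 (hf2.toLp f) : Lp ℂ 2 (volume : Measure E)) =ᵐ[volume] 𝓕 f := by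
  set U : Lp ℂ 2 (volume : Measure E) := 𝓕 (hf2.toLp f)
  have hUloc : LocallyIntegrable (U : E → ℂ) :=
    (Lp.memLp U).locallyIntegrable (by norm_num)
  have hcont : Continuous (𝓕 f) := VectorFourier.fourierIntegral_continuous
    Real.continuous_fourierChar continuous_inner hf
  have hloc : LocallyIntegrable (𝓕 f) := hcont.locallyIntegrable
  -- Both functions are tested against smooth compactly supported `g`. On the `L²` side the
  -- transform is moved by the Plancherel isometry, on the `L¹` side by the multiplication formula;
  -- both pairings equal `∫ f * 𝓕 ψ`.
  refine ae_eq_of_integral_contDiff_smul_eq hUloc hloc fun g hg hgc ↦ ?_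
  set ψ : 𝓢(E, ℂ) := HasCompactSupport.toSchwartzMap (f := fun x ↦ (g x : ℂ))
    (hgc.comp_left (g := fun r : ℝ ↦ (r : ℂ)) rfl)
    (Complex.ofRealCLM.contDiff.comp hg) with hψ
  have hψx : ∀ x, ψ x = (g x : ℂ) := fun x ↦ rfl
  have h1 : inner ℂ ((𝓕⁻ ψ).toLp 2) (hf2.toLp f) = inner ℂ (ψ.toLp 2) U := by
    rw [← Lp.inner_fourier_eq, SchwartzMap.toLp_fourier_eq]
    simp [U]
  have h2 : inner ℂ (ψ.toLp 2) U = ∫ x, g x • U x := by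
    rw [L2.inner_def]
    refine integral_congr_ae ?_
    filter_upwards [ψ.coeFn_toLp 2 volume] with x hx
    rw [hx, hψx]
    simp [mul_comm]
  have h3 : inner ℂ ((𝓕⁻ ψ).toLp 2) (hf2.toLp f) = ∫ x, f x * 𝓕 (ψ : E → ℂ) x := by
    rw [L2.inner_def]
    refine integral_congr_ae ?_
    filter_upwards [(𝓕⁻ ψ).coeFn_toLp 2 volume, hf2.coeFn_toLp] with x hx hx2
    rw [hx, hx2]
    simp only [RCLike.inner_apply]
    congr 1
    rw [SchwartzMap.fourierInv_coe, Real.fourierInv_eq', Real.fourier_eq', ← integral_conj]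
    refine integral_congr_ae (Eventually.of_forall fun y ↦ ?_)
    simp only [smul_eq_mul, map_mul, hψx, ← Complex.exp_conj, Complex.conj_ofReal, Complex.conj_I]
    congr 2
    push_cast
    ring
  have h4 : ∫ x, f x * 𝓕 (ψ : E → ℂ) x = ∫ x, 𝓕 f x * ψ x := by
    have := VectorFourier.integral_fourierIntegral_smul_eq_flip (μ := (volume : Measure E))
      (ν := (volume : Measure E)) (L := innerₗ E) (f := f) (g := (ψ : E → ℂ))
      Real.continuous_fourierChar continuous_inner hf ψ.integrable
    simp only [smul_eq_mul, flip_innerₗ] at this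
    exact this.symm
  rw [← h2, ← h1, h3, h4]
  refine integral_congr_ae (Eventually.of_forall fun x ↦ ?_)
  simp only [hψx, Complex.real_smul, mul_comm]

theorem lintegral_enorm_fourier_sq {f : E → ℂ} (hf : Integrable f) (hf2 : MemLp f 2 volume) :
    ∫⁻ x, ‖𝓕 f x‖ₑ ^ 2 = ∫⁻ x, ‖f x‖ₑ ^ 2 := by
  have h := Lp.norm_fourier_eq (hf2.toLp f)
  have key : ∀ g : Lp ℂ 2 (volume : Measure E), ∫⁻ x, ‖g x‖ₑ ^ 2 = ENNReal.ofReal (‖g‖ ^ 2) := by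
    intro g
    have h2 := eLpNorm_nnreal_pow_eq_lintegral (f := g) (p := 2) (μ := volume) (by norm_num)
    have h3 : ENNReal.ofReal ‖g‖ = eLpNorm g 2 volume := by
      rw [Lp.norm_def, ENNReal.ofReal_toReal (Lp.eLpNorm_ne_top g)]
    rw [ENNReal.ofReal_pow (norm_nonneg _), h3]
    have h4 : (∫⁻ x, ‖g x‖ₑ ^ ((2 : ℝ≥0) : ℝ)) = ∫⁻ x, ‖g x‖ₑ ^ 2 := by
      simp
    rw [← h4, ← h2]
    simp
  calc ∫⁻ x, ‖𝓕 f x‖ₑ ^ 2 = ∫⁻ x, ‖(𝓕 (hf2.toLp f) : Lp ℂ 2 (volume : Measure E)) x‖ₑ ^ 2 := by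
        refine lintegral_congr_ae ?_
        filter_upwards [coeFn_fourier_toLp_ae_eq hf hf2] with x hx
        rw [hx]
    _ = ∫⁻ x, ‖(hf2.toLp f) x‖ₑ ^ 2 := by rw [key, key, h]
    _ = ∫⁻ x, ‖f x‖ₑ ^ 2 := by
        refine lintegral_congr_ae ?_
        filter_upwards [hf2.coeFn_toLp] with x hx
        rw [hx]

theorem memLp_two_of_integrable_of_bounded {f : E → ℂ} (hf : Integrable f) {M : ℝ}
    (hM : ∀ x, ‖f x‖ ≤ M) : MemLp f 2 volume := by
  rw [memLp_two_iff_integrable_sq_norm hf.1]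
  refine (hf.norm.const_mul M).mono' (hf.1.norm.pow 2) (Eventually.of_forall fun x ↦ ?_)
  rw [Real.norm_eq_abs, abs_of_nonneg (by positivity), pow_two]
  gcongr
  exact hM x

/-- A bounded Fourier transform gives an `L²` bounded convolution operator. -/
theorem convL2Bound_of_norm_fourier_le {K : E → ℂ} (hK : Integrable K) {B : ℝ}
    (hB : ∀ ξ, ‖𝓕 K ξ‖ ≤ B) : ConvL2Bound K (ENNReal.ofReal B ^ 2) := by
  rintro g hgm hg ⟨M, hM⟩
  have hT := integrable_kernelConv hK hg
  rw [← lintegral_enorm_fourier_sq hT (memLp_two_of_integrable_of_bounded hT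
    (norm_kernelConv_le hK hM)), ← lintegral_enorm_fourier_sq hg
    (memLp_two_of_integrable_of_bounded hg hM), ← lintegral_const_mul' _ _ (by finiteness)]
  refine lintegral_mono fun ξ ↦ ?_
  have : 𝓕 (kernelConv K g) ξ = 𝓕 g ξ * 𝓕 K ξ := Real.fourier_mul_convolution_eq hg hK ξ
  rw [this, enorm_mul, mul_pow, mul_comm]
  gcongr
  rw [← ofReal_norm]
  exact ENNReal.ofReal_le_ofReal (hB ξ)

end PlancherelConvolution

/-! ### Duality: the range `p > 2`, and the full theorem -/

section CalderonZygmund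

open Metric Module
open scoped FourierTransform

variable {E : Type*} [NormedAddCommGroup E] [InnerProductSpace ℝ E] [FiniteDimensional ℝ E]
  [MeasurableSpace E] [BorelSpace E]

theorem HormanderBound.comp_neg {K : E → ℂ} {A : ℝ≥0∞} (hA : HormanderBound K A) :
    HormanderBound (fun x ↦ K (-x)) A := by
  intro y
  refine le_trans (le_of_eq ?_) (hA (-y))
  have hm : MeasurableSet {x : E | 2 * ‖y‖ ≤ ‖x‖} :=
    measurableSet_le measurable_const measurable_norm
  rw [norm_neg, ← lintegral_indicator hm, ← lintegral_indicator hm,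
    ← lintegral_neg_eq_self]
  refine lintegral_congr fun x ↦ ?_
  by_cases hx : 2 * ‖y‖ ≤ ‖x‖
  · rw [Set.indicator_of_mem (by simpa using hx), Set.indicator_of_mem (by simpa using hx)]
    simp only [neg_sub, neg_neg, sub_neg_eq_add]
    rw [add_comm]
  · rw [Set.indicator_of_notMem (by simpa using hx), Set.indicator_of_notMem (by simpa using hx)]

theorem integral_kernelConv_mul {K f h : E → ℂ} (hK : Integrable K)
    (hf : Integrable f) (hhm : Measurable h)
    (hhb : ∃ M, ∀ x, ‖h x‖ ≤ M) :
    ∫ x, kernelConv K f x * h x = ∫ t, f t * kernelConv (fun x ↦ K (-x)) h t := by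
  simp only [kernelConv, ← integral_mul_const, ← integral_const_mul]
  rw [integral_integral_swap]
  · refine integral_congr_ae (Eventually.of_forall fun t ↦ ?_)
    refine integral_congr_ae (Eventually.of_forall fun x ↦ ?_)
    simp only [neg_sub]
    ring
  · obtain ⟨M, hM⟩ := hhb
    have := (integrable_kernelConv_integrand hK hf).bdd_mul (c := M) (f := fun z : E × E ↦ h z.1)
      (hhm.comp measurable_fst).aestronglyMeasurable (Eventually.of_forall fun z ↦ hM z.1)
    refine this.congr (Eventually.of_forall fun z ↦ ?_)
    simp only [Function.uncurry]
    ring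

/-- The transpose of convolution with `K` is convolution with `K (-x)`, which satisfies the same
hypotheses. The conjugate exponent lies in `(1, 2)`, so the previous range applies to the transpose.
-/
theorem lintegral_kernelConv_rpow_le_of_two_lt [Nontrivial E] {K f : E → ℂ} {A B : ℝ≥0∞}
    (hKm : Measurable K) (hK : Integrable K) (hA : HormanderBound K A)
    (hB : ConvL2Bound (fun x ↦ K (-x)) B) (hAt : A ≠ ∞) (hBt : B ≠ ∞)
    (hfm : Measurable f) (hf : Integrable f) (hfb : ∃ M, ∀ x, ‖f x‖ ≤ M) {p : ℝ} (hp : 2 < p) :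
    ∫⁻ x, ‖kernelConv K f x‖ₑ ^ p
      ≤ strongTypeConst (p / (p - 1)) (finrank ℝ E) A B ^ (p - 1) * ∫⁻ x, ‖f x‖ₑ ^ p := by
  have hp1 : 0 < p - 1 := by linarith
  have hp0 : 0 < p := by linarith
  set q := p / (p - 1) with hq
  have hpq : p.HolderConjugate q := Real.HolderConjugate.conjExponent (by linarith)
  have hq1 : 1 < q := hpq.symm.lt
  have hq2 : q < 2 := by rw [hq, div_lt_iff₀ hp1]; linarith
  set C := strongTypeConst q (finrank ℝ E) A B
  set F := kernelConv K f with hF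
  have hFm : Measurable F := measurable_kernelConv hKm hfm
  have hFi : Integrable F := integrable_kernelConv hK hf
  obtain ⟨M, hM⟩ := hfb
  set N := M * ∫ t, ‖K t‖
  have hFN : ∀ x, ‖F x‖ ≤ N := norm_kernelConv_le hK hM
  have hN0 : 0 ≤ N := (norm_nonneg _).trans (hFN 0)
  -- The extremal dual function for `F`: it satisfies `F * h = ‖F‖ ^ p` and `‖h‖ ^ q = ‖F‖ ^ p`.
  set h : E → ℂ := fun x ↦ (starRingEnd ℂ) (F x) * ((‖F x‖ ^ (p - 2) : ℝ) : ℂ) with hh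
  have hhn : ∀ x, ‖h x‖ = ‖F x‖ ^ (p - 1) := by
    intro x
    rw [hh]
    simp only [norm_mul, RCLike.norm_conj, Complex.norm_real, Real.norm_eq_abs]
    rw [abs_of_nonneg (by positivity)]
    rcases (norm_nonneg (F x)).eq_or_lt with h0 | h0
    · rw [← h0, Real.zero_rpow hp1.ne', zero_mul]
    · rw [← Real.rpow_one_add' h0.le (by linarith)]
      ring_nf
  have hhm : Measurable h := by
    have : Measurable fun x ↦ (starRingEnd ℂ) (F x) :=
      Complex.continuous_conj.measurable.comp hFm
    fun_prop
  have hhb : ∀ x, ‖h x‖ ≤ N ^ (p - 1) := fun x ↦ by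
    rw [hhn]
    exact Real.rpow_le_rpow (norm_nonneg _) (hFN x) hp1.le
  have hhi : Integrable h := by
    refine (hFi.norm.const_mul (N ^ (p - 2))).mono' hhm.aestronglyMeasurable
      (Eventually.of_forall fun x ↦ ?_)
    rw [hh]
    simp only [norm_mul, RCLike.norm_conj, Complex.norm_real, Real.norm_eq_abs]
    rw [abs_of_nonneg (by positivity), mul_comm]
    gcongr
    exact hFN x
  have hFh : ∀ x, F x * h x = ((‖F x‖ ^ p : ℝ) : ℂ) := by
    intro x
    rw [hh]
    simp only
    rw [← mul_assoc, Complex.mul_conj, Complex.normSq_eq_norm_sq]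
    norm_cast
    rcases (norm_nonneg (F x)).eq_or_lt with h0 | h0
    · rw [← h0, Real.zero_rpow hp0.ne']; simp
    · rw [← Real.rpow_natCast, ← Real.rpow_add h0]
      push_cast
      ring_nf
  have hhq : ∀ x, ‖h x‖ₑ ^ q = ‖F x‖ₑ ^ p := by
    intro x
    rw [← ofReal_norm, hhn, ENNReal.ofReal_rpow_of_nonneg (by positivity) (by linarith),
      ← Real.rpow_mul (norm_nonneg _), hq, mul_div_cancel₀ _ hp1.ne',
      ofReal_norm_rpow hp0.le]
  have hFp : Integrable fun x ↦ ‖F x‖ ^ p := by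
    have : Integrable fun x ↦ F x * h x :=
      hFi.mul_bdd hhm.aestronglyMeasurable (Eventually.of_forall hhb)
    refine this.norm.congr (Eventually.of_forall fun x ↦ ?_)
    simp only [hFh, Complex.norm_real, Real.norm_eq_abs]
    rw [abs_of_nonneg (by positivity)]
  set I := ∫⁻ x, ‖F x‖ₑ ^ p with hI
  have hIeq : I = ENNReal.ofReal (∫ x, ‖F x‖ ^ p) := by
    rw [ofReal_integral_eq_lintegral_ofReal hFp (Eventually.of_forall fun x ↦ by positivity), hI]
    simp_rw [ofReal_norm_rpow hp0.le]
  -- Finiteness, which holds since `F` is bounded and integrable, is needed to cancel `I ^ (1 / q)`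
  -- from both sides of `hmain`.
  have hIt : I ≠ ∞ := by rw [hIeq]; exact ENNReal.ofReal_ne_top
  set J := ∫⁻ x, ‖f x‖ₑ ^ p
  have hmain : I ≤ J ^ (1 / p) * (C * I) ^ (1 / q) := by
    calc I = ‖∫ x, F x * h x‖ₑ := by
          simp_rw [hFh]
          rw [integral_complex_ofReal, enorm_ofReal_complex, hIeq, Real.enorm_eq_ofReal]
          exact integral_nonneg fun x ↦ by positivity
      _ = ‖∫ t, f t * kernelConv (fun x ↦ K (-x)) h t‖ₑ := by
          rw [hF, integral_kernelConv_mul hK hf hhm ⟨_, hhb⟩]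
      _ ≤ ∫⁻ t, ‖f t‖ₑ * ‖kernelConv (fun x ↦ K (-x)) h t‖ₑ := by
          refine (enorm_integral_le_lintegral_enorm _).trans_eq ?_
          simp_rw [enorm_mul]
      _ ≤ J ^ (1 / p) * (∫⁻ t, ‖kernelConv (fun x ↦ K (-x)) h t‖ₑ ^ q) ^ (1 / q) :=
          ENNReal.lintegral_mul_le_Lp_mul_Lq _ hpq hfm.enorm.aemeasurable
            (measurable_kernelConv (hKm.comp measurable_neg) hhm).enorm.aemeasurable
      _ ≤ J ^ (1 / p) * (C * I) ^ (1 / q) := by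
          gcongr
          refine (lintegral_kernelConv_rpow_le_of_lt_two (hKm.comp measurable_neg) hK.comp_neg
            hA.comp_neg hB hAt hBt hhm hhi ⟨_, hhb⟩ hq1 hq2).trans_eq ?_
          simp_rw [hhq]
          rfl
  rcases eq_or_ne I 0 with h0 | h0
  · rw [h0]; exact zero_le
  have hpi : (1 / p) + (1 / q) = 1 := by simpa using hpq.inv_add_inv_eq_one
  have hI1 : I ^ (1 / p) * I ^ (1 / q) = I := by
    rw [← ENNReal.rpow_add _ _ h0 hIt, hpi, ENNReal.rpow_one]
  have hq0 : 0 < 1 / q := by positivity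
  have h2 : I ^ (1 / p) ≤ J ^ (1 / p) * C ^ (1 / q) := by
    rw [ENNReal.mul_rpow_of_nonneg _ _ hq0.le, ← mul_assoc] at hmain
    nth_rewrite 1 [← hI1] at hmain
    exact (ENNReal.mul_le_mul_iff_left (by simp [h0, hIt])
      (ENNReal.rpow_ne_top_of_nonneg hq0.le hIt)).1 hmain
  calc I = (I ^ (1 / p)) ^ p := by
        rw [← ENNReal.rpow_mul, one_div_mul_cancel hp0.ne', ENNReal.rpow_one]
    _ ≤ (J ^ (1 / p) * C ^ (1 / q)) ^ p := by gcongr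
    _ = C ^ (p - 1) * J := by
        rw [ENNReal.mul_rpow_of_nonneg _ _ hp0.le, ← ENNReal.rpow_mul, ← ENNReal.rpow_mul,
          one_div_mul_cancel hp0.ne', ENNReal.rpow_one, mul_comm]
        congr 2
        rw [hq]
        field_simp

/-- The Calderón–Zygmund theorem for convolution operators with an integrable kernel: the norm on
`Lᵖ` is controlled by the Hörmander constant and the supremum of the Fourier transform. -/
theorem exists_lintegral_kernelConv_rpow_le [Nontrivial E] (A B : ℝ) {p : ℝ} (hp : 1 < p) :
    ∃ C : ℝ≥0∞, C ≠ ∞ ∧ ∀ K : E → ℂ, Measurable K → Integrable K →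
      HormanderBound K (ENNReal.ofReal A) → (∀ ξ, ‖𝓕 K ξ‖ ≤ B) →
      ∀ f : E → ℂ, Measurable f → Integrable f → (∃ M, ∀ x, ‖f x‖ ≤ M) →
      ∫⁻ x, ‖kernelConv K f x‖ₑ ^ p ≤ C * ∫⁻ x, ‖f x‖ₑ ^ p := by
  have hfin : ∀ s : ℝ, strongTypeConst s (finrank ℝ E) (ENNReal.ofReal A)
      (ENNReal.ofReal B ^ 2) ≠ ∞ := fun s ↦ by
    have := weakTypeConst_ne_top (finrank ℝ E) (ENNReal.ofReal_ne_top (r := A))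
      (ENNReal.pow_ne_top (n := 2) (ENNReal.ofReal_ne_top (r := B)))
    unfold strongTypeConst
    finiteness
  have hBt : ENNReal.ofReal B ^ 2 ≠ ∞ := by finiteness
  rcases lt_trichotomy p 2 with h2 | h2 | h2
  · exact ⟨_, hfin p, fun K hKm hK hA hB f hfm hf hfb ↦ lintegral_kernelConv_rpow_le_of_lt_two
      hKm hK hA (convL2Bound_of_norm_fourier_le hK hB) ENNReal.ofReal_ne_top hBt hfm hf hfb hp h2⟩
  · refine ⟨_, hBt, fun K hKm hK hA hB f hfm hf hfb ↦ ?_⟩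
    have := convL2Bound_of_norm_fourier_le hK hB f hfm hf hfb
    simpa [h2] using this
  · refine ⟨_, ENNReal.rpow_ne_top_of_nonneg (by linarith : 0 ≤ p - 1) (hfin (p / (p - 1))),
      fun K hKm hK hA hB f hfm hf hfb ↦ ?_⟩
    refine lintegral_kernelConv_rpow_le_of_two_lt hKm hK hA
      (convL2Bound_of_norm_fourier_le hK.comp_neg fun ξ ↦ ?_) ENNReal.ofReal_ne_top hBt hfm hf hfb h2
    have : 𝓕 (fun x ↦ K (-x)) ξ = 𝓕 K (-ξ) := by
      rw [← Real.fourierInv_eq_fourier_comp_neg, Real.fourierInv_eq_fourier_neg]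
    rw [this]
    exact hB _

end CalderonZygmund

/-! ### Superpositions of dilations as Calderón–Zygmund kernels -/

section DilatedKernel

open Metric Module
open scoped FourierTransform

variable {E : Type*} [NormedAddCommGroup E] [InnerProductSpace ℝ E] [FiniteDimensional ℝ E]
  [MeasurableSpace E] [BorelSpace E]

/-- Quantitative smoothness, decay and cancellation of a profile `g`. -/
structure ProfileBound (g : E → ℂ) (A : ℝ) : Prop where
  nonneg : 0 ≤ A
  continuous : Continuous g
  lintegral_le : ∫⁻ x, ‖g x‖ₑ ≤ ENNReal.ofReal A
  diff_le : ∀ y, ∫⁻ x, ‖g (x - y) - g x‖ₑ ≤ ENNReal.ofReal (A * ‖y‖)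
  moment_le : ∫⁻ x, ‖x‖ₑ * ‖g x‖ₑ ≤ ENNReal.ofReal A
  fourier_le : ∀ η, ‖𝓕⁻ g η‖ ≤ A * (‖η‖ / (1 + ‖η‖ ^ 2))

/-- The tails of `m` decay like the inverse of the radius. -/
def TailBound (m : Measure E) (A : ℝ) : Prop :=
  ∀ R, 0 < R → m {z | R ≤ ‖z‖} ≤ ENNReal.ofReal (A / R)

/-- The superposition over `ε < t < N` of the dilations of `g`, convolved with `m`. -/
noncomputable def dilatedKernel (g : E → ℂ) (m : Measure E) (lam ε N : ℝ) (v : E) : ℂ :=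
  -∫ s : ℝ × E, ((Real.exp (-lam * s.1) * (s.1 ^ (finrank ℝ E + 1))⁻¹ : ℝ) : ℂ)
    * g (-(s.1⁻¹ • v) - s.2) ∂((volume.restrict (Set.Ioo ε N)).prod m)

theorem lintegral_comp_neg_inv_smul_sub {F : E → ℝ≥0∞} {t : ℝ} (ht : 0 < t)
    (z : E) : ∫⁻ v, F (-(t⁻¹ • v) - z) = ENNReal.ofReal (t ^ finrank ℝ E) * ∫⁻ x, F x := by
  have h1 : ∫⁻ x, F x = ∫⁻ x, F (-x - z) := by
    rw [lintegral_neg_eq_self (fun x ↦ F (x - z)), lintegral_sub_right_eq_self]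
  have he : MeasurableEmbedding fun v : E ↦ t⁻¹ • v :=
    (Homeomorph.smulOfNeZero t⁻¹ (inv_ne_zero ht.ne')).measurableEmbedding
  rw [h1, ← he.lintegral_map (fun x ↦ F (-x - z)),
    Measure.map_addHaar_smul volume (inv_ne_zero ht.ne'), lintegral_smul_measure, smul_eq_mul]
  congr 2
  rw [inv_pow, inv_inv, abs_of_nonneg (by positivity)]

theorem integral_comp_neg_inv_smul_sub {F : Type*} [NormedAddCommGroup F] [NormedSpace ℝ F]
    (f : E → F) {t : ℝ} (ht : 0 < t) (z : E) :
    ∫ v, f (-(t⁻¹ • v) - z) = (t ^ finrank ℝ E) • ∫ x, f x := by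
  have h1 : ∫ x, f x = ∫ x, f (-x - z) := by
    rw [integral_neg_eq_self (fun x ↦ f (x - z)), integral_sub_right_eq_self]
  rw [h1, Measure.integral_comp_smul volume (fun x ↦ f (-x - z)), inv_pow, inv_inv,
    abs_of_nonneg (by positivity)]

variable {g : E → ℂ} {m : Measure E} {A A' lam ε N : ℝ}

theorem ProfileBound.integrable (hg : ProfileBound g A) : Integrable g :=
  ⟨hg.continuous.aestronglyMeasurable, hg.lintegral_le.trans_lt ENNReal.ofReal_lt_top⟩

theorem ProfileBound.slice_diff_le (hg : ProfileBound g A) {t : ℝ} (ht : 0 < t) (y z : E) :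
    ∫⁻ v, ‖g (-(t⁻¹ • (v - y)) - z) - g (-(t⁻¹ • v) - z)‖ₑ
      ≤ ENNReal.ofReal (t ^ finrank ℝ E) * ENNReal.ofReal (A * ‖y‖ / t) := by
  have h := lintegral_comp_neg_inv_smul_sub (F := fun x ↦ ‖g (x - -(t⁻¹ • y)) - g x‖ₑ) ht z
  have h1 : ∀ v, -(t⁻¹ • (v - y)) - z = -(t⁻¹ • v) - z - -(t⁻¹ • y) := fun v ↦ by
    rw [smul_sub]; abel
  simp_rw [h1]
  rw [h]
  gcongr
  refine (hg.diff_le _).trans (ENNReal.ofReal_le_ofReal (le_of_eq ?_))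
  rw [norm_neg, norm_smul, Real.norm_eq_abs, abs_of_pos (by positivity)]
  ring

/-- With `x = -v/t - z`, the condition `‖v‖ ≥ r` forces `‖x‖` or `‖z‖` to be at least `r / (2 t)`.
The first case is paid for by the first moment of `g`, the second by the tail of `m`. Both give
order `t / r`, so tails of order `1/R` are enough for `m`, which may have no first moment. -/
theorem ProfileBound.slice_tail_le [IsProbabilityMeasure m] (hg : ProfileBound g A)
    (hm : TailBound m A') (hA' : 0 ≤ A') {t r : ℝ} (ht : 0 < t) (hr : 0 < r) :
    ∫⁻ z, (∫⁻ v in {v | r ≤ ‖v‖}, ‖g (-(t⁻¹ • v) - z)‖ₑ) ∂m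
      ≤ ENNReal.ofReal (t ^ finrank ℝ E) * ENNReal.ofReal ((2 * A + 2 * A * A') * t / r) := by
  have hA := hg.nonneg
  have hgc := hg.continuous
  have hgm := hgc.measurable
  have hms : MeasurableSet {v : E | r ≤ ‖v‖} := measurableSet_le measurable_const measurable_norm
  have hmz : MeasurableSet {z : E | r / t / 2 ≤ ‖z‖} :=
    measurableSet_le measurable_const measurable_norm
  have hinner : ∀ z, ∫⁻ v in {v | r ≤ ‖v‖}, ‖g (-(t⁻¹ • v) - z)‖ₑ
      ≤ ENNReal.ofReal (t ^ finrank ℝ E) * (ENNReal.ofReal (2 * A * t / r)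
        + {z : E | r / t / 2 ≤ ‖z‖}.indicator (fun _ ↦ ENNReal.ofReal A) z) := by
    intro z
    calc ∫⁻ v in {v | r ≤ ‖v‖}, ‖g (-(t⁻¹ • v) - z)‖ₑ
        ≤ ∫⁻ v, (fun x ↦ ENNReal.ofReal (2 * t / r) * (‖x‖ₑ * ‖g x‖ₑ)
          + {z : E | r / t / 2 ≤ ‖z‖}.indicator (fun _ ↦ 1) z * ‖g x‖ₑ) (-(t⁻¹ • v) - z) := by
          rw [← lintegral_indicator hms]
          refine lintegral_mono fun v ↦ ?_
          by_cases hv : r ≤ ‖v‖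
          swap
          · rw [Set.indicator_of_notMem (by simpa using hv)]; exact zero_le
          rw [Set.indicator_of_mem (by simpa using hv)]
          set x := -(t⁻¹ • v) - z with hx
          have hxz : r / t ≤ ‖x‖ + ‖z‖ := by
            have : ‖t⁻¹ • v‖ ≤ ‖x‖ + ‖z‖ := by
              have h : t⁻¹ • v = -(x + z) := by rw [hx]; abel
              rw [h, norm_neg]
              exact norm_add_le _ _
            rw [norm_smul, Real.norm_eq_abs, abs_of_pos (by positivity)] at this
            refine le_trans ?_ this
            rw [div_eq_inv_mul]
            gcongr
          by_cases hz : r / t / 2 ≤ ‖z‖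
          · simp only
            rw [Set.indicator_of_mem (by simpa using hz), one_mul]
            exact le_add_self
          · refine le_trans ?_ (le_self_add (a := ENNReal.ofReal (2 * t / r) * (‖x‖ₑ * ‖g x‖ₑ)))
            rw [← mul_assoc]
            have h1 : (1 : ℝ≥0∞) ≤ ENNReal.ofReal (2 * t / r) * ‖x‖ₑ := by
              rw [← ofReal_norm, ← ENNReal.ofReal_mul (by positivity), ← ENNReal.ofReal_one]
              refine ENNReal.ofReal_le_ofReal ?_
              have h2 : r / t / 2 ≤ ‖x‖ := by linarith
              calc (1 : ℝ) = 2 * t / r * (r / t / 2) := by field_simp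
                _ ≤ _ := by gcongr
            calc ‖g x‖ₑ = 1 * ‖g x‖ₑ := (one_mul _).symm
              _ ≤ _ := by gcongr
      _ ≤ _ := by
          rw [lintegral_comp_neg_inv_smul_sub (F := fun x ↦
            ENNReal.ofReal (2 * t / r) * (‖x‖ₑ * ‖g x‖ₑ)
              + {z : E | r / t / 2 ≤ ‖z‖}.indicator (fun _ ↦ 1) z * ‖g x‖ₑ) ht]
          gcongr
          rw [lintegral_add_left (by fun_prop), lintegral_const_mul _ (by fun_prop),
            lintegral_const_mul _ (by fun_prop)]
          gcongr
          · calc ENNReal.ofReal (2 * t / r) * ∫⁻ x, ‖x‖ₑ * ‖g x‖ₑ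
                ≤ ENNReal.ofReal (2 * t / r) * ENNReal.ofReal A := by gcongr; exact hg.moment_le
              _ = ENNReal.ofReal (2 * A * t / r) := by
                rw [← ENNReal.ofReal_mul (by positivity)]
                congr 1
                ring
          · by_cases hz : r / t / 2 ≤ ‖z‖
            · simpa [hz] using hg.lintegral_le
            · simp [hz]
  refine (lintegral_mono hinner).trans ?_
  rw [lintegral_const_mul' _ _ ENNReal.ofReal_ne_top,
    lintegral_add_left measurable_const, lintegral_const, measure_univ, mul_one,
    lintegral_indicator hmz, setLIntegral_const]
  gcongr
  calc ENNReal.ofReal (2 * A * t / r) + ENNReal.ofReal A * m {z | r / t / 2 ≤ ‖z‖}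
      ≤ ENNReal.ofReal (2 * A * t / r) + ENNReal.ofReal A * ENNReal.ofReal (A' / (r / t / 2)) := by
        gcongr
        exact hm _ (by positivity)
    _ = _ := by
        rw [← ENNReal.ofReal_mul hA, ← ENNReal.ofReal_add (by positivity) (by positivity)]
        congr 1
        field_simp

/-- For `t` small relative to `‖y‖` no cancellation is needed: if `‖v‖ ≥ 2 ‖y‖`, both `v` and `v -
y` have norm at least `‖y‖`, so each term is bounded by the tail estimate. This doubles the
constant. -/
theorem ProfileBound.slice_hormander_le [IsProbabilityMeasure m] (hg : ProfileBound g A)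
    (hm : TailBound m A') (hA' : 0 ≤ A') {t : ℝ} (ht : 0 < t) {y : E} (hy : y ≠ 0) :
    ∫⁻ z, (∫⁻ v in {v | 2 * ‖y‖ ≤ ‖v‖}, ‖g (-(t⁻¹ • (v - y)) - z) - g (-(t⁻¹ • v) - z)‖ₑ) ∂m
      ≤ ENNReal.ofReal (t ^ finrank ℝ E) * ENNReal.ofReal ((4 * A + 4 * A * A') * t / ‖y‖) := by
  have hgc := hg.continuous
  have hgm := hgc.measurable
  have hA := hg.nonneg
  have hyp : 0 < ‖y‖ := norm_pos_iff.2 hy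
  have hms2 : MeasurableSet {v : E | 2 * ‖y‖ ≤ ‖v‖} :=
    measurableSet_le measurable_const measurable_norm
  have hms : MeasurableSet {v : E | ‖y‖ ≤ ‖v‖} :=
    measurableSet_le measurable_const measurable_norm
  have hT := hg.slice_tail_le hm hA' ht hyp
  calc ∫⁻ z, (∫⁻ v in {v | 2 * ‖y‖ ≤ ‖v‖}, ‖g (-(t⁻¹ • (v - y)) - z) - g (-(t⁻¹ • v) - z)‖ₑ) ∂m
      ≤ ∫⁻ z, (2 * ∫⁻ v in {v | ‖y‖ ≤ ‖v‖}, ‖g (-(t⁻¹ • v) - z)‖ₑ) ∂m := by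
        refine lintegral_mono fun z ↦ ?_
        calc ∫⁻ v in {v | 2 * ‖y‖ ≤ ‖v‖}, ‖g (-(t⁻¹ • (v - y)) - z) - g (-(t⁻¹ • v) - z)‖ₑ
            ≤ ∫⁻ v, ({v | ‖y‖ ≤ ‖v‖}.indicator (fun v ↦ ‖g (-(t⁻¹ • v) - z)‖ₑ) (v - y)
              + {v | ‖y‖ ≤ ‖v‖}.indicator (fun v ↦ ‖g (-(t⁻¹ • v) - z)‖ₑ) v) := by
              rw [← lintegral_indicator hms2]
              refine lintegral_mono fun v ↦ ?_
              by_cases hv : 2 * ‖y‖ ≤ ‖v‖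
              · have h1 : ‖y‖ ≤ ‖v‖ := by linarith
                have h2 : ‖y‖ ≤ ‖v - y‖ := by
                  have := norm_sub_norm_le v y
                  linarith
                rw [Set.indicator_of_mem (by simpa using hv),
                  Set.indicator_of_mem (by simpa using h2),
                  Set.indicator_of_mem (by simpa using h1)]
                exact enorm_sub_le
              · rw [Set.indicator_of_notMem (by simpa using hv)]; exact zero_le
          _ = 2 * ∫⁻ v in {v | ‖y‖ ≤ ‖v‖}, ‖g (-(t⁻¹ • v) - z)‖ₑ := by
              rw [lintegral_add_right _ (Measurable.indicator (by fun_prop) hms),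
                lintegral_sub_right_eq_self
                  ({v | ‖y‖ ≤ ‖v‖}.indicator fun v ↦ ‖g (-(t⁻¹ • v) - z)‖ₑ) y,
                lintegral_indicator hms, two_mul]
    _ ≤ 2 * (ENNReal.ofReal (t ^ finrank ℝ E)
          * ENNReal.ofReal ((2 * A + 2 * A * A') * t / ‖y‖)) := by
        rw [lintegral_const_mul' _ _ (by norm_num)]
        gcongr
    _ = _ := by
        rw [mul_left_comm, ← ENNReal.ofReal_ofNat, ← ENNReal.ofReal_mul (by norm_num)]
        congr 2
        ring

/-- The Jacobian `t ^ n` of the dilation meets the weight `t ^ -(n + 1)` and leaves the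
scale-invariant `1/t`. The exponential is discarded as at most `1`, which makes the bound
independent of `lam`. -/
theorem ofReal_weight_mul_le (hlam : 0 ≤ lam) {n : ℕ} {t : ℝ} (ht : 0 < t) {c : ℝ} :
    ‖((Real.exp (-lam * t) * (t ^ (n + 1))⁻¹ : ℝ) : ℂ)‖ₑ
      * (ENNReal.ofReal (t ^ n) * ENNReal.ofReal c) ≤ ENNReal.ofReal (t⁻¹ * c) := by
  have hexp : Real.exp (-lam * t) ≤ 1 := by
    rw [Real.exp_le_one_iff]
    nlinarith
  rw [enorm_ofReal_complex, Real.enorm_eq_ofReal (by positivity), ← mul_assoc,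
    ← ENNReal.ofReal_mul (by positivity), ENNReal.ofReal_mul (inv_nonneg.2 ht.le)]
  gcongr
  calc Real.exp (-lam * t) * (t ^ (n + 1))⁻¹ * t ^ n
      = Real.exp (-lam * t) * t⁻¹ := by
        rw [pow_succ]
        field_simp
    _ ≤ 1 * t⁻¹ := by gcongr
    _ = t⁻¹ := one_mul _

variable [IsProbabilityMeasure m]

theorem measurable_dilatedKernel_integrand (hgc : Continuous g) :
    Measurable fun w : E × (ℝ × E) ↦
      ((Real.exp (-lam * w.2.1) * (w.2.1 ^ (finrank ℝ E + 1))⁻¹ : ℝ) : ℂ)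
        * g (-(w.2.1⁻¹ • w.1) - w.2.2) := by
  have h1 : Measurable fun w : E × (ℝ × E) ↦ -(w.2.1⁻¹ • w.1) - w.2.2 := by fun_prop
  have := hgc.measurable.comp h1
  have h2 : Measurable fun w : E × (ℝ × E) ↦
      (Real.exp (-lam * w.2.1) * (w.2.1 ^ (finrank ℝ E + 1))⁻¹ : ℝ) := by fun_prop
  exact (Complex.measurable_ofReal.comp h2).mul this

theorem measurable_dilatedKernel (hgc : Continuous g) :
    Measurable (dilatedKernel g m lam ε N) := by
  have := (measurable_dilatedKernel_integrand (lam := lam) hgc).stronglyMeasurable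
  exact (this.integral_prod_right (ν := (volume.restrict (Set.Ioo ε N)).prod m)).measurable.neg

theorem lintegral_dilatedKernel_integrand_lt_top (hg : ProfileBound g A) (hlam : 0 ≤ lam)
    (hε : 0 < ε) :
    ∫⁻ s : ℝ × E, (∫⁻ v, ‖((Real.exp (-lam * s.1) * (s.1 ^ (finrank ℝ E + 1))⁻¹ : ℝ) : ℂ)
      * g (-(s.1⁻¹ • v) - s.2)‖ₑ) ∂((volume.restrict (Set.Ioo ε N)).prod m) < ∞ := by
  have hA := hg.nonneg
  have hgc := hg.continuous
  have hgm := hgc.measurable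
  have hae : ∀ᵐ s : ℝ × E ∂((volume.restrict (Set.Ioo ε N)).prod m), s.1 ∈ Set.Ioo ε N :=
    (Measure.quasiMeasurePreserving_fst (μ := volume.restrict (Set.Ioo ε N)) (ν := m)).ae
      (ae_restrict_mem measurableSet_Ioo)
  calc _ ≤ ∫⁻ s : ℝ × E, ENNReal.ofReal (ε⁻¹ * A) ∂((volume.restrict (Set.Ioo ε N)).prod m) := by
        refine lintegral_mono_ae ?_
        filter_upwards [hae] with s hs
        have ht : 0 < s.1 := hε.trans hs.1
        simp_rw [enorm_mul]
        rw [lintegral_const_mul _ (by fun_prop),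
          lintegral_comp_neg_inv_smul_sub (F := fun x ↦ ‖g x‖ₑ) ht]
        calc _ ≤ ‖((Real.exp (-lam * s.1) * (s.1 ^ (finrank ℝ E + 1))⁻¹ : ℝ) : ℂ)‖ₑ
              * (ENNReal.ofReal (s.1 ^ finrank ℝ E) * ENNReal.ofReal A) := by
              gcongr
              exact hg.lintegral_le
          _ ≤ ENNReal.ofReal (s.1⁻¹ * A) := ofReal_weight_mul_le hlam ht
          _ ≤ _ := by
              gcongr
              exact hs.1.le
    _ < ∞ := by
        rw [lintegral_const]
        exact ENNReal.mul_lt_top ENNReal.ofReal_lt_top (measure_lt_top _ _)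

theorem integrable_dilatedKernel_integrand (hg : ProfileBound g A) (hlam : 0 ≤ lam) (hε : 0 < ε) :
    Integrable (fun w : E × (ℝ × E) ↦
      ((Real.exp (-lam * w.2.1) * (w.2.1 ^ (finrank ℝ E + 1))⁻¹ : ℝ) : ℂ)
        * g (-(w.2.1⁻¹ • w.1) - w.2.2))
      (volume.prod ((volume.restrict (Set.Ioo ε N)).prod m)) := by
  have hmeas := measurable_dilatedKernel_integrand (lam := lam) hg.continuous
  refine ⟨hmeas.aestronglyMeasurable, ?_⟩
  rw [HasFiniteIntegral, lintegral_prod_symm' _ hmeas.enorm]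
  exact lintegral_dilatedKernel_integrand_lt_top hg hlam hε

theorem integrable_dilatedKernel (hg : ProfileBound g A) (hlam : 0 ≤ lam) (hε : 0 < ε) :
    Integrable (dilatedKernel g m lam ε N) :=
  (integrable_dilatedKernel_integrand hg hlam hε).integral_prod_left.neg

/-- Integration against the dilated kernel. -/
theorem integral_mul_dilatedKernel (hg : ProfileBound g A) (hlam : 0 ≤ lam) (hε : 0 < ε)
    {φ : E → ℂ} (hφ : Measurable φ) {M : ℝ} (hφM : ∀ x, ‖φ x‖ ≤ M) :
    ∫ v, φ v * dilatedKernel g m lam ε N v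
      = -∫ s : ℝ × E, ((Real.exp (-lam * s.1) * s.1⁻¹ : ℝ) : ℂ)
        * (∫ x, φ (-(s.1 • (x + s.2))) * g x) ∂((volume.restrict (Set.Ioo ε N)).prod m) := by
  simp only [dilatedKernel, mul_neg, ← integral_const_mul]
  rw [integral_neg, integral_integral_swap]
  · congr 1
    have hae : ∀ᵐ s : ℝ × E ∂((volume.restrict (Set.Ioo ε N)).prod m), s.1 ∈ Set.Ioo ε N :=
      (Measure.quasiMeasurePreserving_fst (μ := volume.restrict (Set.Ioo ε N)) (ν := m)).ae
        (ae_restrict_mem measurableSet_Ioo)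
    refine integral_congr_ae ?_
    filter_upwards [hae] with s hs
    have ht : 0 < s.1 := hε.trans hs.1
    -- Substitution `x = -v/t - z`, whose inverse is `v = -t (x + z)`.
    have h := integral_comp_neg_inv_smul_sub (fun x ↦
      ((Real.exp (-lam * s.1) * (s.1 ^ (finrank ℝ E + 1))⁻¹ : ℝ) : ℂ)
        * (φ (-(s.1 • (x + s.2))) * g x)) ht s.2
    have h1 : ∀ v, -(s.1 • (-(s.1⁻¹ • v) - s.2 + s.2)) = v := fun v ↦ by
      rw [sub_add_cancel, smul_neg, smul_smul, mul_inv_cancel₀ ht.ne', one_smul, neg_neg]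
    simp only [h1] at h
    calc _ = ∫ v, ((Real.exp (-lam * s.1) * (s.1 ^ (finrank ℝ E + 1))⁻¹ : ℝ) : ℂ)
          * (φ v * g (-(s.1⁻¹ • v) - s.2)) := by
          refine integral_congr_ae (Eventually.of_forall fun v ↦ ?_)
          simp only
          ring
      _ = _ := by
          rw [h, ← integral_smul]
          refine integral_congr_ae (Eventually.of_forall fun v ↦ ?_)
          simp only [Complex.real_smul]
          rw [← mul_assoc]
          congr 1
          norm_cast
          field_simp
          ring
  · exact (integrable_dilatedKernel_integrand hg hlam hε).bdd_mul (c := M)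
      (f := fun w : E × (ℝ × E) ↦ φ w.1) (hφ.comp measurable_fst).aestronglyMeasurable
      (Eventually.of_forall fun w ↦ hφM w.1)

/-- The `t` integral is split at `‖y‖`. Below, the tail bound `t / ‖y‖` against `dt/t` integrates to
a constant; above, smoothness of the profile gives `A ‖y‖ / t²`, which integrates to `A`. Neither
piece depends on `ε`, `N` or `lam`. -/
theorem hormanderBound_dilatedKernel (hg : ProfileBound g A) (hm : TailBound m A') (hA' : 0 ≤ A')
    (hlam : 0 ≤ lam) (hε : 0 < ε) :
    HormanderBound (dilatedKernel g m lam ε N) (ENNReal.ofReal (5 * A + 4 * A * A')) := by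
  intro y
  have hA := hg.nonneg
  have hgc := hg.continuous
  have hgm := hgc.measurable
  rcases eq_or_ne y 0 with rfl | hy
  · simp
  have hyp : 0 < ‖y‖ := norm_pos_iff.2 hy
  set τ := (volume.restrict (Set.Ioo ε N)).prod m
  set W : ℝ → ℂ := fun t ↦ ((Real.exp (-lam * t) * (t ^ (finrank ℝ E + 1))⁻¹ : ℝ) : ℂ) with hW
  set V : Set E := {v | 2 * ‖y‖ ≤ ‖v‖}
  set D : ℝ → E → E → ℂ := fun t z v ↦ g (-(t⁻¹ • (v - y)) - z) - g (-(t⁻¹ • v) - z) with hD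
  have hDm : Measurable fun w : E × (ℝ × E) ↦ ‖W w.2.1 * D w.2.1 w.2.2 w.1‖ₑ := by
    have h1 : Measurable fun w : E × (ℝ × E) ↦ -(w.2.1⁻¹ • w.1) - w.2.2 := by fun_prop
    have h2 : Measurable fun w : E × (ℝ × E) ↦ -(w.2.1⁻¹ • (w.1 - y)) - w.2.2 := by fun_prop
    have h3 : Measurable fun w : E × (ℝ × E) ↦
      (Real.exp (-lam * w.2.1) * (w.2.1 ^ (finrank ℝ E + 1))⁻¹ : ℝ) := by fun_prop
    exact ((Complex.measurable_ofReal.comp h3).mul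
      ((hgc.measurable.comp h2).sub (hgc.measurable.comp h1))).enorm
  have hDm' : Measurable fun s : ℝ × E ↦ ∫⁻ v in V, ‖W s.1 * D s.1 s.2 v‖ₑ :=
    Measurable.lintegral_prod_left' hDm
  have hint := integrable_dilatedKernel_integrand (m := m) (N := N) hg hlam hε
  have hae : ∀ᵐ v : E, Integrable (fun s : ℝ × E ↦ W s.1 * g (-(s.1⁻¹ • v) - s.2)) τ :=
    hint.prod_right_ae
  have hae' : ∀ᵐ v : E, Integrable (fun s : ℝ × E ↦ W s.1 * g (-(s.1⁻¹ • (v - y)) - s.2)) τ :=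
    (measurePreserving_sub_right volume y).quasiMeasurePreserving.ae hae
  calc ∫⁻ v in V, ‖dilatedKernel g m lam ε N (v - y) - dilatedKernel g m lam ε N v‖ₑ
      ≤ ∫⁻ v in V, ∫⁻ s, ‖W s.1 * D s.1 s.2 v‖ₑ ∂τ := by
        refine lintegral_mono_ae (ae_restrict_of_ae ?_)
        filter_upwards [hae, hae'] with v h1 h2
        have : dilatedKernel g m lam ε N (v - y) - dilatedKernel g m lam ε N v
            = -∫ s, W s.1 * D s.1 s.2 v ∂τ := by
          simp only [hD, mul_sub]
          rw [integral_sub h2 h1, dilatedKernel, dilatedKernel]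
          ring
        rw [this, enorm_neg]
        exact enorm_integral_le_lintegral_enorm _
    _ = ∫⁻ s, (∫⁻ v in V, ‖W s.1 * D s.1 s.2 v‖ₑ) ∂τ := lintegral_lintegral_swap hDm.aemeasurable
    _ = ∫⁻ t in Set.Ioo ε N, ∫⁻ z, (∫⁻ v in V, ‖W t * D t z v‖ₑ) ∂m := by
        rw [lintegral_prod _ hDm'.aemeasurable]
    _ ≤ ∫⁻ t in Set.Ioo ε N, (Set.Iio ‖y‖).indicator
          (fun _ ↦ ENNReal.ofReal ((4 * A + 4 * A * A') / ‖y‖)) t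
          + (Set.Ici ‖y‖).indicator (fun t ↦ ENNReal.ofReal (A * ‖y‖)
            * ENNReal.ofReal (t ^ (-2 : ℝ))) t := by
        refine setLIntegral_mono' measurableSet_Ioo fun t ht ↦ ?_
        have ht0 : 0 < t := hε.trans ht.1
        have hDt : ∀ z, Measurable (D t z) := fun z ↦ by
          have : Continuous (D t z) := by fun_prop
          exact this.measurable
        simp_rw [enorm_mul]
        have hc : ∀ z, ∫⁻ v in V, ‖W t‖ₑ * ‖D t z v‖ₑ = ‖W t‖ₑ * ∫⁻ v in V, ‖D t z v‖ₑ := fun z ↦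
          lintegral_const_mul _ (hDt z).enorm
        simp_rw [hc]
        rw [lintegral_const_mul' _ _ (by finiteness)]
        by_cases hty : t < ‖y‖
        · rw [Set.indicator_of_mem (by simpa using hty)]
          refine le_trans ?_ le_self_add
          refine (mul_le_mul' le_rfl (hg.slice_hormander_le hm hA' ht0 hy)).trans
            ((ofReal_weight_mul_le hlam ht0).trans (ENNReal.ofReal_le_ofReal (le_of_eq ?_)))
          field_simp
        · rw [Set.indicator_of_mem (s := Set.Ici ‖y‖) (by simpa using hty)]
          refine le_trans ?_ le_add_self
          have hb : ∫⁻ z, (∫⁻ v in V, ‖D t z v‖ₑ) ∂m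
              ≤ ENNReal.ofReal (t ^ finrank ℝ E) * ENNReal.ofReal (A * ‖y‖ / t) := by
            calc ∫⁻ z, (∫⁻ v in V, ‖D t z v‖ₑ) ∂m
                ≤ ∫⁻ z, ENNReal.ofReal (t ^ finrank ℝ E) * ENNReal.ofReal (A * ‖y‖ / t) ∂m :=
                  lintegral_mono fun z ↦ (setLIntegral_le_lintegral _ _).trans
                    (hg.slice_diff_le ht0 y z)
              _ = _ := by rw [lintegral_const, measure_univ, mul_one]
          refine (mul_le_mul' le_rfl hb).trans ((ofReal_weight_mul_le hlam ht0).trans ?_)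
          rw [← ENNReal.ofReal_mul (by positivity)]
          refine ENNReal.ofReal_le_ofReal (le_of_eq ?_)
          rw [Real.rpow_neg ht0.le, Real.rpow_ofNat]
          field_simp
    _ ≤ ∫⁻ t in Set.Ioi (0 : ℝ), (Set.Iio ‖y‖).indicator
          (fun _ ↦ ENNReal.ofReal ((4 * A + 4 * A * A') / ‖y‖)) t
          + (Set.Ici ‖y‖).indicator (fun t ↦ ENNReal.ofReal (A * ‖y‖)
            * ENNReal.ofReal (t ^ (-2 : ℝ))) t :=
        lintegral_mono_set fun t ht ↦ hε.trans ht.1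
    _ ≤ ENNReal.ofReal (4 * A + 4 * A * A') + ENNReal.ofReal A := by
        rw [lintegral_add_left (measurable_const.indicator measurableSet_Iio)]
        gcongr
        · rw [lintegral_indicator measurableSet_Iio, setLIntegral_const,
            Measure.restrict_apply measurableSet_Iio, Set.Iio_inter_Ioi, Real.volume_Ioo, sub_zero,
            ← ENNReal.ofReal_mul (by positivity)]
          refine ENNReal.ofReal_le_ofReal (le_of_eq ?_)
          field_simp
        · refine (lintegral_mono' Measure.restrict_le_self le_rfl).trans ?_
          rw [lintegral_indicator measurableSet_Ici, lintegral_const_mul _ (by fun_prop),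
            lintegral_Ici_rpow hyp (by norm_num), ← ENNReal.ofReal_mul (by positivity)]
          refine ENNReal.ofReal_le_ofReal (le_of_eq ?_)
          norm_num
          rw [Real.rpow_neg_one]
          field_simp
    _ = _ := by
        rw [← ENNReal.ofReal_add (by positivity) hA]
        congr 1
        ring

/-- On the Fourier side dilation becomes `ξ ↦ t • ξ`, and translation by `z` contributes only a
phase, so `m` plays no role. The bound `A ‖η‖ / (1 + ‖η‖²)` at `η = t • ξ`, integrated against
`dt/t`, is at most `A ∫_ℝ ‖ξ‖ / (1 + t² ‖ξ‖²) dt ≤ A π`. Its vanishing at `η = 0` gives convergence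
at small `t`. -/
theorem norm_fourier_dilatedKernel_le (hg : ProfileBound g A) (hlam : 0 ≤ lam) (hε : 0 < ε)
    (ξ : E) : ‖𝓕 (dilatedKernel g m lam ε N) ξ‖ ≤ A * Real.pi := by
  have hA := hg.nonneg
  have hφm : Measurable fun v : E ↦ Complex.exp (↑(-2 * Real.pi * ⟪v, ξ⟫) * Complex.I) := by
    fun_prop
  rw [Real.fourier_eq']
  simp only [smul_eq_mul]
  rw [integral_mul_dilatedKernel (M := 1) hg hlam hε hφm fun v ↦
    (Complex.norm_exp_ofReal_mul_I _).le, norm_neg]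
  set τ := (volume.restrict (Set.Ioo ε N)).prod m
  have hinner : ∀ s : ℝ × E, ‖∫ x, Complex.exp (↑(-2 * Real.pi * ⟪-(s.1 • (x + s.2)), ξ⟫)
      * Complex.I) * g x‖ = ‖𝓕⁻ g (s.1 • ξ)‖ := by
    intro s
    have : ∀ x, Complex.exp (↑(-2 * Real.pi * ⟪-(s.1 • (x + s.2)), ξ⟫) * Complex.I) * g x
        = Complex.exp (↑(2 * Real.pi * ⟪s.1 • s.2, ξ⟫) * Complex.I)
          * (Complex.exp (↑(2 * Real.pi * ⟪x, s.1 • ξ⟫) * Complex.I) * g x) := by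
      intro x
      rw [← mul_assoc, ← Complex.exp_add]
      congr 2
      simp only [inner_neg_left, inner_smul_left, inner_add_left, inner_smul_right, conj_trivial]
      push_cast
      ring
    simp_rw [this]
    rw [integral_const_mul, norm_mul, Complex.norm_exp_ofReal_mul_I, one_mul, Real.fourierInv_eq']
    simp only [smul_eq_mul]
  have hae : ∀ᵐ s : ℝ × E ∂τ, s.1 ∈ Set.Ioo ε N :=
    (Measure.quasiMeasurePreserving_fst (μ := volume.restrict (Set.Ioo ε N)) (ν := m)).ae
      (ae_restrict_mem measurableSet_Ioo)
  have hint : Integrable (fun t : ℝ ↦ (1 + (t * ‖ξ‖) ^ 2)⁻¹ * ‖ξ‖) := by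
    rcases eq_or_ne ξ 0 with rfl | h
    · simp
    · exact (integrable_inv_one_add_sq.comp_mul_right' (norm_ne_zero_iff.2 h)).mul_const _
  have hnn : ∀ t : ℝ, 0 ≤ (1 + (t * ‖ξ‖) ^ 2)⁻¹ * ‖ξ‖ := fun t ↦ by positivity
  have hint2 : Integrable (fun s : ℝ × E ↦ A * ((1 + (s.1 * ‖ξ‖) ^ 2)⁻¹ * ‖ξ‖)) τ :=
    ((hint.restrict (s := Set.Ioo ε N)).comp_fst m).const_mul A
  calc _ ≤ ∫ s : ℝ × E, A * ((1 + (s.1 * ‖ξ‖) ^ 2)⁻¹ * ‖ξ‖) ∂τ := by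
        refine norm_integral_le_of_norm_le hint2 ?_
        filter_upwards [hae] with s hs
        have ht : 0 < s.1 := hε.trans hs.1
        rw [norm_mul, hinner, Complex.norm_real, Real.norm_eq_abs, abs_of_nonneg (by positivity)]
        have hexp : Real.exp (-lam * s.1) ≤ 1 := by
          rw [Real.exp_le_one_iff]
          nlinarith
        calc Real.exp (-lam * s.1) * s.1⁻¹ * ‖𝓕⁻ g (s.1 • ξ)‖
            ≤ 1 * s.1⁻¹ * (A * (‖s.1 • ξ‖ / (1 + ‖s.1 • ξ‖ ^ 2))) := by
              gcongr
              exact hg.fourier_le _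
          _ = _ := by
              rw [norm_smul, Real.norm_eq_abs, abs_of_pos ht]
              field_simp
    _ = A * ∫ t in Set.Ioo ε N, (1 + (t * ‖ξ‖) ^ 2)⁻¹ * ‖ξ‖ := by
        rw [integral_const_mul]
        congr 1
        have := integral_fun_fst (E := ℝ) (μ := volume.restrict (Set.Ioo ε N)) (ν := m)
          (f := fun t : ℝ ↦ (1 + (t * ‖ξ‖) ^ 2)⁻¹ * ‖ξ‖)
        simpa using this
    _ ≤ A * ∫ t : ℝ, (1 + (t * ‖ξ‖) ^ 2)⁻¹ * ‖ξ‖ := by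
        gcongr
        exact Eventually.of_forall hnn
        exact Measure.restrict_le_self
    _ ≤ A * Real.pi := by
        gcongr
        rw [integral_mul_const, Measure.integral_comp_mul_right (fun x : ℝ ↦ (1 + x ^ 2)⁻¹),
          integral_univ_inv_one_add_sq, abs_of_nonneg (by positivity), smul_eq_mul]
        rcases eq_or_ne ξ 0 with rfl | h
        · simpa using Real.pi_pos.le
        · have : ‖ξ‖ ≠ 0 := norm_ne_zero_iff.2 h
          apply le_of_eq
          field_simp

end DilatedKernel

/-! ### Compound Poisson laws -/

section ExponentialMeasure

open scoped Nat

variable {E : Type*} [NormedAddCommGroup E] [InnerProductSpace ℝ E]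
  [MeasurableSpace E] [BorelSpace E] [SecondCountableTopology E]

/-- The convolution powers of a measure. -/
noncomputable def convPow (M : Measure E) : ℕ → Measure E
  | 0 => Measure.dirac 0
  | n + 1 => convPow M n ∗ M

instance isFiniteMeasure_convPow (M : Measure E) [IsFiniteMeasure M] (n : ℕ) :
    IsFiniteMeasure (convPow M n) := by
  induction n with
  | zero => unfold convPow; infer_instance
  | succ n ih => unfold convPow; infer_instance

theorem charFun_convPow (M : Measure E) [IsFiniteMeasure M] (n : ℕ) (ζ : E) :
    charFun (convPow M n) ζ = charFun M ζ ^ n := by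
  induction n with
  | zero => simp [convPow, charFun_dirac]
  | succ n ih => rw [convPow, charFun_conv, ih, pow_succ]

theorem convPow_univ (M : Measure E) [IsFiniteMeasure M] (n : ℕ) :
    convPow M n Set.univ = ENNReal.ofReal (M.real Set.univ ^ n) := by
  have h := charFun_convPow M n 0
  rw [charFun_zero, charFun_zero] at h
  have h' : (convPow M n).real Set.univ = M.real Set.univ ^ n := by exact_mod_cast h
  rw [← h', Measure.real, ENNReal.ofReal_toReal (measure_ne_top _ _)]

/-- The compound Poisson law with Lévy measure `M`. -/
theorem exists_isProbabilityMeasure_charFun_eq_exp (M : Measure E) [IsFiniteMeasure M] :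
    ∃ m : Measure E, IsProbabilityMeasure m ∧
      ∀ ζ, charFun m ζ = Complex.exp (charFun M ζ - charFun M 0) := by
  set S : Measure E := Measure.sum fun n : ℕ ↦ ENNReal.ofReal ((n ! : ℝ)⁻¹) • convPow M n with hS
  have hSu : S Set.univ = ENNReal.ofReal (Real.exp (M.real Set.univ)) := by
    rw [hS, Measure.sum_apply _ MeasurableSet.univ]
    have h0 : HasSum (fun n : ℕ ↦ (n ! : ℝ)⁻¹ * M.real Set.univ ^ n)
        (Real.exp (M.real Set.univ)) := by
      have := NormedSpace.expSeries_div_hasSum_exp (M.real Set.univ)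
      rw [← Real.exp_eq_exp_ℝ] at this
      simpa [div_eq_inv_mul] using this
    rw [← h0.tsum_eq, ENNReal.ofReal_tsum_of_nonneg (fun n ↦ by positivity) h0.summable]
    refine tsum_congr fun n ↦ ?_
    rw [Measure.smul_apply, smul_eq_mul, convPow_univ, ENNReal.ofReal_mul (by positivity)]
  have hSfin : IsFiniteMeasure S := ⟨by rw [hSu]; exact ENNReal.ofReal_lt_top⟩
  have hS0 : NeZero S := ⟨fun h ↦ by
    rw [h] at hSu
    exact (ENNReal.ofReal_pos.2 (Real.exp_pos (M.real Set.univ))).ne hSu⟩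
  have hchar : ∀ ζ, charFun S ζ = Complex.exp (charFun M ζ) := by
    intro ζ
    have h1 : HasSum (fun n : ℕ ↦ (n ! : ℂ)⁻¹ * charFun M ζ ^ n) (Complex.exp (charFun M ζ)) := by
      have := NormedSpace.expSeries_div_hasSum_exp (charFun M ζ)
      rw [← Complex.exp_eq_exp_ℂ] at this
      simpa [div_eq_inv_mul] using this
    have h2 : HasSum (fun n : ℕ ↦ (n ! : ℂ)⁻¹ * charFun M ζ ^ n) (charFun S ζ) := by
      have hint : Integrable (fun x : E ↦ Complex.exp (⟪x, ζ⟫ * Complex.I)) S := by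
        refine (integrable_const (1 : ℝ)).mono' (by fun_prop) (Eventually.of_forall fun x ↦ ?_)
        exact (Complex.norm_exp_ofReal_mul_I _).le
      have := hasSum_integral_measure hint
      rw [charFun_apply]
      have hterm : ∀ n : ℕ, ∫ x, Complex.exp (⟪x, ζ⟫ * Complex.I)
          ∂(ENNReal.ofReal ((n ! : ℝ)⁻¹) • convPow M n) = (n ! : ℂ)⁻¹ * charFun M ζ ^ n := by
        intro n
        rw [integral_smul_measure, ENNReal.toReal_ofReal (by positivity), ← charFun_apply,
          charFun_convPow, Complex.real_smul]
        push_cast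
        rfl
      simp_rw [hterm] at this
      exact this
    exact h2.unique h1
  -- The total mass of `S` is `exp (M univ)`, so normalising it produces the factor `exp (-charFun M
  -- 0)`.
  refine ⟨(S Set.univ)⁻¹ • S, inferInstance, fun ζ ↦ ?_⟩
  rw [charFun_apply, integral_smul_measure, ← charFun_apply, hchar, hSu, Complex.exp_sub,
    ENNReal.toReal_inv, ENNReal.toReal_ofReal (Real.exp_pos _).le, charFun_zero, Complex.real_smul]
  push_cast
  rw [div_eq_inv_mul]

end ExponentialMeasure

/-! ### Tails from the characteristic function -/

section Tail

/-- A characteristic function which is Lipschitz at the origin gives tails of order `R⁻¹`. -/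
theorem tailBound_of_norm_one_sub_charFun_le {d : ℕ} {m : Measure (EuclideanSpace ℝ (Fin d))}
    [IsProbabilityMeasure m] {L : ℝ} (hL : ∀ ζ, ‖1 - charFun m ζ‖ ≤ L * ‖ζ‖) :
    TailBound m (8 * d ^ 2 * L) := by
  intro R hR
  rcases Nat.eq_zero_or_pos d with rfl | hd
  · have : {z : EuclideanSpace ℝ (Fin 0) | R ≤ ‖z‖} = ∅ := by
      ext z
      have : ‖z‖ = 0 := by
        rw [norm_eq_zero]
        exact Subsingleton.elim _ _
      simp [this, hR]
    simp [this]
  have hd' : (0 : ℝ) < d := by exact_mod_cast hd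
  set e : Fin d → EuclideanSpace ℝ (Fin d) := fun i ↦ EuclideanSpace.single i 1
  -- If all `d` coordinates are at most `r` in absolute value, the norm is at most `R / 2 < R`.
  set r := R / (2 * d) with hr
  have hr0 : 0 < r := by positivity
  have he : ∀ i, ‖e i‖ = 1 := fun i ↦ by simp [e]
  have hsub : {z : EuclideanSpace ℝ (Fin d) | R ≤ ‖z‖} ⊆ ⋃ i, {z | r < |⟪e i, z⟫|} := by
    intro z hz
    by_contra hcon
    simp only [Set.mem_iUnion, Set.mem_ofPred_eq, not_exists, not_lt] at hcon
    have h1 : ‖z‖ ≤ ∑ i : Fin d, r := by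
      have hz : z = ∑ i, ⟪e i, z⟫ • e i := by
        have := (EuclideanSpace.basisFun (Fin d) ℝ).sum_repr' z
        simpa [e] using this.symm
      calc ‖z‖ = ‖∑ i, ⟪e i, z⟫ • e i‖ := by rw [← hz]
        _ ≤ ∑ i, ‖⟪e i, z⟫ • e i‖ := norm_sum_le _ _
        _ ≤ ∑ i : Fin d, r := Finset.sum_le_sum fun i _ ↦ by
            rw [norm_smul, he, mul_one, Real.norm_eq_abs]
            exact hcon i
    have h2 : ∑ i : Fin d, r = R / 2 := by
      rw [Finset.sum_const, Finset.card_univ, Fintype.card_fin, nsmul_eq_mul, hr]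
      field_simp
    have hz : R ≤ ‖z‖ := hz
    linarith
  have hone : ∀ i, m.real {z | r < |⟪e i, z⟫|} ≤ 8 * d * L / R := by
    intro i
    -- The tail beyond `r` in direction `e i` is controlled by the integral of `1 - charFun m` over
    -- `|t| ≤ 2 / r`; the Lipschitz bound gives `4 L / r = 8 d L / R`.
    refine (measureReal_abs_inner_gt_le_integral_charFun hr0).trans ?_
    have h1 : ‖∫ t in -2 * r⁻¹..2 * r⁻¹, 1 - charFun m (t • e i)‖
        ≤ (L * (2 * r⁻¹)) * |2 * r⁻¹ - -2 * r⁻¹| := by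
      refine intervalIntegral.norm_integral_le_of_norm_le_const fun t ht ↦ ?_
      rw [Set.uIoc_of_le (by have := inv_pos.2 hr0; linarith)] at ht
      refine (hL _).trans ?_
      rw [norm_smul, he, mul_one, Real.norm_eq_abs]
      have hL0 : 0 ≤ L := by
        have := (norm_nonneg _).trans (hL (e i))
        rwa [he, mul_one] at this
      gcongr
      rw [abs_le]
      exact ⟨by linarith [ht.1], ht.2⟩
    calc 2⁻¹ * r * ‖∫ t in -2 * r⁻¹..2 * r⁻¹, 1 - charFun m (t • e i)‖
        ≤ 2⁻¹ * r * ((L * (2 * r⁻¹)) * |2 * r⁻¹ - -2 * r⁻¹|) := by gcongr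
      _ = 8 * d * L / R := by
          rw [show 2 * r⁻¹ - -2 * r⁻¹ = 4 * r⁻¹ by ring, abs_of_nonneg (by positivity), hr]
          field_simp
          ring
  have hreal : m.real {z | R ≤ ‖z‖} ≤ 8 * d ^ 2 * L / R := by
    calc m.real {z | R ≤ ‖z‖} ≤ m.real (⋃ i, {z | r < |⟪e i, z⟫|}) := measureReal_mono hsub
      _ ≤ ∑ i, m.real {z | r < |⟪e i, z⟫|} := measureReal_iUnion_fintype_le _
      _ ≤ ∑ i : Fin d, 8 * d * L / R := Finset.sum_le_sum fun i _ ↦ hone i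
      _ = 8 * d ^ 2 * L / R := by
          rw [Finset.sum_const, Finset.card_univ, Fintype.card_fin, nsmul_eq_mul]
          ring
  rw [← ENNReal.ofReal_toReal (measure_ne_top m _)]
  exact ENNReal.ofReal_le_ofReal hreal

end Tail

/-! ### The Lévy–Khintchine formula for the absolute value -/

section AbsRepresentation

theorem integrable_one_sub_cos_div_sq : Integrable fun x : ℝ ↦ (1 - Real.cos x) / x ^ 2 := by
  refine (integrable_inv_one_add_sq.const_mul 4).mono'
    (Measurable.aestronglyMeasurable (by fun_prop)) (Eventually.of_forall fun x ↦ ?_)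
  have h1 : 0 ≤ 1 - Real.cos x := by linarith [Real.cos_le_one x]
  rw [Real.norm_eq_abs, abs_of_nonneg (by positivity), ← div_eq_mul_inv]
  rcases eq_or_ne x 0 with rfl | hx
  · simp
  have hx2 : 0 < x ^ 2 := by positivity
  rw [div_le_div_iff₀ hx2 (by positivity)]
  have h2 : 1 - Real.cos x ≤ x ^ 2 / 2 := by linarith [Real.one_sub_sq_div_two_le_cos (x := x)]
  have h3 : 1 - Real.cos x ≤ 2 := by linarith [Real.neg_one_le_cos x]
  nlinarith

theorem integral_one_sub_cos_div_sq_pos : 0 < ∫ x : ℝ, (1 - Real.cos x) / x ^ 2 := by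
  have hnn : ∀ x : ℝ, 0 ≤ (1 - Real.cos x) / x ^ 2 := fun x ↦ by
    have h1 : 0 ≤ 1 - Real.cos x := by linarith [Real.cos_le_one x]
    positivity
  rw [integral_pos_iff_support_of_nonneg hnn integrable_one_sub_cos_div_sq]
  have hsub : Set.Ioo (0 : ℝ) 1 ⊆ Function.support fun x : ℝ ↦ (1 - Real.cos x) / x ^ 2 := by
    intro x hx
    have hcos : Real.cos x < 1 := by
      have := Real.cos_lt_cos_of_nonneg_of_le_pi le_rfl
        (by linarith [hx.2, Real.pi_gt_three]) hx.1
      rwa [Real.cos_zero] at this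
    have h0 := hx.1
    have : 0 < (1 - Real.cos x) / x ^ 2 := div_pos (by linarith) (by positivity)
    exact this.ne'
  refine lt_of_lt_of_le ?_ (measure_mono hsub)
  simp

/-- The normalising constant in the Lévy–Khintchine representation of `|s|`. -/
noncomputable def absConst : ℝ := ∫ x : ℝ, (1 - Real.cos x) / x ^ 2

theorem one_sub_cos_mul_div_sq (s x : ℝ) :
    (1 - Real.cos (x * s)) / x ^ 2 = s ^ 2 * ((1 - Real.cos (x * s)) / (x * s) ^ 2) := by
  rcases eq_or_ne s 0 with rfl | hs
  · simp
  rcases eq_or_ne x 0 with rfl | hx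
  · simp
  field_simp

theorem integrable_one_sub_cos_mul_div_sq (s : ℝ) :
    Integrable fun x : ℝ ↦ (1 - Real.cos (x * s)) / x ^ 2 := by
  simp_rw [one_sub_cos_mul_div_sq s]
  rcases eq_or_ne s 0 with rfl | hs
  · simp
  exact (integrable_one_sub_cos_div_sq.comp_mul_right' hs).const_mul _

theorem integral_one_sub_cos_mul_div_sq (s : ℝ) :
    ∫ x : ℝ, (1 - Real.cos (x * s)) / x ^ 2 = absConst * |s| := by
  simp_rw [one_sub_cos_mul_div_sq s]
  rw [integral_const_mul, Measure.integral_comp_mul_right (fun x : ℝ ↦ (1 - Real.cos x) / x ^ 2),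
    smul_eq_mul, absConst, abs_inv]
  rcases eq_or_ne s 0 with rfl | hs
  · simp
  have : |s| ≠ 0 := abs_ne_zero.2 hs
  field_simp
  rw [sq_abs]

/-- The Fourier transform of `x ↦ (1 - cos (x r)) / x²` is the second difference of `|·|`. -/
theorem integral_one_sub_cos_mul_exp (r s : ℝ) :
    ∫ x : ℝ, (((1 - Real.cos (x * r)) / x ^ 2 : ℝ) : ℂ) * Complex.exp (↑(x * s) * Complex.I)
      = ((absConst * ((|s - r| + |s + r|) / 2 - |s|) : ℝ) : ℂ) := by
  have hi := integrable_one_sub_cos_mul_div_sq r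
  have hic : Integrable fun x : ℝ ↦ (1 - Real.cos (x * r)) / x ^ 2 * Real.cos (x * s) :=
    hi.mul_bdd (c := 1) (by fun_prop) (Eventually.of_forall fun x ↦ by
      rw [Real.norm_eq_abs]; exact Real.abs_cos_le_one _)
  have his : Integrable fun x : ℝ ↦ (1 - Real.cos (x * r)) / x ^ 2 * Real.sin (x * s) :=
    hi.mul_bdd (c := 1) (by fun_prop) (Eventually.of_forall fun x ↦ by
      rw [Real.norm_eq_abs]; exact Real.abs_sin_le_one _)
  have hsin : ∫ x : ℝ, (1 - Real.cos (x * r)) / x ^ 2 * Real.sin (x * s) = 0 := by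
    have h := integral_neg_eq_self
      (fun x : ℝ ↦ (1 - Real.cos (x * r)) / x ^ 2 * Real.sin (x * s)) volume
    simp only [neg_mul, Real.cos_neg, Real.sin_neg, neg_sq, mul_neg, integral_neg] at h
    linarith
  have hcos : ∫ x : ℝ, (1 - Real.cos (x * r)) / x ^ 2 * Real.cos (x * s)
      = absConst * ((|s - r| + |s + r|) / 2 - |s|) := by
    -- Product-to-sum: the integrand becomes a combination of terms `(1 - cos (x u)) / x²`, each
    -- integrating to `absConst * |u|`.
    have h1 : ∀ x : ℝ, (1 - Real.cos (x * r)) / x ^ 2 * Real.cos (x * s)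
        = ((1 - Real.cos (x * (s - r))) / x ^ 2 + (1 - Real.cos (x * (s + r))) / x ^ 2) / 2
          - (1 - Real.cos (x * s)) / x ^ 2 := by
      intro x
      rw [mul_sub, mul_add, Real.cos_sub, Real.cos_add]
      ring
    simp_rw [h1]
    have h2 : Integrable fun x : ℝ ↦
        ((1 - Real.cos (x * (s - r))) / x ^ 2 + (1 - Real.cos (x * (s + r))) / x ^ 2) / 2 :=
      ((integrable_one_sub_cos_mul_div_sq _).add
        (integrable_one_sub_cos_mul_div_sq _)).div_const 2
    rw [integral_sub h2 (integrable_one_sub_cos_mul_div_sq _),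
      integral_div, integral_add (integrable_one_sub_cos_mul_div_sq _)
      (integrable_one_sub_cos_mul_div_sq _)]
    simp_rw [integral_one_sub_cos_mul_div_sq]
    ring
  have h2 : ∀ x : ℝ, (((1 - Real.cos (x * r)) / x ^ 2 : ℝ) : ℂ)
        * Complex.exp (↑(x * s) * Complex.I)
      = (((1 - Real.cos (x * r)) / x ^ 2 * Real.cos (x * s) : ℝ) : ℂ)
        + (((1 - Real.cos (x * r)) / x ^ 2 * Real.sin (x * s) : ℝ) : ℂ) * Complex.I := by
    intro x
    rw [Complex.exp_mul_I]
    push_cast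
    ring
  simp_rw [h2]
  rw [integral_add hic.ofReal (his.ofReal.mul_const _), integral_mul_const,
    integral_complex_ofReal, integral_complex_ofReal, hsin, hcos]
  simp

end AbsRepresentation

/-! ### The spectral exponent as a seminorm -/

section SpectralExponent

variable {d : ℕ} (μ : Measure (Metric.sphere (0 : EuclideanSpace ℝ (Fin d)) 1))

theorem abs_inner_sphere_le (ζ : EuclideanSpace ℝ (Fin d))
    (θ : Metric.sphere (0 : EuclideanSpace ℝ (Fin d)) 1) :
    |⟪ζ, (θ : EuclideanSpace ℝ (Fin d))⟫| ≤ ‖ζ‖ := by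
  refine (abs_real_inner_le_norm _ _).trans_eq ?_
  rw [norm_eq_of_mem_sphere, mul_one]

theorem integrable_abs_inner_sphere [IsFiniteMeasure μ] (ζ : EuclideanSpace ℝ (Fin d)) :
    Integrable (fun θ : Metric.sphere (0 : EuclideanSpace ℝ (Fin d)) 1 ↦
      |⟪ζ, (θ : EuclideanSpace ℝ (Fin d))⟫|) μ := by
  refine (integrable_const ‖ζ‖).mono' ?_ (Eventually.of_forall fun θ ↦ ?_)
  · exact (by fun_prop : Continuous fun θ : Metric.sphere (0 : EuclideanSpace ℝ (Fin d)) 1 ↦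
      |⟪ζ, (θ : EuclideanSpace ℝ (Fin d))⟫|).aestronglyMeasurable
  · rw [Real.norm_eq_abs, abs_abs]
    exact abs_inner_sphere_le ζ θ

theorem spectralExponent_zero : spectralExponent μ 0 = 0 := by
  simp [spectralExponent]

theorem spectralExponent_nonneg (ζ : EuclideanSpace ℝ (Fin d)) : 0 ≤ spectralExponent μ ζ :=
  integral_nonneg fun _ ↦ abs_nonneg _

theorem spectralExponent_smul (c : ℝ) (ζ : EuclideanSpace ℝ (Fin d)) :
    spectralExponent μ (c • ζ) = |c| * spectralExponent μ ζ := by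
  simp_rw [spectralExponent, real_inner_smul_left, abs_mul, integral_const_mul]

theorem spectralExponent_add_le [IsFiniteMeasure μ] (ζ η : EuclideanSpace ℝ (Fin d)) :
    spectralExponent μ (ζ + η) ≤ spectralExponent μ ζ + spectralExponent μ η := by
  unfold spectralExponent
  rw [← integral_add (integrable_abs_inner_sphere μ ζ) (integrable_abs_inner_sphere μ η)]
  refine integral_mono (integrable_abs_inner_sphere μ _)
    ((integrable_abs_inner_sphere μ ζ).add (integrable_abs_inner_sphere μ η)) fun θ ↦ ?_
  simp only [inner_add_left]
  exact abs_add_le _ _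

variable {μ} {κ : ℝ}

/-- The exponent is subadditive, so the upper bound of the nondegeneracy condition is also a
Lipschitz bound. -/
theorem abs_spectralExponent_sub_le [IsFiniteMeasure μ] (hκ : ∀ ζ, spectralExponent μ ζ ≤ κ * ‖ζ‖)
    (ζ η : EuclideanSpace ℝ (Fin d)) :
    |spectralExponent μ ζ - spectralExponent μ η| ≤ κ * ‖ζ - η‖ := by
  have h1 := spectralExponent_add_le μ (ζ - η) η
  have h2 := spectralExponent_add_le μ (η - ζ) ζ
  have h3 := hκ (ζ - η)
  have h4 := hκ (η - ζ)
  rw [norm_sub_rev] at h4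
  simp only [sub_add_cancel] at h1 h2
  rw [abs_le]
  constructor <;> linarith

theorem continuous_spectralExponent (μ : Measure (Metric.sphere (0 : EuclideanSpace ℝ (Fin d)) 1))
    [IsFiniteMeasure μ] : Continuous (spectralExponent μ) := by
  have h (ζ) : spectralExponent μ ζ ≤ μ.real Set.univ * ‖ζ‖ := by
    calc spectralExponent μ ζ ≤ ∫ _, ‖ζ‖ ∂μ :=
          integral_mono (integrable_abs_inner_sphere μ ζ) (integrable_const _)
            (abs_inner_sphere_le ζ)
      _ = μ.real Set.univ * ‖ζ‖ := by rw [integral_const, smul_eq_mul]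
  refine (LipschitzWith.of_dist_le_mul (K := ⟨μ.real Set.univ, measureReal_nonneg⟩)
    fun ζ η ↦ ?_).continuous
  rw [Real.dist_eq, dist_eq_norm]
  exact abs_spectralExponent_sub_le h ζ η

end SpectralExponent

/-! ### Mollifying the exponent at unit scale -/

section Mollification

variable {d : ℕ}

/-- A smooth even probability density supported in the ball of radius `2`. -/
noncomputable def mollifier (d : ℕ) : EuclideanSpace ℝ (Fin d) → ℝ :=
  (⟨1, 2, one_pos, one_lt_two⟩ : ContDiffBump (0 : EuclideanSpace ℝ (Fin d))).normed volume

theorem contDiff_mollifier : ContDiff ℝ (⊤ : ℕ∞) (mollifier d) :=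
  ContDiffBump.contDiff_normed _

theorem continuous_mollifier : Continuous (mollifier d) := contDiff_mollifier.continuous

theorem mollifier_nonneg (y : EuclideanSpace ℝ (Fin d)) : 0 ≤ mollifier d y :=
  ContDiffBump.nonneg_normed _ _

theorem mollifier_neg (y : EuclideanSpace ℝ (Fin d)) : mollifier d (-y) = mollifier d y :=
  ContDiffBump.normed_neg _ _

theorem integral_mollifier : ∫ y, mollifier d y = 1 :=
  ContDiffBump.integral_normed _

theorem hasCompactSupport_mollifier : HasCompactSupport (mollifier d) :=
  ContDiffBump.hasCompactSupport_normed _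

theorem integrable_mollifier : Integrable (mollifier d) :=
  continuous_mollifier.integrable_of_hasCompactSupport hasCompactSupport_mollifier

theorem norm_le_of_mollifier_ne_zero {y : EuclideanSpace ℝ (Fin d)} (hy : mollifier d y ≠ 0) :
    ‖y‖ ≤ 2 := by
  have h : y ∈ Function.support (mollifier d) := hy
  rw [mollifier, ContDiffBump.support_normed_eq, mem_ball_zero_iff] at h
  exact h.le

theorem mollifier_mul_norm_le (y : EuclideanSpace ℝ (Fin d)) :
    mollifier d y * ‖y‖ ≤ 2 * mollifier d y := by
  by_cases hy : mollifier d y = 0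
  · simp [hy]
  · have := norm_le_of_mollifier_ne_zero hy
    have := mollifier_nonneg y
    nlinarith

/-- The spectral exponent, mollified at unit scale. -/
noncomputable def mollifiedExponent (μ : Measure (Metric.sphere (0 : EuclideanSpace ℝ (Fin d)) 1))
    (ζ : EuclideanSpace ℝ (Fin d)) : ℝ :=
  ∫ y, mollifier d y * spectralExponent μ (ζ - y)

variable {μ : Measure (Metric.sphere (0 : EuclideanSpace ℝ (Fin d)) 1)} [IsFiniteMeasure μ]

theorem integrable_mollifier_mul {g : EuclideanSpace ℝ (Fin d) → ℝ} (hg : Continuous g) :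
    Integrable fun y ↦ mollifier d y * g y :=
  (continuous_mollifier.mul hg).integrable_of_hasCompactSupport
    hasCompactSupport_mollifier.mul_right

theorem mollifiedExponent_sub_le {κ : ℝ} (hκ : ∀ ζ, spectralExponent μ ζ ≤ κ * ‖ζ‖)
    (ζ η : EuclideanSpace ℝ (Fin d)) :
    |mollifiedExponent μ ζ - mollifiedExponent μ η| ≤ κ * ‖ζ - η‖ := by
  have hc := continuous_spectralExponent μ
  rw [mollifiedExponent, mollifiedExponent,
    ← integral_sub (integrable_mollifier_mul (by fun_prop)) (integrable_mollifier_mul (by fun_prop)),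
    ← Real.norm_eq_abs]
  calc _ ≤ ∫ y, mollifier d y * (κ * ‖ζ - η‖) := by
        refine norm_integral_le_of_norm_le (integrable_mollifier.mul_const _)
          (Eventually.of_forall fun y ↦ ?_)
        rw [← mul_sub, norm_mul, Real.norm_of_nonneg (mollifier_nonneg y), Real.norm_eq_abs]
        refine mul_le_mul_of_nonneg_left ?_ (mollifier_nonneg y)
        simpa using abs_spectralExponent_sub_le hκ (ζ - y) (η - y)
    _ = κ * ‖ζ - η‖ := by rw [integral_mul_const, integral_mollifier, one_mul]

/-- The mollifier moves the argument by at most `2` and the exponent is `κ`-Lipschitz. The error is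
thus bounded in `ζ`, and linear growth survives the mollification. -/
theorem abs_mollifiedExponent_sub_spectralExponent_le {κ : ℝ}
    (hκ : ∀ ζ, spectralExponent μ ζ ≤ κ * ‖ζ‖) (hκ0 : 0 ≤ κ) (ζ : EuclideanSpace ℝ (Fin d)) :
    |mollifiedExponent μ ζ - spectralExponent μ ζ| ≤ 2 * κ := by
  have hc := continuous_spectralExponent μ
  have h1 : spectralExponent μ ζ = ∫ y, mollifier d y * spectralExponent μ ζ := by
    rw [integral_mul_const, integral_mollifier, one_mul]
  rw [mollifiedExponent, h1,
    ← integral_sub (integrable_mollifier_mul (by fun_prop)) (integrable_mollifier_mul (by fun_prop)),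
    ← Real.norm_eq_abs]
  calc _ ≤ ∫ y, mollifier d y * (2 * κ) := by
        refine norm_integral_le_of_norm_le (integrable_mollifier.mul_const _)
          (Eventually.of_forall fun y ↦ ?_)
        rw [← mul_sub, norm_mul, Real.norm_of_nonneg (mollifier_nonneg y), Real.norm_eq_abs]
        have h2 := abs_spectralExponent_sub_le hκ (ζ - y) ζ
        rw [sub_sub_cancel_left, norm_neg] at h2
        have h3 := mollifier_mul_norm_le y
        have h4 := mul_le_mul_of_nonneg_left h2 (mollifier_nonneg y)
        nlinarith
    _ = 2 * κ := by rw [integral_mul_const, integral_mollifier, one_mul]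

end Mollification

/-! ### The compensating jump measure and law -/

section CompensatingMeasure

variable {d : ℕ} (μ : Measure (Metric.sphere (0 : EuclideanSpace ℝ (Fin d)) 1))

/-- The density of the jump measure compensating the mollification of the exponent. -/
noncomputable def jumpDensity
    (z : EuclideanSpace ℝ (Fin d) × Metric.sphere (0 : EuclideanSpace ℝ (Fin d)) 1 × ℝ) : ℝ :=
  absConst⁻¹ * (mollifier d z.1 *
    ((1 - Real.cos (z.2.2 * ⟪z.1, (z.2.1 : EuclideanSpace ℝ (Fin d))⟫)) / z.2.2 ^ 2))

theorem measurable_jumpDensity : Measurable (jumpDensity (d := d)) := by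
  have := (continuous_mollifier (d := d)).measurable
  unfold jumpDensity
  fun_prop

theorem jumpDensity_nonneg
    (z : EuclideanSpace ℝ (Fin d) × Metric.sphere (0 : EuclideanSpace ℝ (Fin d)) 1 × ℝ) :
    0 ≤ jumpDensity z := by
  have h1 : 0 < absConst := integral_one_sub_cos_div_sq_pos
  have h2 := mollifier_nonneg z.1
  have h3 : 0 ≤ 1 - Real.cos (z.2.2 * ⟪z.1, (z.2.1 : EuclideanSpace ℝ (Fin d))⟫) := by
    linarith [Real.cos_le_one (z.2.2 * ⟪z.1, (z.2.1 : EuclideanSpace ℝ (Fin d))⟫)]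
  unfold jumpDensity
  positivity

variable [IsFiniteMeasure μ]

/-- Integration in `x` leaves `mollifier d y * |⟪y, θ⟫|`, which is at most `2 * mollifier d y`. The
factor `1 - cos` removes the singularity of `x⁻²` at the origin, so the total mass is finite, unlike
that of a stable Lévy measure. -/
theorem integrable_jumpDensity :
    Integrable (jumpDensity (d := d)) (volume.prod (μ.prod volume)) := by
  have hm := measurable_jumpDensity (d := d)
  have hc : 0 < absConst := integral_one_sub_cos_div_sq_pos
  refine ⟨hm.aestronglyMeasurable, ?_⟩
  rw [hasFiniteIntegral_iff_ofReal (Eventually.of_forall jumpDensity_nonneg),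
    lintegral_prod _ (by fun_prop)]
  have hx : ∀ (y : EuclideanSpace ℝ (Fin d)) (θ : Metric.sphere (0 : EuclideanSpace ℝ (Fin d)) 1),
      ∫⁻ x : ℝ, ENNReal.ofReal (jumpDensity (y, θ, x))
        ≤ ENNReal.ofReal (2 * mollifier d y) := by
    intro y θ
    have hi : Integrable fun x : ℝ ↦ jumpDensity (y, θ, x) :=
      ((integrable_one_sub_cos_mul_div_sq ⟪y, (θ : EuclideanSpace ℝ (Fin d))⟫).const_mul
        (mollifier d y)).const_mul absConst⁻¹
    rw [← ofReal_integral_eq_lintegral_ofReal hi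
      (Eventually.of_forall fun x ↦ jumpDensity_nonneg _)]
    refine ENNReal.ofReal_le_ofReal ?_
    simp only [jumpDensity]
    rw [integral_const_mul, integral_const_mul, integral_one_sub_cos_mul_div_sq]
    have h1 := mul_le_mul_of_nonneg_left (abs_inner_sphere_le y θ) (mollifier_nonneg y)
    have h2 := mollifier_mul_norm_le y
    calc absConst⁻¹ * (mollifier d y * (absConst * |⟪y, (θ : EuclideanSpace ℝ (Fin d))⟫|))
        = mollifier d y * |⟪y, (θ : EuclideanSpace ℝ (Fin d))⟫| := by field_simp
      _ ≤ 2 * mollifier d y := h1.trans h2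
  calc ∫⁻ y, ∫⁻ w, ENNReal.ofReal (jumpDensity (y, w)) ∂(μ.prod volume)
      ≤ ∫⁻ y, ENNReal.ofReal (2 * mollifier d y) * μ Set.univ := by
        refine lintegral_mono fun y ↦ ?_
        rw [lintegral_prod _ (by fun_prop)]
        refine (lintegral_mono fun θ ↦ hx y θ).trans_eq ?_
        rw [lintegral_const]
    _ = (∫⁻ y, ENNReal.ofReal (2 * mollifier d y)) * μ Set.univ := by
        rw [lintegral_mul_const' _ _ (measure_ne_top _ _)]
    _ < ∞ := by
        refine ENNReal.mul_lt_top ?_ (measure_lt_top _ _)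
        exact (integrable_mollifier.const_mul 2).lintegral_lt_top

/-- The jump measure compensating the mollification of the exponent. -/
noncomputable def jumpMeasure : Measure (EuclideanSpace ℝ (Fin d)) :=
  ((volume.prod (μ.prod volume)).withDensity fun z ↦ ENNReal.ofReal (jumpDensity z)).map
    fun z ↦ z.2.2 • (z.2.1 : EuclideanSpace ℝ (Fin d))

instance isFiniteMeasure_jumpMeasure : IsFiniteMeasure (jumpMeasure μ) := by
  have : IsFiniteMeasure ((volume.prod (μ.prod volume)).withDensity
      fun z ↦ ENNReal.ofReal (jumpDensity (d := d) z)) :=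
    isFiniteMeasure_withDensity_ofReal (integrable_jumpDensity μ).2
  unfold jumpMeasure
  infer_instance

/-- Integration in `x` produces the symmetric second difference of `|·|` at `⟪ζ, θ⟫` with step `⟪y,
θ⟫`; integration in `θ` turns it into that of the exponent; averaging in `y` against the even
mollifier gives `ψ₁ - ψ`. It is the convexity of `|·|` in Fourier form: the density is nonnegative.
-/
theorem charFun_jumpMeasure (ζ : EuclideanSpace ℝ (Fin d)) :
    charFun (jumpMeasure μ) ζ = ((mollifiedExponent μ ζ - spectralExponent μ ζ : ℝ) : ℂ) := by
  have hc : 0 < absConst := integral_one_sub_cos_div_sq_pos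
  have hψ := continuous_spectralExponent μ
  have hm := measurable_jumpDensity (d := d)
  have hF : Integrable (fun z : EuclideanSpace ℝ (Fin d) ×
      Metric.sphere (0 : EuclideanSpace ℝ (Fin d)) 1 × ℝ ↦ (jumpDensity z : ℂ) *
        Complex.exp (↑(z.2.2 * ⟪ζ, (z.2.1 : EuclideanSpace ℝ (Fin d))⟫) * Complex.I))
      (volume.prod (μ.prod volume)) := by
    refine (integrable_jumpDensity μ).ofReal.mul_bdd (c := 1)
      (Measurable.aestronglyMeasurable (by fun_prop)) (Eventually.of_forall fun z ↦ ?_)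
    exact (Complex.norm_exp_ofReal_mul_I _).le
  have h1 : charFun (jumpMeasure μ) ζ = ∫ z, (jumpDensity z : ℂ) *
        Complex.exp (↑(z.2.2 * ⟪ζ, (z.2.1 : EuclideanSpace ℝ (Fin d))⟫) * Complex.I)
        ∂(volume.prod (μ.prod volume)) := by
    rw [charFun_apply, jumpMeasure, integral_map (Measurable.aemeasurable (by fun_prop))
      (Measurable.aestronglyMeasurable (by fun_prop)),
      integral_withDensity_eq_integral_toReal_smul (by fun_prop)
        (Eventually.of_forall fun _ ↦ ENNReal.ofReal_lt_top)]
    refine integral_congr_ae (Eventually.of_forall fun z ↦ ?_)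
    simp only
    rw [ENNReal.toReal_ofReal (jumpDensity_nonneg z), Complex.real_smul, real_inner_smul_left,
      real_inner_comm]
  have hx : ∀ (y : EuclideanSpace ℝ (Fin d)) (θ : Metric.sphere (0 : EuclideanSpace ℝ (Fin d)) 1),
      ∫ x : ℝ, (jumpDensity (y, θ, x) : ℂ) *
          Complex.exp (↑(x * ⟪ζ, (θ : EuclideanSpace ℝ (Fin d))⟫) * Complex.I)
        = ((mollifier d y * ((|⟪ζ - y, (θ : EuclideanSpace ℝ (Fin d))⟫|
          + |⟪ζ + y, (θ : EuclideanSpace ℝ (Fin d))⟫|) / 2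
          - |⟪ζ, (θ : EuclideanSpace ℝ (Fin d))⟫|) : ℝ) : ℂ) := by
    intro y θ
    have h2 : ∀ x : ℝ, (jumpDensity (y, θ, x) : ℂ) *
          Complex.exp (↑(x * ⟪ζ, (θ : EuclideanSpace ℝ (Fin d))⟫) * Complex.I)
        = ((absConst⁻¹ * mollifier d y : ℝ) : ℂ) *
          ((((1 - Real.cos (x * ⟪y, (θ : EuclideanSpace ℝ (Fin d))⟫)) / x ^ 2 : ℝ) : ℂ) *
          Complex.exp (↑(x * ⟪ζ, (θ : EuclideanSpace ℝ (Fin d))⟫) * Complex.I)) := by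
      intro x
      simp only [jumpDensity]
      push_cast
      ring
    simp_rw [h2]
    rw [integral_const_mul, integral_one_sub_cos_mul_exp, ← Complex.ofReal_mul,
      ← inner_sub_left, ← inner_add_left]
    congr 1
    field_simp
  have hθ : ∀ y : EuclideanSpace ℝ (Fin d),
      ∫ θ, (((mollifier d y * ((|⟪ζ - y, (θ : EuclideanSpace ℝ (Fin d))⟫|
          + |⟪ζ + y, (θ : EuclideanSpace ℝ (Fin d))⟫|) / 2
          - |⟪ζ, (θ : EuclideanSpace ℝ (Fin d))⟫|) : ℝ) : ℂ)) ∂μ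
        = ((mollifier d y * ((spectralExponent μ (ζ - y) + spectralExponent μ (ζ + y)) / 2
          - spectralExponent μ ζ) : ℝ) : ℂ) := by
    intro y
    have hi : Integrable (fun θ : Metric.sphere (0 : EuclideanSpace ℝ (Fin d)) 1 ↦
        (|⟪ζ - y, (θ : EuclideanSpace ℝ (Fin d))⟫|
          + |⟪ζ + y, (θ : EuclideanSpace ℝ (Fin d))⟫|) / 2) μ :=
      ((integrable_abs_inner_sphere μ _).add (integrable_abs_inner_sphere μ _)).div_const 2
    rw [integral_complex_ofReal, integral_const_mul,
      integral_sub hi (integrable_abs_inner_sphere μ _), integral_div,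
      integral_add (integrable_abs_inner_sphere μ _) (integrable_abs_inner_sphere μ _)]
    rfl
  have hfub : ∀ᵐ y : EuclideanSpace ℝ (Fin d), ∫ w, (jumpDensity (y, w) : ℂ) *
        Complex.exp (↑(w.2 * ⟪ζ, (w.1 : EuclideanSpace ℝ (Fin d))⟫) * Complex.I)
        ∂(μ.prod volume)
      = ((mollifier d y * ((spectralExponent μ (ζ - y) + spectralExponent μ (ζ + y)) / 2
          - spectralExponent μ ζ) : ℝ) : ℂ) := by
    filter_upwards [hF.prod_right_ae] with y hy
    rw [integral_prod _ hy]
    simp only [hx]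
    exact hθ y
  have hneg : ∫ y, mollifier d y * spectralExponent μ (ζ + y) = mollifiedExponent μ ζ := by
    rw [mollifiedExponent, ← integral_neg_eq_self]
    simp [mollifier_neg, sub_eq_add_neg]
  rw [h1, integral_prod _ hF, integral_congr_ae hfub, integral_complex_ofReal]
  congr 1
  have h3 : ∀ y : EuclideanSpace ℝ (Fin d), mollifier d y *
      ((spectralExponent μ (ζ - y) + spectralExponent μ (ζ + y)) / 2 - spectralExponent μ ζ)
      = (mollifier d y * spectralExponent μ (ζ - y) + mollifier d y * spectralExponent μ (ζ + y)) / 2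
        - mollifier d y * spectralExponent μ ζ := fun y ↦ by ring
  have i1 : Integrable fun y ↦ mollifier d y * spectralExponent μ (ζ - y) :=
    integrable_mollifier_mul (by fun_prop)
  have i2 : Integrable fun y ↦ mollifier d y * spectralExponent μ (ζ + y) :=
    integrable_mollifier_mul (by fun_prop)
  have i3 : Integrable fun y ↦ (mollifier d y * spectralExponent μ (ζ - y)
      + mollifier d y * spectralExponent μ (ζ + y)) / 2 := (i1.add i2).div_const 2
  simp_rw [h3]
  rw [integral_sub i3 (integrable_mollifier.mul_const _), integral_div, integral_add i1 i2, hneg,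
    integral_mul_const, integral_mollifier, one_mul, ← mollifiedExponent]
  ring

variable {μ}

/-- A probability law which, convolved with the law of symbol `exp (-(ψ₁ - ψ₁ 0))` (`ψ₁` the
mollified exponent), gives the `1`-stable law with exponent `ψ` and drift `b₀`. -/
theorem exists_compensating_law {κ : ℝ} (hκ : ∀ ζ, spectralExponent μ ζ ≤ κ * ‖ζ‖)
    (b₀ : EuclideanSpace ℝ (Fin d)) :
    ∃ m : Measure (EuclideanSpace ℝ (Fin d)), IsProbabilityMeasure m ∧
      (∀ ζ, charFun m ζ = ((Real.exp (mollifiedExponent μ ζ - mollifiedExponent μ 0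
        - spectralExponent μ ζ) : ℝ) : ℂ) * Complex.exp (⟪b₀, ζ⟫ * Complex.I)) ∧
      TailBound m (8 * d ^ 2 * (2 * κ + ‖b₀‖)) := by
  obtain ⟨m, hm, hchar⟩ := exists_isProbabilityMeasure_charFun_eq_exp (jumpMeasure μ)
  have h1 : ∀ ζ, charFun m ζ = ((Real.exp (mollifiedExponent μ ζ - mollifiedExponent μ 0
        - spectralExponent μ ζ) : ℝ) : ℂ) := by
    intro ζ
    rw [hchar, charFun_jumpMeasure, charFun_jumpMeasure, ← Complex.ofReal_sub,
      ← Complex.ofReal_exp, spectralExponent_zero]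
    congr 2
    ring
  have h2 : ∀ ζ, charFun (m.map fun x ↦ x + b₀) ζ = ((Real.exp (mollifiedExponent μ ζ
      - mollifiedExponent μ 0 - spectralExponent μ ζ) : ℝ) : ℂ)
        * Complex.exp (⟪b₀, ζ⟫ * Complex.I) := by
    intro ζ
    rw [charFun_map_add_const, h1, real_inner_comm]
  have hprob : IsProbabilityMeasure (m.map fun x ↦ x + b₀) :=
    Measure.isProbabilityMeasure_map (by fun_prop)
  refine ⟨m.map fun x ↦ x + b₀, hprob, h2, tailBound_of_norm_one_sub_charFun_le fun ζ ↦ ?_⟩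
  rw [h2]
  set a := mollifiedExponent μ ζ - mollifiedExponent μ 0 - spectralExponent μ ζ with ha
  -- The sign of `a` is read off from `exp a` being the value of a characteristic function.
  have ha0 : Real.exp a ≤ 1 := by
    have := norm_charFun_le_one (μ := m) ζ
    rwa [h1, Complex.norm_real, Real.norm_of_nonneg (Real.exp_pos _).le] at this
  have ha1 : 1 - Real.exp a ≤ 2 * κ * ‖ζ‖ := by
    have e1 := Real.add_one_le_exp a
    have e2 := (abs_le.1 (mollifiedExponent_sub_le hκ ζ 0)).1
    have e3 := hκ ζ
    rw [sub_zero] at e2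
    linarith
  set w := Complex.exp (⟪b₀, ζ⟫ * Complex.I) with hw
  have hw1 : ‖1 - w‖ ≤ ‖b₀‖ * ‖ζ‖ := by
    rw [norm_sub_rev, hw, mul_comm]
    refine (Real.norm_exp_I_mul_ofReal_sub_one_le).trans ?_
    exact abs_real_inner_le_norm _ _
  calc ‖1 - (Real.exp a : ℂ) * w‖ = ‖(1 - w) + ((1 - Real.exp a : ℝ) : ℂ) * w‖ := by
        congr 1
        push_cast
        ring
    _ ≤ ‖1 - w‖ + ‖((1 - Real.exp a : ℝ) : ℂ) * w‖ := norm_add_le _ _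
    _ = ‖1 - w‖ + (1 - Real.exp a) := by
        rw [norm_mul, hw, Complex.norm_exp_ofReal_mul_I, mul_one, Complex.norm_real,
          Real.norm_of_nonneg (by linarith)]
    _ ≤ (2 * κ + ‖b₀‖) * ‖ζ‖ := by linarith

end CompensatingMeasure

/-! ### Derivatives of a convolution with a rough factor -/

section Smear

variable {E F : Type} [NormedAddCommGroup E] [InnerProductSpace ℝ E] [FiniteDimensional ℝ E]
  [MeasurableSpace E] [BorelSpace E] [NormedAddCommGroup F] [NormedSpace ℝ F]

/-- The convolution of a scalar function with a vector-valued one. -/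
noncomputable def smear (ψ : E → ℝ) (g : E → F) (x : E) : F := ∫ t, ψ t • g (x - t)

theorem smear_eq_convolution (ψ : E → ℝ) (g : E → F) :
    smear ψ g = convolution ψ g (ContinuousLinearMap.lsmul ℝ ℝ) volume := rfl

theorem contDiff_smear {ψ : E → ℝ} {g : E → F} (hψ : Continuous ψ)
    (hg : ContDiff ℝ (⊤ : ℕ∞) g) (hgc : HasCompactSupport g) :
    ContDiff ℝ (⊤ : ℕ∞) (smear ψ g) :=
  hgc.contDiff_convolution_right (ContinuousLinearMap.lsmul ℝ ℝ) hψ.locallyIntegrable hg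

/-- Every derivative falls on the smooth factor `g`. The rough factor enters only through its linear
growth, which is why the derivative bounds for the mollified exponent depend on `μ` only through
`κ`. -/
theorem fderiv_smear {ψ : E → ℝ} {g : E → F} (hψ : Continuous ψ)
    (hg : ContDiff ℝ (⊤ : ℕ∞) g) (hgc : HasCompactSupport g) :
    fderiv ℝ (smear ψ g) = smear ψ (fderiv ℝ g) := by
  ext1 x
  rw [smear_eq_convolution]
  exact (hgc.hasFDerivAt_convolution_right (ContinuousLinearMap.lsmul ℝ ℝ)
    hψ.locallyIntegrable (hg.of_le (by exact_mod_cast le_top)) x).fderiv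

theorem norm_smear_le {ψ : E → ℝ} {g : E → F} {κ : ℝ} (hψ : ∀ t, |ψ t| ≤ κ * ‖t‖)
    (hκ : 0 ≤ κ) (hg : Continuous g) (hgc : HasCompactSupport g) (x : E) :
    ‖smear ψ g x‖ ≤ κ * (∫ t, (1 + ‖t‖) * ‖g t‖) * (1 + ‖x‖) := by
  have hi : Integrable fun t ↦ (1 + ‖t‖) * ‖g t‖ :=
    Continuous.integrable_of_hasCompactSupport (by fun_prop) hgc.norm.mul_left
  have h1 : smear ψ g x = ∫ t, ψ (x - t) • g t := by
    rw [smear, ← integral_sub_left_eq_self _ volume x]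
    simp
  rw [h1]
  calc ‖∫ t, ψ (x - t) • g t‖ ≤ ∫ t, κ * (1 + ‖x‖) * ((1 + ‖t‖) * ‖g t‖) := by
        refine norm_integral_le_of_norm_le (hi.const_mul _) (Eventually.of_forall fun t ↦ ?_)
        rw [norm_smul, Real.norm_eq_abs, ← mul_assoc]
        refine mul_le_mul_of_nonneg_right ((hψ _).trans ?_) (norm_nonneg _)
        rw [mul_assoc]
        refine mul_le_mul_of_nonneg_left ((norm_sub_le _ _).trans ?_) hκ
        nlinarith [norm_nonneg x, norm_nonneg t, mul_nonneg (norm_nonneg x) (norm_nonneg t)]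
    _ = _ := by
        rw [integral_const_mul]
        ring

end Smear

/-- All derivatives of the smeared function grow at most linearly, uniformly in `ψ`. -/
theorem exists_norm_iteratedFDeriv_smear_le {E : Type} [NormedAddCommGroup E]
    [InnerProductSpace ℝ E] [FiniteDimensional ℝ E] [MeasurableSpace E] [BorelSpace E]
    {κ : ℝ} (hκ : 0 ≤ κ) (n : ℕ) :
    ∀ {F : Type} [NormedAddCommGroup F] [NormedSpace ℝ F] (g : E → F),
      ContDiff ℝ (⊤ : ℕ∞) g → HasCompactSupport g →
      ∃ C : ℝ, ∀ ψ : E → ℝ, Continuous ψ → (∀ t, |ψ t| ≤ κ * ‖t‖) →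
        ∀ x, ‖iteratedFDeriv ℝ n (smear ψ g) x‖ ≤ C * (1 + ‖x‖) := by
  induction n with
  | zero =>
    intro F _ _ g hg hgc
    refine ⟨κ * ∫ t, (1 + ‖t‖) * ‖g t‖, fun ψ _ hψ x ↦ ?_⟩
    rw [norm_iteratedFDeriv_zero]
    exact norm_smear_le hψ hκ hg.continuous hgc x
  | succ n ih =>
    intro F _ _ g hg hgc
    -- The derivative takes values in `E →L[ℝ] F`, so the induction has to run over all target
    -- spaces.
    obtain ⟨C, hC⟩ := ih (fderiv ℝ g) (hg.fderiv_right (by simp)) (hgc.fderiv ℝ)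
    refine ⟨C, fun ψ hψc hψ x ↦ ?_⟩
    rw [← norm_iteratedFDeriv_fderiv, fderiv_smear hψc hg hgc]
    exact hC ψ hψc hψ x

/-! ### Uniform Schwartz bounds for the smooth symbol -/

section Symbol

variable {d : ℕ}

theorem mollifiedExponent_eq_smear
    (μ : Measure (Metric.sphere (0 : EuclideanSpace ℝ (Fin d)) 1)) :
    mollifiedExponent μ = smear (spectralExponent μ) (mollifier d) := by
  ext x
  rw [mollifiedExponent, smear, ← integral_sub_left_eq_self _ volume x]
  simp [mul_comm]

theorem contDiff_mollifiedExponent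
    (μ : Measure (Metric.sphere (0 : EuclideanSpace ℝ (Fin d)) 1)) [IsFiniteMeasure μ] :
    ContDiff ℝ (⊤ : ℕ∞) (mollifiedExponent μ) := by
  rw [mollifiedExponent_eq_smear]
  exact contDiff_smear (continuous_spectralExponent μ) contDiff_mollifier
    hasCompactSupport_mollifier

/-- The smooth part of the characteristic function of the `1`-stable law. -/
noncomputable def smoothSymbol (μ : Measure (Metric.sphere (0 : EuclideanSpace ℝ (Fin d)) 1))
    (ζ : EuclideanSpace ℝ (Fin d)) : ℂ :=
  ((Real.exp (mollifiedExponent μ 0 - mollifiedExponent μ ζ) : ℝ) : ℂ)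

theorem contDiff_smoothSymbol
    (μ : Measure (Metric.sphere (0 : EuclideanSpace ℝ (Fin d)) 1)) [IsFiniteMeasure μ] :
    ContDiff ℝ (⊤ : ℕ∞) (smoothSymbol μ) :=
  Complex.ofRealCLM.contDiff.comp
    (Real.contDiff_exp.comp (contDiff_const.sub (contDiff_mollifiedExponent μ)))

/-- The lower bound of the nondegeneracy condition gives the decay; mollification errors of `2 * κ`
at `ζ` and at `0` add up to `4 * κ`. -/
theorem mollifiedExponent_sub_ge {κ : ℝ}
    {μ : Measure (Metric.sphere (0 : EuclideanSpace ℝ (Fin d)) 1)} [IsFiniteMeasure μ]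
    (h : SpectralNondegenerate κ μ) (ζ : EuclideanSpace ℝ (Fin d)) :
    mollifiedExponent μ 0 - mollifiedExponent μ ζ ≤ 4 * κ - κ⁻¹ * ‖ζ‖ := by
  have hκ0 : 0 ≤ κ := zero_le_one.trans h.1
  have h1 := abs_le.1 (abs_mollifiedExponent_sub_spectralExponent_le (fun ζ ↦ (h.2 ζ).2) hκ0 ζ)
  have h2 := abs_le.1 (abs_mollifiedExponent_sub_spectralExponent_le (fun ζ ↦ (h.2 ζ).2) hκ0 0)
  have h3 := (h.2 ζ).1
  rw [spectralExponent_zero] at h2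
  linarith [h1.1, h2.2]

theorem norm_iteratedFDeriv_real_exp (n : ℕ) (x : ℝ) :
    ‖iteratedFDeriv ℝ n Real.exp x‖ = Real.exp x := by
  rw [norm_iteratedFDeriv_eq_norm_iteratedDeriv, iteratedDeriv_eq_iterate, Real.iter_deriv_exp,
    Real.norm_of_nonneg (Real.exp_pos x).le]

theorem pow_mul_exp_neg_le {c : ℝ} (hc : 0 < c) (m : ℕ) {r : ℝ} (hr : 0 ≤ r) :
    (1 + r) ^ m * Real.exp (-(c * r)) ≤ Real.exp c * m.factorial / c ^ m := by
  have h1 := Real.pow_div_factorial_le_exp (x := c * (1 + r)) (by positivity) m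
  have hm : (0 : ℝ) < m.factorial := by positivity
  rw [div_le_iff₀ hm, mul_pow, mul_add, mul_one, Real.exp_add] at h1
  rw [Real.exp_neg, ← div_eq_mul_inv, div_le_div_iff₀ (Real.exp_pos _) (by positivity)]
  linarith

/-- The Schwartz seminorms of the smooth symbol are controlled by the nondegeneracy constant. -/
theorem exists_pow_mul_norm_iteratedFDeriv_smoothSymbol_le (d : ℕ) {κ : ℝ} (hκ : 1 ≤ κ)
    (k n : ℕ) :
    ∃ C : ℝ, ∀ (μ : Measure (Metric.sphere (0 : EuclideanSpace ℝ (Fin d)) 1))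
      [IsFiniteMeasure μ], SpectralNondegenerate κ μ → ∀ ζ,
      ‖ζ‖ ^ k * ‖iteratedFDeriv ℝ n (smoothSymbol μ) ζ‖ ≤ C := by
  have hκ0 : 0 ≤ κ := zero_le_one.trans hκ
  have hκ' : 0 < κ⁻¹ := inv_pos.2 (by linarith)
  choose D hD using fun i ↦ exists_norm_iteratedFDeriv_smear_le hκ0 i (mollifier d)
    contDiff_mollifier hasCompactSupport_mollifier
  set K : ℝ := 1 + ∑ i ∈ Finset.range (n + 1), |D i| with hK
  have hsum : 0 ≤ ∑ i ∈ Finset.range (n + 1), |D i| := Finset.sum_nonneg fun _ _ ↦ abs_nonneg _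
  have hK1 : 1 ≤ K := by linarith
  refine ⟨n.factorial * K ^ n * Real.exp (4 * κ) *
    (Real.exp κ⁻¹ * (k + n).factorial / κ⁻¹ ^ (k + n)), fun μ _ h ζ ↦ ?_⟩
  set a : EuclideanSpace ℝ (Fin d) → ℝ := fun ζ ↦ mollifiedExponent μ 0 - mollifiedExponent μ ζ
    with ha
  have hac : ContDiff ℝ (⊤ : ℕ∞) a := contDiff_const.sub (contDiff_mollifiedExponent μ)
  have h1 : ‖iteratedFDeriv ℝ n (smoothSymbol μ) ζ‖ = ‖iteratedFDeriv ℝ n (Real.exp ∘ a) ζ‖ :=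
    LinearIsometry.norm_iteratedFDeriv_comp_left (n := ((⊤ : ℕ∞) : WithTop ℕ∞)) Complex.ofRealLI
      ((Real.contDiff_exp.comp hac).contDiffAt) (by exact_mod_cast le_top)
  -- The composition estimate wants the `i`-th derivative bounded by an `i`-th power; the linear
  -- bound `K (1 + ‖ζ‖)` is at least `1`, so it can be raised to that power.
  have h2 : ∀ i, 1 ≤ i → i ≤ n → ‖iteratedFDeriv ℝ i a ζ‖ ≤ (K * (1 + ‖ζ‖)) ^ i := by
    intro i hi hin
    have e1 : ‖iteratedFDeriv ℝ i a ζ‖ = ‖iteratedFDeriv ℝ i (mollifiedExponent μ) ζ‖ := by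
      obtain ⟨j, rfl⟩ := Nat.exists_eq_add_of_le' hi
      have : fderiv ℝ a = -fderiv ℝ (mollifiedExponent μ) := by
        ext1 x
        simp only [ha, fderiv_const_sub, Pi.neg_apply]
      rw [← norm_iteratedFDeriv_fderiv, this, iteratedFDeriv_neg, Pi.neg_apply, norm_neg,
        norm_iteratedFDeriv_fderiv]
    have e2 := hD i (spectralExponent μ) (continuous_spectralExponent μ) (fun t ↦ by
      rw [abs_of_nonneg (spectralExponent_nonneg μ t)]; exact (h.2 t).2) ζ
    rw [e1, mollifiedExponent_eq_smear]
    have e3 : D i ≤ K := by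
      have := Finset.single_le_sum (f := fun i ↦ |D i|) (fun _ _ ↦ abs_nonneg _)
        (Finset.mem_range.2 (Nat.lt_succ_of_le hin))
      linarith [le_abs_self (D i)]
    have e4 : 1 ≤ K * (1 + ‖ζ‖) := by nlinarith [norm_nonneg ζ]
    calc _ ≤ D i * (1 + ‖ζ‖) := e2
      _ ≤ K * (1 + ‖ζ‖) := by gcongr
      _ ≤ _ := le_self_pow₀ e4 (by omega)
  -- All derivatives of `exp` at `a ζ` equal `exp (a ζ)`, so `n` derivatives cost only `n! (K (1 +
  -- ‖ζ‖)) ^ n`, a polynomial absorbed by the exponential decay of `exp (a ζ)`.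
  have h3 := norm_iteratedFDeriv_comp_le (Real.contDiff_exp (n := ((⊤ : ℕ∞) : WithTop ℕ∞))) hac
    (n := n) (by exact_mod_cast le_top) ζ (C := Real.exp (a ζ))
    (fun i _ ↦ (norm_iteratedFDeriv_real_exp i _).le) h2
  have h4 : Real.exp (a ζ) ≤ Real.exp (4 * κ) * Real.exp (-(κ⁻¹ * ‖ζ‖)) := by
    rw [← Real.exp_add]
    refine Real.exp_le_exp.2 ?_
    have := mollifiedExponent_sub_ge h ζ
    simp only [ha]
    linarith
  rw [h1]
  calc ‖ζ‖ ^ k * ‖iteratedFDeriv ℝ n (Real.exp ∘ a) ζ‖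
      ≤ (1 + ‖ζ‖) ^ k * (n.factorial * (Real.exp (4 * κ) * Real.exp (-(κ⁻¹ * ‖ζ‖)))
        * (K * (1 + ‖ζ‖)) ^ n) := by
        refine mul_le_mul ?_ (h3.trans ?_) (norm_nonneg _) (by positivity)
        · gcongr
          linarith
        · gcongr
    _ = n.factorial * K ^ n * Real.exp (4 * κ) *
        ((1 + ‖ζ‖) ^ (k + n) * Real.exp (-(κ⁻¹ * ‖ζ‖))) := by
        rw [mul_pow, pow_add]
        ring
    _ ≤ _ := by
        gcongr
        exact pow_mul_exp_neg_le hκ' _ (norm_nonneg ζ)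

end Symbol

/-! ### From Schwartz seminorms to profile bounds -/

section SchwartzProfile

open scoped SchwartzMap FourierTransform LineDeriv

variable {E : Type*} [NormedAddCommGroup E] [InnerProductSpace ℝ E]

/-- The `L¹` modulus of continuity is controlled by the `L¹` norm of the derivative. -/
theorem lintegral_enorm_sub_translate_le [FiniteDimensional ℝ E] [MeasurableSpace E] [BorelSpace E]
    {g : E → ℂ} (hg : ContDiff ℝ 1 g) (y : E) :
    ∫⁻ x, ‖g (x - y) - g x‖ₑ ≤ (∫⁻ x, ‖fderiv ℝ g x‖ₑ) * ‖y‖ₑ := by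
  have hd : Continuous (fderiv ℝ g) := hg.continuous_fderiv one_ne_zero
  have h1 : ∀ x, ‖g (x - y) - g x‖ₑ
      ≤ ∫⁻ s in Set.Ioc (0 : ℝ) 1, ‖fderiv ℝ g (x - s • y)‖ₑ * ‖y‖ₑ := by
    intro x
    have hder : ∀ s : ℝ, HasDerivAt (fun s : ℝ ↦ g (x - s • y)) (fderiv ℝ g (x - s • y) (-y)) s := by
      intro s
      have e1 : HasDerivAt (fun s : ℝ ↦ x - s • y) (-y) s := by
        simpa using ((hasDerivAt_id s).smul_const y).const_sub x
      exact ((hg.differentiable one_ne_zero).differentiableAt.hasFDerivAt).comp_hasDerivAt s e1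
    have e2 := intervalIntegral.integral_eq_sub_of_hasDerivAt (a := 0) (b := 1)
      (fun s _ ↦ hder s) (Continuous.intervalIntegrable (by fun_prop) _ _)
    simp only [one_smul, zero_smul, sub_zero] at e2
    rw [← e2, intervalIntegral.integral_of_le zero_le_one]
    refine (enorm_integral_le_lintegral_enorm _).trans (lintegral_mono fun s ↦ ?_)
    rw [← enorm_neg y]
    exact ContinuousLinearMap.le_opENorm _ _
  calc ∫⁻ x, ‖g (x - y) - g x‖ₑ
      ≤ ∫⁻ x, ∫⁻ s in Set.Ioc (0 : ℝ) 1, ‖fderiv ℝ g (x - s • y)‖ₑ * ‖y‖ₑ := lintegral_mono h1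
    _ = ∫⁻ s in Set.Ioc (0 : ℝ) 1, ∫⁻ x, ‖fderiv ℝ g (x - s • y)‖ₑ * ‖y‖ₑ :=
        lintegral_lintegral_swap
          (Continuous.measurable (by fun_prop :
            Continuous fun z : E × ℝ ↦ ‖fderiv ℝ g (z.1 - z.2 • y)‖ₑ)|>.mul_const _).aemeasurable
    _ = ∫⁻ _ in Set.Ioc (0 : ℝ) 1, (∫⁻ x, ‖fderiv ℝ g x‖ₑ) * ‖y‖ₑ := by
        refine lintegral_congr fun s ↦ ?_
        rw [lintegral_mul_const' _ _ enorm_ne_top,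
          lintegral_sub_right_eq_self (fun x ↦ ‖fderiv ℝ g x‖ₑ)]
    _ = _ := by simp

/-- A Schwartz function is a profile, with constants controlled by finitely many seminorms. -/
theorem exists_profileBound_of_seminorm_le (E : Type*) [NormedAddCommGroup E]
    [InnerProductSpace ℝ E] [FiniteDimensional ℝ E] [MeasurableSpace E] [BorelSpace E] :
    ∃ (k₀ : ℕ) (c : ℝ), 1 ≤ c ∧ ∀ (g : 𝓢(E, ℂ)) (B : ℝ), 0 ≤ B →
      (∀ k ≤ k₀, ∀ n ≤ 1, SchwartzMap.seminorm ℂ k n g ≤ B) →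
      (∀ η, ‖𝓕⁻ (g : E → ℂ) η‖ ≤ B * (‖η‖ / (1 + ‖η‖ ^ 2))) → ProfileBound g (c * B) := by
  set N := (volume : Measure E).integrablePower with hN
  set I := 2 ^ N * ∫ x : E, (1 + ‖x‖) ^ (-(N : ℝ)) with hI
  have hI0 : 0 ≤ I := mul_nonneg (by positivity) (integral_nonneg fun x ↦ by positivity)
  -- An `L¹` norm with weight `‖x‖ ^ k`, `k ≤ 1`, is controlled by the seminorms of weights `0` and
  -- `k + N`, whence `1 + N` and `2 * I`; the extra `1` in the constant covers the Fourier bound.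
  refine ⟨1 + N, 1 + 2 * I, by linarith, fun g B hB hs hF ↦ ?_⟩
  have hc : 2 * I * B ≤ (1 + 2 * I) * B := by linarith
  have hint : ∀ k ≤ 1, ∀ n ≤ 1, ∫ x, ‖x‖ ^ k * ‖iteratedFDeriv ℝ n g x‖ ≤ (1 + 2 * I) * B := by
    intro k hk n hn
    refine (SchwartzMap.integral_pow_mul_iteratedFDeriv_le ℂ volume g k n).trans ?_
    refine (mul_le_mul_of_nonneg_left (add_le_add (hs 0 (by omega) n hn)
      (hs (k + N) (by omega) n hn)) hI0).trans ?_
    linarith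
  have hlint : ∀ k ≤ 1, ∀ n ≤ 1, ∫⁻ x, ENNReal.ofReal (‖x‖ ^ k * ‖iteratedFDeriv ℝ n g x‖)
      ≤ ENNReal.ofReal ((1 + 2 * I) * B) := by
    intro k hk n hn
    rw [← ofReal_integral_eq_lintegral_ofReal (g.integrable_pow_mul_iteratedFDeriv volume k n)
      (Eventually.of_forall fun x ↦ by positivity)]
    exact ENNReal.ofReal_le_ofReal (hint k hk n hn)
  have hfd : ∫⁻ x, ‖fderiv ℝ g x‖ₑ ≤ ENNReal.ofReal ((1 + 2 * I) * B) := by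
    refine (lintegral_congr fun x ↦ ?_).trans_le (hlint 0 zero_le_one 1 le_rfl)
    rw [pow_zero, one_mul, norm_iteratedFDeriv_one, ofReal_norm]
  refine ⟨by positivity, g.continuous, ?_, fun y ↦ ?_, ?_, fun η ↦ (hF η).trans ?_⟩
  · refine (lintegral_congr fun x ↦ ?_).trans_le (hlint 0 zero_le_one 0 zero_le_one)
    rw [pow_zero, one_mul, norm_iteratedFDeriv_zero, ofReal_norm]
  · refine (lintegral_enorm_sub_translate_le (g.smooth 1) y).trans ?_
    rw [ENNReal.ofReal_mul (by positivity), ofReal_norm]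
    gcongr
  · refine (lintegral_congr fun x ↦ ?_).trans_le (hlint 1 le_rfl 0 zero_le_one)
    rw [pow_one, norm_iteratedFDeriv_zero, ENNReal.ofReal_mul (norm_nonneg _),
      ofReal_norm, ofReal_norm]
  · refine mul_le_mul_of_nonneg_right ?_ (by positivity)
    nlinarith

/-- A continuous linear map of Schwartz space preserves uniform seminorm bounds. -/
theorem exists_seminorm_map_le {ι : Sort*} {Φ : ι → 𝓢(E, ℂ)}
    (hΦ : ∀ k n : ℕ, ∃ C, ∀ i x, ‖x‖ ^ k * ‖iteratedFDeriv ℝ n (Φ i) x‖ ≤ C)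
    (T : 𝓢(E, ℂ) →L[ℂ] 𝓢(E, ℂ)) (k n : ℕ) :
    ∃ C, ∀ i, SchwartzMap.seminorm ℂ k n (T (Φ i)) ≤ C := by
  have hw := schwartz_withSeminorms ℂ E ℂ
  -- Uniform seminorm bounds say that the family is von Neumann bounded, and continuous linear maps
  -- preserve boundedness. No constants need to be tracked through `T`.
  have hb : Bornology.IsVonNBounded ℂ (Set.range Φ) := by
    rw [hw.isVonNBounded_iff_seminorm_bounded]
    rintro ⟨k, n⟩
    obtain ⟨C, hC⟩ := hΦ k n
    refine ⟨|C| + 1, by positivity, ?_⟩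
    rintro _ ⟨i, rfl⟩
    have : SchwartzMap.seminorm ℂ k n (Φ i) ≤ |C| :=
      SchwartzMap.seminorm_le_bound ℂ k n (Φ i) (abs_nonneg C)
        fun x ↦ (hC i x).trans (le_abs_self C)
    exact this.trans_lt (by linarith)
  have hb' := hw.isVonNBounded_iff_seminorm_bounded.1 (hb.image T) (k, n)
  obtain ⟨r, -, hr⟩ := hb'
  exact ⟨r, fun i ↦ (hr _ ⟨Φ i, ⟨i, rfl⟩, rfl⟩).le⟩

end SchwartzProfile

/-! ### The density of the smooth symbol as a profile -/

section ProfileOfSymbol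

open scoped SchwartzMap FourierTransform LineDeriv

variable {d : ℕ} {κ : ℝ} (μ : Measure (Metric.sphere (0 : EuclideanSpace ℝ (Fin d)) 1))
  [IsFiniteMeasure μ]

/-- The smooth symbol as a Schwartz function. -/
noncomputable def symbolSchwartz (h : SpectralNondegenerate κ μ) :
    𝓢(EuclideanSpace ℝ (Fin d), ℂ) :=
  ⟨smoothSymbol μ, contDiff_smoothSymbol μ, fun k n ↦
    let ⟨C, hC⟩ := exists_pow_mul_norm_iteratedFDeriv_smoothSymbol_le d h.1 k n
    ⟨C, hC μ h⟩⟩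

variable (d) in
/-- The dilation by `2π`. -/
noncomputable def twoPiDilation : EuclideanSpace ℝ (Fin d) ≃L[ℝ] EuclideanSpace ℝ (Fin d) :=
  (LinearEquiv.smulOfNeZero ℝ (EuclideanSpace ℝ (Fin d)) (2 * Real.pi)
    Real.two_pi_pos.ne').toContinuousLinearEquiv

/-- The density whose characteristic function is the smooth symbol. -/
noncomputable def symbolDensity (h : SpectralNondegenerate κ μ) :
    𝓢(EuclideanSpace ℝ (Fin d), ℂ) :=
  𝓕 (SchwartzMap.compCLMOfContinuousLinearEquiv ℂ (twoPiDilation d) (symbolSchwartz μ h))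

theorem fourierInv_symbolDensity (h : SpectralNondegenerate κ μ)
    (ξ : EuclideanSpace ℝ (Fin d)) :
    (𝓕⁻ (symbolDensity μ h)) ξ = smoothSymbol μ ((2 * Real.pi) • ξ) := by
  rw [symbolDensity, FourierTransform.fourierInv_fourier_eq]
  rfl

/-- The dilation by `2π` in the definition of the density reconciles the Fourier kernel `exp (2πi⟪·,
·⟫)` with that of characteristic functions. -/
theorem integral_exp_mul_symbolDensity (h : SpectralNondegenerate κ μ)
    (ζ : EuclideanSpace ℝ (Fin d)) :
    ∫ y, Complex.exp (⟪y, ζ⟫ * Complex.I) * symbolDensity μ h y = smoothSymbol μ ζ := by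
  have h1 := fourierInv_symbolDensity μ h ((2 * Real.pi)⁻¹ • ζ)
  rw [smul_inv_smul₀ Real.two_pi_pos.ne', SchwartzMap.fourierInv_coe,
    Real.fourierInv_eq'] at h1
  rw [← h1]
  refine integral_congr_ae (Eventually.of_forall fun y ↦ ?_)
  simp only [smul_eq_mul, real_inner_smul_right]
  congr 3
  field_simp

theorem exists_profileBound_symbolDensity (d : ℕ) {κ : ℝ} (hκ : 1 ≤ κ) :
    ∃ A : ℝ, ∀ (μ : Measure (Metric.sphere (0 : EuclideanSpace ℝ (Fin d)) 1))
      [IsFiniteMeasure μ] (h : SpectralNondegenerate κ μ) (j : Fin d),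
        ProfileBound (∂_{(EuclideanSpace.single j (1 : ℝ))} (symbolDensity μ h) :
          𝓢(EuclideanSpace ℝ (Fin d), ℂ)) A := by
  obtain ⟨k₀, c, hc, hprof⟩ := exists_profileBound_of_seminorm_le (EuclideanSpace ℝ (Fin d))
  -- Indexing by all admissible measures at once makes the resulting seminorm bounds uniform in `μ`.
  let ι := {μ : Measure (Metric.sphere (0 : EuclideanSpace ℝ (Fin d)) 1) //
    IsFiniteMeasure μ ∧ SpectralNondegenerate κ μ}
  let Φ : ι → 𝓢(EuclideanSpace ℝ (Fin d), ℂ) := fun i ↦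
    haveI := i.2.1
    symbolSchwartz i.1 i.2.2
  let T : Fin d → 𝓢(EuclideanSpace ℝ (Fin d), ℂ) →L[ℂ] 𝓢(EuclideanSpace ℝ (Fin d), ℂ) := fun j ↦
    (LineDeriv.lineDerivOpCLM ℂ 𝓢(EuclideanSpace ℝ (Fin d), ℂ) (EuclideanSpace.single j (1 : ℝ))).comp
      ((FourierTransform.fourierCLM ℂ 𝓢(EuclideanSpace ℝ (Fin d), ℂ)).comp
        (SchwartzMap.compCLMOfContinuousLinearEquiv ℂ (twoPiDilation d)))
  choose C₀ hC₀ using exists_pow_mul_norm_iteratedFDeriv_smoothSymbol_le d hκ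
  have hΦ : ∀ k n : ℕ, ∃ C, ∀ (i : ι) x, ‖x‖ ^ k * ‖iteratedFDeriv ℝ n (Φ i) x‖ ≤ C :=
    fun k n ↦ ⟨C₀ k n, fun i x ↦ haveI := i.2.1; hC₀ k n i.1 i.2.2 x⟩
  choose C₁ hC₁ using fun j k n ↦ exists_seminorm_map_le hΦ (T j) k n
  set S := ∑ j : Fin d, ∑ k ∈ Finset.range (k₀ + 1), ∑ n ∈ Finset.range 2, |C₁ j k n| with hS
  have hS0 : 0 ≤ S := by positivity
  set B := S + 2 * Real.pi * (|C₀ 0 0| + |C₀ 2 0|) with hB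
  have hπ := Real.pi_pos
  refine ⟨c * B, fun μ _ h j ↦ hprof _ B (by positivity) (fun k hk n hn ↦ ?_) fun η ↦ ?_⟩
  · have h1 : |C₁ j k n| ≤ S := by
      refine le_trans ?_ (Finset.single_le_sum (f := fun j ↦ ∑ k ∈ Finset.range (k₀ + 1),
        ∑ n ∈ Finset.range 2, |C₁ j k n|) (fun _ _ ↦ by positivity) (Finset.mem_univ j))
      refine le_trans ?_ (Finset.single_le_sum (f := fun k ↦ ∑ n ∈ Finset.range 2, |C₁ j k n|)
        (fun _ _ ↦ by positivity) (Finset.mem_range.2 (Nat.lt_succ_of_le hk)))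
      exact Finset.single_le_sum (f := fun n ↦ |C₁ j k n|)
        (fun _ _ ↦ by positivity) (Finset.mem_range.2 (Nat.lt_succ_of_le hn))
    have h2 := hC₁ j k n ⟨μ, ‹_›, h⟩
    have h3 : 0 ≤ 2 * Real.pi * (|C₀ 0 0| + |C₀ 2 0|) := by positivity
    exact (h2.trans (le_abs_self _)).trans (h1.trans (by linarith))
  · have h1 : 𝓕⁻ ((∂_{(EuclideanSpace.single j (1 : ℝ))} (symbolDensity μ h) :
          𝓢(EuclideanSpace ℝ (Fin d), ℂ)) : EuclideanSpace ℝ (Fin d) → ℂ) η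
        = -(2 * Real.pi * Complex.I) * ((⟪η, EuclideanSpace.single j (1 : ℝ)⟫ : ℝ) *
          smoothSymbol μ ((2 * Real.pi) • η)) := by
      rw [← SchwartzMap.fourierInv_coe, SchwartzMap.fourierInv_lineDerivOp_eq,
        smul_apply, SchwartzMap.smulLeftCLM_apply_apply (by fun_prop),
        fourierInv_symbolDensity]
      rfl
    have h2 := hC₀ 0 0 μ h ((2 * Real.pi) • η)
    have h3 := hC₀ 2 0 μ h ((2 * Real.pi) • η)
    rw [norm_iteratedFDeriv_zero] at h2 h3
    rw [pow_zero, one_mul] at h2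
    rw [norm_smul, Real.norm_of_nonneg Real.two_pi_pos.le] at h3
    set w := ‖smoothSymbol μ ((2 * Real.pi) • η)‖ with hw
    have hw0 : 0 ≤ w := norm_nonneg _
    -- The bounds of weights `0` and `2` add up to decay of order `1 / (1 + ‖η‖²)`. The numerator
    -- `‖η‖` of the required bound comes from the derivative in direction `j`.
    have h4 : w * (1 + ‖η‖ ^ 2) ≤ |C₀ 0 0| + |C₀ 2 0| := by
      have e1 : ‖η‖ ^ 2 ≤ (2 * Real.pi * ‖η‖) ^ 2 := by
        refine pow_le_pow_left₀ (norm_nonneg _) ?_ 2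
        nlinarith [norm_nonneg η, Real.pi_gt_three]
      have e2 := mul_le_mul_of_nonneg_right e1 hw0
      linarith [le_abs_self (C₀ 0 0), le_abs_self (C₀ 2 0)]
    have h5 : w ≤ (|C₀ 0 0| + |C₀ 2 0|) / (1 + ‖η‖ ^ 2) := by
      rwa [le_div_iff₀ (by positivity)]
    have h6 : |⟪η, EuclideanSpace.single j (1 : ℝ)⟫| ≤ ‖η‖ := by
      refine (abs_real_inner_le_norm _ _).trans_eq ?_
      simp
    rw [h1, norm_mul, norm_mul, ← hw, Complex.norm_real, Real.norm_eq_abs, norm_neg, norm_mul,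
      norm_mul, Complex.norm_I, Complex.norm_real, Complex.norm_ofNat, mul_one,
      Real.norm_of_nonneg hπ.le]
    calc 2 * Real.pi * (|⟪η, EuclideanSpace.single j (1 : ℝ)⟫| * w)
        ≤ 2 * Real.pi * (‖η‖ * ((|C₀ 0 0| + |C₀ 2 0|) / (1 + ‖η‖ ^ 2))) := by gcongr
      _ = (2 * Real.pi * (|C₀ 0 0| + |C₀ 2 0|)) * (‖η‖ / (1 + ‖η‖ ^ 2)) := by ring
      _ ≤ B * (‖η‖ / (1 + ‖η‖ ^ 2)) := by
          gcongr
          linarith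

end ProfileOfSymbol

/-! ### Identifying the kernel of the truncated gradient -/

section Identification

open scoped SchwartzMap FourierTransform LineDeriv

variable {E : Type*} [NormedAddCommGroup E] [InnerProductSpace ℝ E] [FiniteDimensional ℝ E]
  [MeasurableSpace E] [BorelSpace E]

/-- Fourier inversion under the integral sign. -/
theorem integral_mul_schwartz_comp {S : Type*} [MeasurableSpace S] {σ : Measure S} [SFinite σ]
    {u : S → ℂ} (hu : Integrable u σ) {φ : S → E} (hφ : Measurable φ) (h : 𝓢(E, ℂ)) :
    ∫ s, u s * h (φ s) ∂σ
      = ∫ ξ, (∫ s, u s * Complex.exp (⟪φ s, (2 * Real.pi) • ξ⟫ * Complex.I) ∂σ) * (𝓕 h) ξ := by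
  have hinv : ∀ w, h w = ∫ ξ, Complex.exp (⟪w, (2 * Real.pi) • ξ⟫ * Complex.I) * (𝓕 h) ξ := by
    intro w
    have h1 : (𝓕⁻ (𝓕 h)) w = h w := by rw [FourierTransform.fourierInv_fourier_eq]
    rw [← h1, SchwartzMap.fourierInv_coe, Real.fourierInv_eq']
    refine integral_congr_ae (Eventually.of_forall fun ξ ↦ ?_)
    simp only [smul_eq_mul, real_inner_smul_right, real_inner_comm]
  have hint : Integrable (fun z : S × E ↦ (u z.1 * (𝓕 h) z.2)
      * Complex.exp (⟪φ z.1, (2 * Real.pi) • z.2⟫ * Complex.I)) (σ.prod volume) := by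
    refine (hu.mul_prod (𝓕 h).integrable).mul_bdd (c := 1)
      (Measurable.aestronglyMeasurable (by fun_prop)) (Eventually.of_forall fun z ↦ ?_)
    exact (Complex.norm_exp_ofReal_mul_I _).le
  calc ∫ s, u s * h (φ s) ∂σ
      = ∫ s, (∫ ξ, (u s * (𝓕 h) ξ)
        * Complex.exp (⟪φ s, (2 * Real.pi) • ξ⟫ * Complex.I)) ∂σ := by
        refine integral_congr_ae (Eventually.of_forall fun s ↦ ?_)
        simp only
        rw [hinv, ← integral_const_mul]
        exact integral_congr_ae (Eventually.of_forall fun ξ ↦ by simp only; ring)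
    _ = ∫ ξ, (∫ s, (u s * (𝓕 h) ξ)
        * Complex.exp (⟪φ s, (2 * Real.pi) • ξ⟫ * Complex.I) ∂σ) :=
        integral_integral_swap hint
    _ = _ := by
        refine integral_congr_ae (Eventually.of_forall fun ξ ↦ ?_)
        simp only
        rw [← integral_mul_const]
        exact integral_congr_ae (Eventually.of_forall fun s ↦ by simp only; ring)

variable {L m : Measure E} [IsProbabilityMeasure L] [IsProbabilityMeasure m] {q : 𝓢(E, ℂ)}

/-- A law whose characteristic function factors is a convolution. -/
theorem integral_schwartz_eq_of_charFun_eq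
    (hL : ∀ ζ, charFun L ζ = charFun m ζ * ∫ y, Complex.exp (⟪y, ζ⟫ * Complex.I) * q y)
    (h : 𝓢(E, ℂ)) :
    ∫ w, h w ∂L = ∫ z, (∫ y, h (y + z) * q y) ∂m := by
  have hq : Integrable (fun s : E × E ↦ (1 : ℂ) * q s.2) (m.prod volume) :=
    (integrable_const (1 : ℂ)).mul_prod q.integrable
  have hqh : Integrable (fun s : E × E ↦ (1 * q s.2) * h (s.2 + s.1)) (m.prod volume) := by
    obtain ⟨C, hC⟩ := h.decay 0 0
    refine hq.mul_bdd (c := C) (Measurable.aestronglyMeasurable (by fun_prop))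
      (Eventually.of_forall fun z ↦ ?_)
    simpa using hC.2 (z.2 + z.1)
  have h1 := integral_mul_schwartz_comp (integrable_const (1 : ℂ) (μ := L)) measurable_id h
  have h2 := integral_mul_schwartz_comp hq
    (by fun_prop : Measurable fun s : E × E ↦ s.2 + s.1) h
  rw [integral_prod _ hqh] at h2
  simp only [one_mul, id] at h1 h2
  rw [h1]
  -- By Fourier inversion each side is `𝓕 h` integrated against a characteristic function at `2π ξ`,
  -- and these agree by the factorization `hL`.
  refine Eq.trans ?_ (h2.symm.trans ?_)
  · refine integral_congr_ae (Eventually.of_forall fun ξ ↦ ?_)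
    simp only
    rw [← charFun_apply, hL]
    congr 1
    have h3 : ∀ s : E × E, q s.2 * Complex.exp (⟪s.2 + s.1, (2 * Real.pi) • ξ⟫ * Complex.I)
        = Complex.exp (⟪s.1, (2 * Real.pi) • ξ⟫ * Complex.I) *
          (Complex.exp (⟪s.2, (2 * Real.pi) • ξ⟫ * Complex.I) * q s.2) := by
      intro s
      rw [inner_add_left, Complex.ofReal_add, add_mul, Complex.exp_add]
      ring
    simp_rw [h3]
    rw [integral_prod_mul (fun z ↦ Complex.exp (⟪z, (2 * Real.pi) • ξ⟫ * Complex.I))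
      (fun y ↦ Complex.exp (⟪y, (2 * Real.pi) • ξ⟫ * Complex.I) * q y), charFun_apply]
  · simp_rw [mul_comm (q _)]

/-- Integration by parts is done in the Schwartz factor alone, for each fixed `z`; the law `m` needs
no regularity. -/
theorem integral_fderiv_eq_of_charFun_eq
    (hL : ∀ ζ, charFun L ζ = charFun m ζ * ∫ y, Complex.exp (⟪y, ζ⟫ * Complex.I) * q y)
    {F : E → ℂ} (hF : ContDiff ℝ (⊤ : ℕ∞) F) (hFc : HasCompactSupport F) (v : E) :
    ∫ w, fderiv ℝ F w v ∂L
      = -∫ z, (∫ y, F (y + z) * (∂_{v} q : 𝓢(E, ℂ)) y) ∂m := by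
  have h1 := integral_schwartz_eq_of_charFun_eq hL (∂_{v} (hFc.toSchwartzMap hF))
  simp only [SchwartzMap.lineDerivOp_apply_eq_fderiv] at h1
  rw [← integral_neg]
  refine h1.trans (integral_congr_ae (Eventually.of_forall fun z ↦ ?_))
  have hFz : ContDiff ℝ (⊤ : ℕ∞) fun y ↦ F (y + z) := hF.comp (contDiff_id.add contDiff_const)
  have hFzc : HasCompactSupport fun y ↦ F (y + z) :=
    hFc.comp_homeomorph (Homeomorph.addRight z)
  have h2 := SchwartzMap.integral_mul_lineDerivOp_right_eq_neg_left (μ := volume)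
    (hFzc.toSchwartzMap hFz) q v
  simp only [SchwartzMap.lineDerivOp_apply_eq_fderiv] at h2 ⊢
  have h3 : ∀ y, fderiv ℝ (hFzc.toSchwartzMap hFz) y v = fderiv ℝ F (y + z) v := fun y ↦ by
    have : (⇑(hFzc.toSchwartzMap hFz) : E → ℂ) = fun y ↦ F (y + z) := rfl
    rw [this, fderiv_comp_add_right]
  simp_rw [h3] at h2
  exact (neg_eq_iff_eq_neg.2 h2).symm

/-- The dilated kernel represents the truncated resolvent gradient. -/
theorem kernelConv_dilatedKernel {A lam ε N : ℝ} {v : E}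
    (hg : ProfileBound (∂_{v} q : 𝓢(E, ℂ)) A) (hlam : 0 ≤ lam) (hε : 0 < ε)
    (hL : ∀ ζ, charFun L ζ = charFun m ζ * ∫ y, Complex.exp (⟪y, ζ⟫ * Complex.I) * q y)
    {f : E → ℂ} (hf : ContDiff ℝ (⊤ : ℕ∞) f) (hfc : HasCompactSupport f) (x : E) :
    kernelConv (dilatedKernel (∂_{v} q : 𝓢(E, ℂ)) m lam ε N) f x
      = ∫ t in Set.Ioo ε N, (Real.exp (-lam * t) : ℂ) * ∫ w, fderiv ℝ f (x + t • w) v ∂L := by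
  obtain ⟨M, hM⟩ := hfc.exists_bound_of_continuous hf.continuous
  set g : E → ℂ := ⇑(∂_{v} q : 𝓢(E, ℂ)) with hgdef
  have hgm : Measurable g := hg.continuous.measurable
  have hfm : Measurable f := hf.continuous.measurable
  have hM0 : 0 ≤ M := (norm_nonneg _).trans (hM 0)
  have h1 : kernelConv (dilatedKernel g m lam ε N) f x
      = ∫ v, f (x - v) * dilatedKernel g m lam ε N v := by
    rw [kernelConv, ← integral_sub_left_eq_self _ volume x]
    simp
  rw [h1, integral_mul_dilatedKernel hg hlam hε (φ := fun v ↦ f (x - v)) (by fun_prop)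
    (fun y ↦ hM _)]
  have hmeas : Measurable fun s : ℝ × E ↦ ((Real.exp (-lam * s.1) * s.1⁻¹ : ℝ) : ℂ)
      * ∫ y, f (x - -(s.1 • (y + s.2))) * g y := by
    refine Measurable.mul (by fun_prop) ?_
    refine (StronglyMeasurable.integral_prod_right (ν := volume)
      (f := fun (s : ℝ × E) (y : E) ↦ f (x - -(s.1 • (y + s.2))) * g y) ?_).measurable
    exact (Measurable.stronglyMeasurable (by fun_prop))
  have hbound : ∀ s : ℝ × E, ‖∫ y, f (x - -(s.1 • (y + s.2))) * g y‖ ≤ M * ∫ y, ‖g y‖ := by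
    intro s
    rw [← integral_const_mul]
    refine norm_integral_le_of_norm_le (hg.integrable.norm.const_mul M)
      (Eventually.of_forall fun y ↦ ?_)
    rw [norm_mul]
    gcongr
    exact hM _
  have hae : ∀ᵐ s : ℝ × E ∂((volume.restrict (Set.Ioo ε N)).prod m), s.1 ∈ Set.Ioo ε N :=
    (Measure.quasiMeasurePreserving_fst (μ := volume.restrict (Set.Ioo ε N)) (ν := m)).ae
      (ae_restrict_mem measurableSet_Ioo)
  have hint : Integrable (fun s : ℝ × E ↦ ((Real.exp (-lam * s.1) * s.1⁻¹ : ℝ) : ℂ)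
      * ∫ y, f (x - -(s.1 • (y + s.2))) * g y) ((volume.restrict (Set.Ioo ε N)).prod m) := by
    refine (integrable_const (ε⁻¹ * (M * ∫ y, ‖g y‖))).mono' hmeas.aestronglyMeasurable ?_
    filter_upwards [hae] with s hs
    have hs0 : 0 < s.1 := hε.trans hs.1
    rw [norm_mul, Complex.norm_real, Real.norm_of_nonneg (by positivity)]
    refine mul_le_mul ?_ (hbound s) (norm_nonneg _) (by positivity)
    have e1 : Real.exp (-lam * s.1) ≤ 1 := Real.exp_le_one_iff.2 (by nlinarith)
    have e2 : s.1⁻¹ ≤ ε⁻¹ := inv_anti₀ hε hs.1.le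
    calc _ ≤ 1 * ε⁻¹ := by gcongr
      _ = _ := one_mul _
  rw [integral_prod _ hint, ← integral_neg]
  refine setIntegral_congr_fun measurableSet_Ioo fun t ht ↦ ?_
  have ht0 : t ≠ 0 := (hε.trans ht.1).ne'
  -- The integration by parts is applied to `w ↦ f (x + t • w)`, whose derivative carries a factor
  -- `t`; it cancels the `t⁻¹` of the dilated kernel.
  have hFt : ContDiff ℝ (⊤ : ℕ∞) fun w ↦ f (x + t • w) :=
    hf.comp (contDiff_const.add (contDiff_const.smul contDiff_id))
  have hFtc : HasCompactSupport fun w ↦ f (x + t • w) :=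
    hfc.comp_homeomorph ((Homeomorph.smulOfNeZero t ht0).trans (Homeomorph.addLeft x))
  have h2 := integral_fderiv_eq_of_charFun_eq hL hFt hFtc v
  have h3 : ∀ w, fderiv ℝ (fun w ↦ f (x + t • w)) w v = (t : ℂ) * fderiv ℝ f (x + t • w) v := by
    intro w
    have e1 : HasFDerivAt (fun w : E ↦ x + t • w) (t • ContinuousLinearMap.id ℝ E) w :=
      ((hasFDerivAt_id w).const_smul t).const_add x
    have e2 := ((hf.differentiable (by simp)).differentiableAt
      (x := x + t • w)).hasFDerivAt.comp w e1
    have e3 := e2.fderiv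
    simp only [Function.comp_def] at e3
    rw [e3]
    simp
  simp_rw [h3] at h2
  rw [integral_const_mul] at h2
  simp only [integral_const_mul, sub_neg_eq_add]
  have h4 : ∫ z, (∫ y, f (x + t • (y + z)) * g y) ∂m
      = -((t : ℂ) * ∫ w, fderiv ℝ f (x + t • w) v ∂L) := by
    rw [h2, neg_neg]
  rw [h4]
  have htc : (t : ℂ) ≠ 0 := by exact_mod_cast ht0
  push_cast
  field_simp

end Identification

/-! ### Marginal laws of the process -/

section ProcessLaw

variable {d : ℕ} {μ : Measure (Metric.sphere (0 : EuclideanSpace ℝ (Fin d)) 1)}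
  {Ω : Type*} [MeasurableSpace Ω] {P : Measure Ω}
  {Z : ℝ≥0 → Ω → EuclideanSpace ℝ (Fin d)}

theorem IsSymmetricOneStableProcess.charFun_map (hZ : IsSymmetricOneStableProcess μ P Z)
    (b : EuclideanSpace ℝ (Fin d)) (t : ℝ≥0) (ζ : EuclideanSpace ℝ (Fin d)) :
    charFun (P.map fun ω ↦ Z t ω + b) ζ
      = ((Real.exp (-(t : ℝ) * spectralExponent μ ζ) : ℝ) : ℂ)
        * Complex.exp (⟪b, ζ⟫ * Complex.I) := by
  have h1 : P.map (fun ω ↦ Z t ω - Z 0 ω) = P.map (Z t) := by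
    refine Measure.map_congr ?_
    filter_upwards [hZ.zero] with ω hω
    rw [hω, sub_zero]
  have h2 := hZ.charFun_increment 0 t zero_le ζ
  rw [h1, NNReal.coe_zero, sub_zero] at h2
  have h3 : P.map (fun ω ↦ Z t ω + b) = (P.map (Z t)).map fun x ↦ x + b := by
    rw [Measure.map_map (by fun_prop) (hZ.measurable t)]
    rfl
  rw [h3, charFun_map_add_const, h2, real_inner_comm]

/-- The marginal laws of the drifted process are the dilates of the law at time `1`. -/
theorem IsSymmetricOneStableProcess.map_add_smul [IsProbabilityMeasure P]
    (hZ : IsSymmetricOneStableProcess μ P Z)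
    (b : EuclideanSpace ℝ (Fin d)) (t : ℝ≥0) :
    P.map (fun ω ↦ Z t ω + (t : ℝ) • b)
      = (P.map fun ω ↦ Z 1 ω + b).map fun w ↦ (t : ℝ) • w := by
  have hm1 := hZ.measurable 1
  have hmt := hZ.measurable t
  have : IsProbabilityMeasure (P.map fun ω ↦ Z 1 ω + b) :=
    Measure.isProbabilityMeasure_map (by fun_prop)
  have : IsProbabilityMeasure (P.map fun ω ↦ Z t ω + (t : ℝ) • b) :=
    Measure.isProbabilityMeasure_map (by fun_prop)
  have : IsProbabilityMeasure ((P.map fun ω ↦ Z 1 ω + b).map fun w ↦ (t : ℝ) • w) :=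
    Measure.isProbabilityMeasure_map (by fun_prop)
  -- Order one is essential here: the exponent is homogeneous of degree one, so the stable part and
  -- the drift scale at the same rate.
  refine Measure.ext_of_charFun (funext fun ζ ↦ ?_)
  rw [charFun_map_smul, hZ.charFun_map, hZ.charFun_map, spectralExponent_smul, NNReal.coe_one,
    abs_of_nonneg t.coe_nonneg, real_inner_smul_left, real_inner_smul_right]
  congr 3
  ring

theorem IsSymmetricOneStableProcess.integral_frozenProcess [IsProbabilityMeasure P]
    (hZ : IsSymmetricOneStableProcess μ P Z) (b x : EuclideanSpace ℝ (Fin d)) (t : ℝ≥0)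
    {f : EuclideanSpace ℝ (Fin d) → ℝ} (hf : Continuous f) :
    ∫ ω, f (frozenProcess b Z x t ω) ∂P
      = ∫ w, f (x + (t : ℝ) • w) ∂(P.map fun ω ↦ Z 1 ω + b) := by
  have hm1 := hZ.measurable 1
  have hmt := hZ.measurable t
  have h1 : ∫ w, f (x + (t : ℝ) • w) ∂(P.map fun ω ↦ Z 1 ω + b)
      = ∫ v, f (x + v) ∂((P.map fun ω ↦ Z 1 ω + b).map fun w ↦ (t : ℝ) • w) := by
    exact (integral_map (φ := fun w ↦ (t : ℝ) • w) (f := fun v ↦ f (x + v)) (by fun_prop)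
      (Continuous.aestronglyMeasurable (by fun_prop))).symm
  rw [h1, ← hZ.map_add_smul, integral_map (Measurable.aemeasurable (by fun_prop))
    (Continuous.aestronglyMeasurable (by fun_prop))]
  refine integral_congr_ae (Eventually.of_forall fun ω ↦ ?_)
  simp only [frozenProcess]
  congr 1
  abel

end ProcessLaw

/-! ### Differentiating the resolvent -/

section Resolvent

variable {E : Type*} [NormedAddCommGroup E] [InnerProductSpace ℝ E] [FiniteDimensional ℝ E]
  [MeasurableSpace E] [BorelSpace E] (L : Measure E) [IsProbabilityMeasure L]

theorem integrable_exp_mul_comp {F : Type*} [NormedAddCommGroup F] [NormedSpace ℝ F]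
    [SecondCountableTopology F] {lam : ℝ} (hlam : 0 < lam) {g : E → F} (hg : Continuous g) {M : ℝ}
    (hM : ∀ x, ‖g x‖ ≤ M) (x : E) :
    Integrable (fun s : ℝ × E ↦ Real.exp (-lam * s.1) • g (x + s.1 • s.2))
      ((volume.restrict (Set.Ioi (0 : ℝ))).prod L) := by
  have h1 : Integrable (fun t : ℝ ↦ Real.exp (-lam * t)) (volume.restrict (Set.Ioi (0 : ℝ))) :=
    exp_neg_integrableOn_Ioi 0 hlam
  have h2 : Integrable (fun s : ℝ × E ↦ Real.exp (-lam * s.1) * M)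
      ((volume.restrict (Set.Ioi (0 : ℝ))).prod L) := h1.mul_prod (integrable_const M)
  refine h2.mono' (Continuous.aestronglyMeasurable (by fun_prop))
    (Eventually.of_forall fun s ↦ ?_)
  rw [norm_smul, Real.norm_of_nonneg (Real.exp_pos _).le]
  exact mul_le_mul_of_nonneg_left (hM _) (Real.exp_pos _).le

/-- The resolvent of the process with marginals `t • w`, `w` distributed as `L`. -/
noncomputable def dilationResolvent (lam : ℝ) (f : E → ℝ) (x : E) : ℝ :=
  ∫ t in Set.Ioi (0 : ℝ), Real.exp (-lam * t) * ∫ w, f (x + t • w) ∂L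

variable {L}

/-- Differentiation under the integral: `fderiv ℝ f` is bounded, `L` is a probability and `exp (-lam
* t)` is integrable on the half-line since `lam > 0`. No regularity of `L` is involved. -/
theorem hasFDerivAt_dilationResolvent {lam : ℝ} (hlam : 0 < lam) {f : E → ℝ}
    (hf : ContDiff ℝ (⊤ : ℕ∞) f) (hfc : HasCompactSupport f) (x : E) :
    HasFDerivAt (dilationResolvent L lam f)
      (∫ s : ℝ × E, Real.exp (-lam * s.1) • fderiv ℝ f (x + s.1 • s.2)
        ∂((volume.restrict (Set.Ioi (0 : ℝ))).prod L)) x := by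
  have hfd : Continuous (fderiv ℝ f) := hf.continuous_fderiv (by simp)
  obtain ⟨M, hM⟩ := hfc.exists_bound_of_continuous hf.continuous
  obtain ⟨M', hM'⟩ := (hfc.fderiv ℝ).exists_bound_of_continuous hfd
  have hR : dilationResolvent L lam f = fun x ↦
      ∫ s : ℝ × E, Real.exp (-lam * s.1) • f (x + s.1 • s.2)
        ∂((volume.restrict (Set.Ioi (0 : ℝ))).prod L) := by
    ext x
    rw [dilationResolvent, integral_prod _ (integrable_exp_mul_comp L hlam hf.continuous hM x)]
    simp only [integral_const_mul, smul_eq_mul]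
  rw [hR]
  have h1 : Integrable (fun t : ℝ ↦ Real.exp (-lam * t)) (volume.restrict (Set.Ioi (0 : ℝ))) :=
    exp_neg_integrableOn_Ioi 0 hlam
  refine hasFDerivAt_integral_of_dominated_of_fderiv_le
    (bound := fun s : ℝ × E ↦ Real.exp (-lam * s.1) * M')
    (F' := fun x s ↦ Real.exp (-lam * s.1) • fderiv ℝ f (x + s.1 • s.2)) Filter.univ_mem
    (Eventually.of_forall fun y ↦ (integrable_exp_mul_comp L hlam hf.continuous hM y).1)
    (integrable_exp_mul_comp L hlam hf.continuous hM x)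
    (integrable_exp_mul_comp L hlam hfd hM' x).1
    (Eventually.of_forall fun s y _ ↦ ?_) (h1.mul_prod (integrable_const M'))
    (Eventually.of_forall fun s y _ ↦ ?_)
  · rw [norm_smul, Real.norm_of_nonneg (Real.exp_pos _).le]
    exact mul_le_mul_of_nonneg_left (hM' _) (Real.exp_pos _).le
  · have e1 : HasFDerivAt (fun y : E ↦ f (y + s.1 • s.2)) (fderiv ℝ f (y + s.1 • s.2)) y := by
      rw [hasFDerivAt_comp_add_right]
      exact (hf.differentiable (by simp)).differentiableAt.hasFDerivAt
    exact e1.const_smul (Real.exp (-lam * s.1))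

theorem fderiv_dilationResolvent_apply {lam : ℝ} (hlam : 0 < lam) {f : E → ℝ}
    (hf : ContDiff ℝ (⊤ : ℕ∞) f) (hfc : HasCompactSupport f) (x v : E) :
    IntegrableOn (fun t : ℝ ↦ Real.exp (-lam * t) * ∫ w, fderiv ℝ f (x + t • w) v ∂L)
      (Set.Ioi 0) ∧
    fderiv ℝ (dilationResolvent L lam f) x v
      = ∫ t in Set.Ioi (0 : ℝ), Real.exp (-lam * t) * ∫ w, fderiv ℝ f (x + t • w) v ∂L := by
  have hfd : Continuous (fderiv ℝ f) := hf.continuous_fderiv (by simp)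
  obtain ⟨M', hM'⟩ := (hfc.fderiv ℝ).exists_bound_of_continuous hfd
  have hi := integrable_exp_mul_comp L hlam hfd hM' x
  have hiv : Integrable (fun s : ℝ × E ↦ Real.exp (-lam * s.1) * fderiv ℝ f (x + s.1 • s.2) v)
      ((volume.restrict (Set.Ioi (0 : ℝ))).prod L) := hi.apply_continuousLinearMap v
  constructor
  · have := hiv.integral_prod_left
    simp only [integral_const_mul] at this
    exact this
  · rw [(hasFDerivAt_dilationResolvent hlam hf hfc x).fderiv,
      ContinuousLinearMap.integral_apply hi]
    simp only [smul_apply, smul_eq_mul]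
    rw [integral_prod _ hiv]
    simp only [integral_const_mul]

end Resolvent

/-! ### Removing the truncation -/

section ResolventBound

open scoped SchwartzMap FourierTransform LineDeriv

variable {E : Type*} [NormedAddCommGroup E] [InnerProductSpace ℝ E] [FiniteDimensional ℝ E]
  [MeasurableSpace E] [BorelSpace E] {L m : Measure E} [IsProbabilityMeasure L]
  [IsProbabilityMeasure m] {q : 𝓢(E, ℂ)}

/-- The windows `(1 / (n + 1), n)` increase to the half-line, over which the gradient integrand is
absolutely integrable, so the truncated gradients converge at every point. -/
theorem tendsto_kernelConv_dilatedKernel {A lam : ℝ} {v : E}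
    (hg : ProfileBound (∂_{v} q : 𝓢(E, ℂ)) A) (hlam : 0 < lam)
    (hL : ∀ ζ, charFun L ζ = charFun m ζ * ∫ y, Complex.exp (⟪y, ζ⟫ * Complex.I) * q y)
    {f : E → ℝ} (hf : ContDiff ℝ (⊤ : ℕ∞) f) (hfc : HasCompactSupport f) (x : E) :
    Tendsto (fun n : ℕ ↦ kernelConv (dilatedKernel (∂_{v} q : 𝓢(E, ℂ)) m lam
        (1 / ((n : ℝ) + 1)) n) (fun y ↦ (f y : ℂ)) x)
      atTop (𝓝 (fderiv ℝ (dilationResolvent L lam f) x v : ℂ)) := by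
  have hfC : ContDiff ℝ (⊤ : ℕ∞) fun y ↦ (f y : ℂ) := Complex.ofRealCLM.contDiff.comp hf
  have hfCc : HasCompactSupport fun y ↦ (f y : ℂ) := hfc.comp_left Complex.ofReal_zero
  have hder : ∀ y, fderiv ℝ (fun y ↦ (f y : ℂ)) y v = (fderiv ℝ f y v : ℂ) := by
    intro y
    have h1 := Complex.ofRealCLM.hasFDerivAt.comp y
      ((hf.differentiable (by simp)).differentiableAt (x := y)).hasFDerivAt
    have h2 := h1.fderiv
    simp only [Function.comp_def, Complex.ofRealCLM_apply] at h2
    rw [h2]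
    simp
  have hk : ∀ n : ℕ, kernelConv (dilatedKernel (∂_{v} q : 𝓢(E, ℂ)) m lam
        (1 / ((n : ℝ) + 1)) n) (fun y ↦ (f y : ℂ)) x
      = ((∫ t in Set.Ioo (1 / ((n : ℝ) + 1)) (n : ℝ),
        Real.exp (-lam * t) * ∫ w, fderiv ℝ f (x + t • w) v ∂L : ℝ) : ℂ) := by
    intro n
    rw [kernelConv_dilatedKernel hg hlam.le (by positivity) hL hfC hfCc x,
      ← integral_complex_ofReal]
    refine integral_congr_ae (Eventually.of_forall fun t ↦ ?_)
    simp only [hder]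
    rw [integral_complex_ofReal, ← Complex.ofReal_mul]
  simp_rw [hk]
  refine (Complex.continuous_ofReal.tendsto _).comp ?_
  obtain ⟨hint, heq⟩ := fderiv_dilationResolvent_apply (L := L) hlam hf hfc x v
  have hU : ⋃ n : ℕ, Set.Ioo (1 / ((n : ℝ) + 1)) (n : ℝ) = Set.Ioi 0 := by
    ext t
    simp only [Set.mem_iUnion, Set.mem_Ioo, Set.mem_Ioi]
    constructor
    · rintro ⟨n, hn, -⟩
      exact lt_trans (by positivity) hn
    · intro ht
      obtain ⟨n, hn⟩ := exists_nat_one_div_lt ht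
      obtain ⟨k, hk⟩ := exists_nat_gt t
      refine ⟨max n k, lt_of_le_of_lt ?_ hn, hk.trans_le (by exact_mod_cast le_max_right n k)⟩
      refine one_div_le_one_div_of_le (by positivity) ?_
      gcongr
      exact le_max_left n k
  rw [heq, ← hU]
  refine tendsto_setIntegral_of_monotone (fun n ↦ measurableSet_Ioo) (fun a b hab ↦ ?_)
    (by rwa [hU])
  refine Set.Ioo_subset_Ioo ?_ (by exact_mod_cast hab)
  refine one_div_le_one_div_of_le (by positivity) ?_
  gcongr

/-- By Fatou's lemma the uniform bound for the truncated operators passes to their pointwise limit;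
no limiting singular kernel has to be constructed. -/
theorem lintegral_fderiv_dilationResolvent_rpow_le {A A' lam p : ℝ} {C : ℝ≥0∞} {v : E}
    (hC : ∀ K : E → ℂ, Measurable K → Integrable K →
      HormanderBound K (ENNReal.ofReal (5 * A + 4 * A * A')) → (∀ ξ, ‖𝓕 K ξ‖ ≤ A * Real.pi) →
      ∀ f : E → ℂ, Measurable f → Integrable f → (∃ M, ∀ x, ‖f x‖ ≤ M) →
      ∫⁻ x, ‖kernelConv K f x‖ₑ ^ p ≤ C * ∫⁻ x, ‖f x‖ₑ ^ p)
    (hg : ProfileBound (∂_{v} q : 𝓢(E, ℂ)) A) (hm : TailBound m A') (hA' : 0 ≤ A')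
    (hlam : 0 < lam)
    (hL : ∀ ζ, charFun L ζ = charFun m ζ * ∫ y, Complex.exp (⟪y, ζ⟫ * Complex.I) * q y)
    {f : E → ℝ} (hf : ContDiff ℝ (⊤ : ℕ∞) f) (hfc : HasCompactSupport f) :
    ∫⁻ x, ‖fderiv ℝ (dilationResolvent L lam f) x v‖ₑ ^ p ≤ C * ∫⁻ x, ‖f x‖ₑ ^ p := by
  have hfC : Continuous fun y ↦ (f y : ℂ) := Complex.continuous_ofReal.comp hf.continuous
  have hfCc : HasCompactSupport fun y ↦ (f y : ℂ) := hfc.comp_left Complex.ofReal_zero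
  set u : ℕ → E → ℂ := fun n ↦ kernelConv (dilatedKernel (∂_{v} q : 𝓢(E, ℂ)) m lam
    (1 / ((n : ℝ) + 1)) n) (fun y ↦ (f y : ℂ)) with hu
  have hpos : ∀ n : ℕ, 0 < 1 / ((n : ℝ) + 1) := fun n ↦ by positivity
  have hum : ∀ n, Measurable (u n) := fun n ↦
    measurable_kernelConv (measurable_dilatedKernel hg.continuous) hfC.measurable
  have hbound : ∀ n, ∫⁻ x, ‖u n x‖ₑ ^ p ≤ C * ∫⁻ x, ‖f x‖ₑ ^ p := by
    intro n
    refine (hC _ (measurable_dilatedKernel hg.continuous)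
      (integrable_dilatedKernel hg hlam.le (hpos n))
      (hormanderBound_dilatedKernel hg hm hA' hlam.le (hpos n))
      (norm_fourier_dilatedKernel_le hg hlam.le (hpos n)) _ hfC.measurable
      (hfC.integrable_of_hasCompactSupport hfCc)
      (hfCc.exists_bound_of_continuous hfC)).trans_eq ?_
    simp only [enorm_ofReal_complex]
  calc ∫⁻ x, ‖fderiv ℝ (dilationResolvent L lam f) x v‖ₑ ^ p
      = ∫⁻ x, liminf (fun n ↦ ‖u n x‖ₑ ^ p) atTop := by
        refine lintegral_congr fun x ↦ ?_
        have h1 := tendsto_kernelConv_dilatedKernel hg hlam hL hf hfc x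
        have h2 := (ENNReal.continuous_rpow_const (y := p)).continuousAt.tendsto.comp h1.enorm
        rw [enorm_ofReal_complex] at h2
        exact h2.liminf_eq.symm
    _ ≤ liminf (fun n ↦ ∫⁻ x, ‖u n x‖ₑ ^ p) atTop :=
        lintegral_liminf_le fun n ↦ (hum n).enorm.pow_const p
    _ ≤ C * ∫⁻ x, ‖f x‖ₑ ^ p :=
        liminf_le_of_le (by isBoundedDefault) fun b hb ↦ by
          obtain ⟨n, hn⟩ := hb.exists
          exact hn.trans (hbound n)

end ResolventBound

/-! ### Assembling the estimate -/

theorem norm_le_sum_norm_apply_single {d : ℕ} (T : EuclideanSpace ℝ (Fin d) →L[ℝ] ℝ) :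
    ‖T‖ ≤ ‖∑ j, ‖T (EuclideanSpace.single j (1 : ℝ))‖‖ := by
  rw [Real.norm_of_nonneg (Finset.sum_nonneg fun _ _ ↦ norm_nonneg _)]
  refine T.opNorm_le_bound (Finset.sum_nonneg fun _ _ ↦ norm_nonneg _) fun z ↦ ?_
  have hz : z = ∑ j, z j • EuclideanSpace.single j (1 : ℝ) := by
    have := (EuclideanSpace.basisFun (Fin d) ℝ).sum_repr z
    simpa using this.symm
  calc ‖T z‖ = ‖∑ j, z j • T (EuclideanSpace.single j (1 : ℝ))‖ := by
        conv_lhs => rw [hz]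
        simp only [map_sum, map_smul]
    _ ≤ ∑ j, ‖z j • T (EuclideanSpace.single j (1 : ℝ))‖ := norm_sum_le _ _
    _ ≤ ∑ j, ‖T (EuclideanSpace.single j (1 : ℝ))‖ * ‖z‖ := by
        refine Finset.sum_le_sum fun j _ ↦ ?_
        rw [norm_smul, mul_comm]
        gcongr
        exact PiLp.norm_apply_le z j
    _ = _ := by rw [Finset.sum_mul]

/-- The bound for the marginal resolvent, with a constant depending only on `p, κ, d` and the
size of the drift. -/
theorem exists_eLpNorm_fderiv_dilationResolvent_le (d : ℕ) (hd : 1 ≤ d) {p : ℝ≥0∞} (hp₁ : 1 < p)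
    (hp₂ : p < ⊤) {κ : ℝ} (hκ : 1 ≤ κ) (β : ℝ) :
    ∃ C : ℝ, 0 < C ∧
      ∀ (μ : Measure (Metric.sphere (0 : EuclideanSpace ℝ (Fin d)) 1)) [IsFiniteMeasure μ],
        SpectralNondegenerate κ μ →
      ∀ b₀ : EuclideanSpace ℝ (Fin d), ‖b₀‖ = β →
      ∀ (L : Measure (EuclideanSpace ℝ (Fin d))) [IsProbabilityMeasure L],
        (∀ ζ, charFun L ζ = ((Real.exp (-spectralExponent μ ζ) : ℝ) : ℂ)
          * Complex.exp (⟪b₀, ζ⟫ * Complex.I)) →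
      ∀ lam : ℝ, 0 < lam →
      ∀ f : EuclideanSpace ℝ (Fin d) → ℝ, ContDiff ℝ (⊤ : ℕ∞) f → HasCompactSupport f →
        eLpNorm (fderiv ℝ (dilationResolvent L lam f)) p volume
          ≤ ENNReal.ofReal C * eLpNorm f p volume := by
  have : Nonempty (Fin d) := ⟨⟨0, hd⟩⟩
  have hp0 : p ≠ 0 := (zero_lt_one.trans hp₁).ne'
  have hpr : 1 < p.toReal := by
    rw [← ENNReal.toReal_one]
    exact (ENNReal.toReal_lt_toReal ENNReal.one_ne_top hp₂.ne).2 hp₁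
  have hpr0 : 0 < p.toReal := zero_lt_one.trans hpr
  obtain ⟨A, hA⟩ := exists_profileBound_symbolDensity d hκ
  set A' := 8 * (d : ℝ) ^ 2 * (2 * κ + β) with hA'
  obtain ⟨C, hCtop, hC⟩ := exists_lintegral_kernelConv_rpow_le (E := EuclideanSpace ℝ (Fin d))
    (5 * A + 4 * A * A') (A * Real.pi) hpr
  have hC' : C ^ (1 / p.toReal) ≠ ∞ := ENNReal.rpow_ne_top_of_nonneg (by positivity) hCtop
  -- The factor `d` sums the partial derivatives; the added `1` only guarantees a positive constant.
  refine ⟨d * (C ^ (1 / p.toReal)).toReal + 1, by positivity,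
    fun μ _ h b₀ hb L _ hL lam hlam f hf hfc ↦ ?_⟩
  obtain ⟨m, hm, hchar, htail⟩ := exists_compensating_law (μ := μ) (fun ζ ↦ (h.2 ζ).2) b₀
  rw [hb] at htail
  -- The mollified exponents of the two factors cancel, leaving `exp (-ψ)` together with the drift
  -- phase carried by `m`.
  have hLm : ∀ ζ, charFun L ζ = charFun m ζ
      * ∫ y, Complex.exp (⟪y, ζ⟫ * Complex.I) * symbolDensity μ h y := by
    intro ζ
    rw [hL, hchar, integral_exp_mul_symbolDensity, smoothSymbol, mul_right_comm,
      ← Complex.ofReal_mul, ← Real.exp_add]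
    congr 4
    ring
  -- The sign of `β` is known only now that some `b₀` has norm `β`.
  have hA'0 : 0 ≤ A' := by
    have : 0 ≤ β := hb ▸ norm_nonneg b₀
    positivity
  have hdir : ∀ j : Fin d, eLpNorm (fun x ↦ ‖fderiv ℝ (dilationResolvent L lam f) x
      (EuclideanSpace.single j (1 : ℝ))‖) p volume ≤ C ^ (1 / p.toReal) * eLpNorm f p volume := by
    intro j
    rw [eLpNorm_norm, eLpNorm_eq_lintegral_rpow_enorm_toReal hp0 hp₂.ne,
      eLpNorm_eq_lintegral_rpow_enorm_toReal hp0 hp₂.ne,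
      ← ENNReal.mul_rpow_of_nonneg _ _ (by positivity)]
    exact ENNReal.rpow_le_rpow (lintegral_fderiv_dilationResolvent_rpow_le hC (hA μ h j)
      htail hA'0 hlam hLm hf hfc) (by positivity)
  calc eLpNorm (fderiv ℝ (dilationResolvent L lam f)) p volume
      ≤ eLpNorm (∑ j : Fin d, fun x ↦ ‖fderiv ℝ (dilationResolvent L lam f) x
          (EuclideanSpace.single j (1 : ℝ))‖) p volume := by
        refine eLpNorm_mono fun x ↦ ?_
        rw [Finset.sum_apply]
        exact norm_le_sum_norm_apply_single _
    _ ≤ ∑ j : Fin d, eLpNorm (fun x ↦ ‖fderiv ℝ (dilationResolvent L lam f) x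
          (EuclideanSpace.single j (1 : ℝ))‖) p volume :=
        eLpNorm_sum_le (fun j _ ↦
          (measurable_fderiv_apply_const ℝ _ _).norm.aestronglyMeasurable) hp₁.le
    _ ≤ ∑ j : Fin d, C ^ (1 / p.toReal) * eLpNorm f p volume :=
        Finset.sum_le_sum fun j _ ↦ hdir j
    _ = d * C ^ (1 / p.toReal) * eLpNorm f p volume := by
        rw [Finset.sum_const, Finset.card_univ, Fintype.card_fin, nsmul_eq_mul, mul_assoc]
    _ ≤ _ := by
        gcongr
        rw [ENNReal.ofReal_add (by positivity) zero_le_one, ENNReal.ofReal_mul (by positivity),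
          ENNReal.ofReal_natCast, ENNReal.ofReal_toReal hC']
        exact le_self_add

theorem theorem2 (d : ℕ) (hd : 1 ≤ d) (p : ℝ≥0∞) (hp₁ : 1 < p) (hp₂ : p < ⊤) (κ β : ℝ) :
    ∃ C : ℝ, 0 < C ∧
      ∀ (μ : Measure (Metric.sphere (0 : EuclideanSpace ℝ (Fin d)) 1)) [IsFiniteMeasure μ],
        SpectralNondegenerate κ μ →
      ∀ b₀ : EuclideanSpace ℝ (Fin d), ‖b₀‖ = β →
      ∀ (Ω : Type*) [MeasurableSpace Ω] (P : Measure Ω) [IsProbabilityMeasure P]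
        (Z : ℝ≥0 → Ω → EuclideanSpace ℝ (Fin d)), IsSymmetricOneStableProcess μ P Z →
      ∀ lam : ℝ, 0 < lam →
      ∀ f : EuclideanSpace ℝ (Fin d) → ℝ, ContDiff ℝ (⊤ : ℕ∞) f → HasCompactSupport f →
        Differentiable ℝ (frozenResolvent P b₀ Z lam f) ∧
        eLpNorm (fderiv ℝ (frozenResolvent P b₀ Z lam f)) p volume
          ≤ ENNReal.ofReal (C * (1 + lam⁻¹)) * eLpNorm f p volume := by
  by_cases hκ : 1 ≤ κ
  swap
  -- Nondegeneracy includes `1 ≤ κ`, so for smaller `κ` there is nothing to prove.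
  · exact ⟨1, one_pos, fun μ _ h ↦ absurd h.1 hκ⟩
  obtain ⟨C, hC0, hC⟩ := exists_eLpNorm_fderiv_dilationResolvent_le d hd hp₁ hp₂ hκ β
  refine ⟨C, hC0, fun μ _ h b₀ hb Ω _ P _ Z hZ lam hlam f hf hfc ↦ ?_⟩
  have hm := hZ.measurable 1
  have hprob : IsProbabilityMeasure (P.map fun ω ↦ Z 1 ω + b₀) :=
    Measure.isProbabilityMeasure_map (by fun_prop)
  have hR : frozenResolvent P b₀ Z lam f
      = dilationResolvent (P.map fun ω ↦ Z 1 ω + b₀) lam f := by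
    ext x
    refine setIntegral_congr_fun measurableSet_Ioi fun t ht ↦ ?_
    rw [hZ.integral_frozenProcess b₀ x _ hf.continuous, Real.coe_toNNReal t (le_of_lt ht)]
  rw [hR]
  refine ⟨fun x ↦ (hasFDerivAt_dilationResolvent hlam hf hfc x).differentiableAt, ?_⟩
  refine (hC μ h b₀ hb _ (fun ζ ↦ ?_) lam hlam f hf hfc).trans ?_
  · rw [hZ.charFun_map, NNReal.coe_one, neg_one_mul]
  -- The estimate obtained is uniform in `lam`; the factor `1 + lam⁻¹ ≥ 1` only weakens it.
  · gcongr
    have : 0 < lam⁻¹ := inv_pos.2 hlam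
    nlinarith
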